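/- Let $N\ge j\ge 1$, let $\Lambda=\mathrm{diag}(\lambda_1,\dots,\lambda_N)$ with $0=\lambda_1<\lambda_2<\dots<\lambda_N$, and let $V(t)=(V_{kl}(t))$, $t\ge 0$, be an $N\times N$ matrix function, locally integrable on $[0,\infty)$, with $V(t)$ Hermitian and $V_{kk}(t)=0$ for all $k$ and almost every $t$. For $k\in\mathbb C$ let $X(t,k)$ be the (absolutely continuous in $t$) solution of $X_t=i(k\Lambda+V(t))X$, $X(0,k)=I$; let $X_j$ denote the leading $j\times j$ block of $X$, and put $$g(t,k)=\det X_j(t,k)\,e^{-ikt(\lambda_1+\dots+\lambda_j)},\qquad I(V)=\sum_{k=1}^{j}\sum_{l=j+1}^{N}|\lambda_l-\lambda_k|^{-1}\int_0^\infty|V_{kl}(\tau)|^2\,d\tau .$$ Assume $I(V)<\infty$, and let $\mathbb C^+=\{k:\operatorname{Im}k>0\}$. Then, as $t\to\infty$, $g(t,\cdot)$ converges, uniformly on compact subsets of $\mathbb C^+$, to a function $g(\infty,\cdot)$ in the unit ball of $H^\infty(\mathbb C^+)$. Moreover $g(t,\cdot)-g(\infty,\cdot)\in H^2(\mathbb C^+)$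 for every $t\ge0$, and $\|g(t,\cdot)-g(\infty,\cdot)\|_{H^2(\mathbb C^+)}\to 0$ as $t\to\infty$. Denoting also by $g(\infty,k)$, $k\in\mathbb R$, the nontangential boundary values (which exist and are nonzero almost everywhere), $\ln|g(\infty,\cdot)|$ is integrable on $\mathbb R$, $$0\ \ge\ \int_{\mathbb R}\ln|g(\infty,k)|\,dk\ \ge\ -\pi I(V),$$ and, for every $1<p<\infty$, $$\int_{\mathbb R}|1-g(\infty,k)|^p\,dk\le C(p)\,I(V),$$ where $C(p)$ depends only on $p$ (not on $N$, $j$, $\Lambda$ or $V$). -/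

import Mathlib

open MeasureTheory Filter Topology Set

noncomputable section

/-- The open upper half-plane `ℂ⁺`, as a subset of `ℂ`. -/
def upperHalf : Set ℂ := {z : ℂ | 0 < z.im}

/-- The norm of the Hardy space `H^p(ℂ⁺)`: the supremum over `y > 0` of the `L^p(ℝ)` norms of
`x ↦ f (x + i y)`. -/
def hardyNorm (p : ENNReal) (f : ℂ → ℂ) : ENNReal :=
  ⨆ (y : ℝ) (_ : 0 < y), eLpNorm (fun x : ℝ => f ((x : ℂ) + (y : ℂ) * Complex.I)) p volume

/-- `f` belongs to the Hardy space `H^p(ℂ⁺)`. -/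
def MemHardy (p : ENNReal) (f : ℂ → ℂ) : Prop :=
  DifferentiableOn ℂ f upperHalf ∧ hardyNorm p f < ⊤

/-- The cone in `ℂ⁺` with vertex at the real point `x` and aperture `α`. -/
def boundaryCone (α x : ℝ) : Set ℂ := {z : ℂ | 0 < z.im ∧ |z.re - x| < α * z.im}

/-- `b : ℝ → ℂ` is the boundary function of `f` on `ℝ`: at almost every real `x`, the function
`f` on `ℂ⁺` has the nontangential limit `b x`. -/
def HasBoundaryFunction (f : ℂ → ℂ) (b : ℝ → ℂ) : Prop :=
  ∀ᵐ x : ℝ, ∀ α : ℝ, 0 < α → Tendsto f (𝓝[boundaryCone α x] (x : ℂ)) (𝓝 (b x))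

/-- `X t k`, `t ≥ 0`, `k ∈ ℂ`, is the solution of the Cauchy problem
`X_t = i (k Λ + V) X`, `X(0) = I`, with `Λ = diag lam`. As `V` is only locally integrable, the
solution is meant in the sense of Carathéodory: `X` is continuous in `t` and satisfies
the integrated equation (written entry by entry). -/
def IsEvolution {N : ℕ} (lam : Fin N → ℝ) (V : ℝ → Matrix (Fin N) (Fin N) ℂ)
    (X : ℝ → ℂ → Matrix (Fin N) (Fin N) ℂ) : Prop :=
  ∀ k : ℂ, ContinuousOn (fun t => X t k) (Ici 0) ∧
    ∀ t : ℝ, 0 ≤ t → ∀ m n : Fin N,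
      X t k m n = (1 : Matrix (Fin N) (Fin N) ℂ) m n +
        ∫ s in (0 : ℝ)..t,
          (Complex.I • ((k • Matrix.diagonal (fun a => (lam a : ℂ)) + V s) * X s k)) m n

/-- The quantity `I(V) = ∑_{k ≤ j < l} |λ_l - λ_k|⁻¹ ∫₀^∞ |V_{kl}|²`, with value in `[0, ∞]`.
Indices of `Fin N` start at `0`, so `k ≤ j < l` reads `k < j ≤ l`. -/
def potentialEnergy {N : ℕ} (j : ℕ) (lam : Fin N → ℝ) (V : ℝ → Matrix (Fin N) (Fin N) ℂ) :
    ENNReal :=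
  ∑ k : Fin N with k.val < j, ∑ l : Fin N with j ≤ l.val,
    ENNReal.ofReal (|lam l - lam k|⁻¹) * ∫⁻ t in Ici (0 : ℝ), ‖V t k l‖ₑ ^ 2

/-- `Δ_j`: the determinant of the leading `j × j` block. -/
def leadingMinor {N j : ℕ} (hj : j ≤ N) (A : Matrix (Fin N) (Fin N) ℂ) : ℂ :=
  (A.submatrix (Fin.castLE hj) (Fin.castLE hj)).det

/-- `g(t, k) = Δ_j(t, k) exp (-i k t (λ_1 + … + λ_j))`. -/
def normalizedMinor {N j : ℕ} (hj : j ≤ N) (lam : Fin N → ℝ)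
    (X : ℝ → ℂ → Matrix (Fin N) (Fin N) ℂ) (t : ℝ) (k : ℂ) : ℂ :=
  leadingMinor hj (X t k) *
    Complex.exp (-(Complex.I * k * (t : ℂ) * ∑ a : Fin j, (lam (Fin.castLE hj a) : ℂ)))

end

/-!
The normalized minor `g(t, k)` of the evolution is studied through the propagator
`U(s, t) = X(s) X(t)⁻¹`.

*The propagator.* For real `k` the matrices `X(t, k)` are unitary, and in general
`X(t, k)⁻¹ = X(t, k̄)*`. Let `u_m(t)` be the minors of the first `j` rows of `U(s, t)` with columns
`m`, normalized by the factor of the free evolution, and let `a(s, t)` be the leading one, so that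
`a(s, 0) = g(s)`. For `Im k > 0` the energy `∑ |u_m|²`, the sum running over all sets of `j`
columns, is at most one, its value at `t = s`, and its derivative controls every single excitation,
in which a column `l ≤ j` is replaced by some `p > j`, with the weight `2 Im k (λ_p - λ_l)`. As `a`
is driven only by the single excitations, `a' = -i ∑ V u`, the Cauchy–Schwarz inequality gives
`2 Im k |1 - a|² ≤ (∫_t^s v) (1 - |a|²)`, where `v = ∑ |V_{lp}|² / (λ_p - λ_l)` has the integral
`I(V)`; see `norm_sq_one_sub_propagatorMinor_le`. Hence `|1 - a| ≤ (∫_t^∞ v) / Im k`. By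
Cauchy–Binet `g(s) - g(t)` is the pairing of the `u_m - δ_m`, where `δ_m` are the minors of the
identity, with minors of `X(t)` of total energy at most one, whence
`|g(s) - g(t)|² ≤ 2 Re (1 - a(s, t))` (`norm_sq_normalizedMinor_sub_le`). These two bounds give the
limit `G`, with `|G| ≤ 1` and `|1 - G| ≤ I(V) / Im k`. The formal sums run over ordered selections
of columns, so that every energy appears with a factor `j!`.

*The half-plane.* All remaining assertions come from evaluating harmonic functions at `i R` and
letting `R → ∞`, where the kernel `R / (x² + R²)`, multiplied by `R`, tends to one, while a function
bounded by `J / Im k` contributes at most `π J`. For `Re (1 - a)`, which is nonnegative,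
this yields mass at most `π ∫_t^∞ v` on every horizontal line, and so the convergence in `H²`. For
`log |G|`, which is subharmonic, Jensen's formula on the disc yields the logarithmic integral
(`log_boundary_integrable`). For `1 < p ≤ 2` the inequality `|w|^p ≤ A (Re w)^p - B Re w^p` in the
right half-plane, applied to `1 - G`, yields the `L^p` bound with a constant depending only on `p`;
for `p > 2` one uses `|1 - G| ≤ 2`. The boundary function exists by Fatou's theorem
(`exists_hasBoundaryFunction`), and the Poisson formula is Cauchy's mean value formula on circles,
carried to the line by the Cayley transform.
-/

/-! ### Absolutely continuous functions with a prescribed derivative -/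

/-- `f` is absolutely continuous on `[0, T]` and `f'` is its derivative at almost every point of
`(0, T)`. -/
def HasACDeriv {F : Type*} [NormedAddCommGroup F] [NormedSpace ℝ F] (f f' : ℝ → F) (T : ℝ) : Prop :=
  AbsolutelyContinuousOnInterval f 0 T ∧ ∀ᵐ t : ℝ, t ∈ Ioo 0 T → HasDerivAt f (f' t) t

namespace HasACDeriv

variable {F : Type*} [NormedAddCommGroup F] [NormedSpace ℝ F] {T : ℝ}

theorem congr_deriv {f f' g' : ℝ → F} (hf : HasACDeriv f f' T)
    (h : ∀ᵐ t : ℝ, t ∈ Ioo 0 T → f' t = g' t) : HasACDeriv f g' T := by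
  refine ⟨hf.1, ?_⟩
  filter_upwards [hf.2, h] with t h1 h2 ht
  rw [← h2 ht]
  exact h1 ht

theorem of_contDiff {f f' : ℝ → F} (hf : ContDiff ℝ 1 f) (h : ∀ t, HasDerivAt f (f' t) t) :
    HasACDeriv f f' T :=
  ⟨hf.contDiffOn.absolutelyContinuousOnInterval, Eventually.of_forall fun t _ => h t⟩

theorem const (c : F) : HasACDeriv (fun _ => c) (fun _ => 0) T :=
  of_contDiff contDiff_const fun t => hasDerivAt_const t c

theorem add {f f' g g' : ℝ → F} (hf : HasACDeriv f f' T) (hg : HasACDeriv g g' T) :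
    HasACDeriv (fun t => f t + g t) (fun t => f' t + g' t) T := by
  refine ⟨hf.1.add hg.1, ?_⟩
  filter_upwards [hf.2, hg.2] with t h1 h2 ht
  exact (h1 ht).add (h2 ht)

theorem smul {M : Type*} [NormedRing M] [NormedAlgebra ℝ M] [Module M F]
    [IsBoundedSMul M F] [NormSMulClass M F] [IsScalarTower ℝ M F] {c c' : ℝ → M} {f f' : ℝ → F}
    (hc : HasACDeriv c c' T) (hf : HasACDeriv f f' T) :
    HasACDeriv (fun t => c t • f t) (fun t => c' t • f t + c t • f' t) T := by
  refine ⟨hc.1.smul hf.1, ?_⟩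
  filter_upwards [hc.2, hf.2] with t h1 h2 ht
  rw [add_comm]
  exact (h1 ht).smul (h2 ht)

theorem mul {f f' g g' : ℝ → ℂ} (hf : HasACDeriv f f' T) (hg : HasACDeriv g g' T) :
    HasACDeriv (fun t => f t * g t) (fun t => f' t * g t + f t * g' t) T :=
  hf.smul hg

theorem const_mul {f f' : ℝ → ℂ} (c : ℂ) (hf : HasACDeriv f f' T) :
    HasACDeriv (fun t => c * f t) (fun t => c * f' t) T := by
  simpa using (const c).mul hf

theorem sum {ι : Type*} {s : Finset ι} {f f' : ι → ℝ → F}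
    (h : ∀ i ∈ s, HasACDeriv (f i) (f' i) T) :
    HasACDeriv (fun t => ∑ i ∈ s, f i t) (fun t => ∑ i ∈ s, f' i t) T := by
  classical
  induction s using Finset.induction_on with
  | empty => simpa using const (0 : F)
  | insert a s ha ih =>
    simp only [Finset.sum_insert ha]
    exact (h a (Finset.mem_insert_self _ _)).add
      (ih fun i hi => h i (Finset.mem_insert_of_mem hi))

theorem prod {ι : Type*} [DecidableEq ι] {s : Finset ι} {f f' : ι → ℝ → ℂ}
    (h : ∀ i ∈ s, HasACDeriv (f i) (f' i) T) :
    HasACDeriv (fun t => ∏ i ∈ s, f i t)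
      (fun t => ∑ i ∈ s, f' i t * ∏ l ∈ s.erase i, f l t) T := by
  induction s using Finset.induction_on with
  | empty => simpa using const (1 : ℂ)
  | insert a s ha ih =>
    simp only [Finset.prod_insert ha]
    refine ((h a (Finset.mem_insert_self _ _)).mul
      (ih fun i hi => h i (Finset.mem_insert_of_mem hi))).congr_deriv (.of_forall fun t _ => ?_)
    rw [Finset.sum_insert ha, Finset.erase_insert ha, Finset.mul_sum]
    congr 1
    refine Finset.sum_congr rfl fun i hi => ?_
    have hia : a ≠ i := fun h => ha (h ▸ hi)
    rw [Finset.erase_insert_of_ne hia, Finset.prod_insert (by simp [ha])]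
    ring

theorem clm_comp {G : Type*} [NormedAddCommGroup G] [NormedSpace ℝ G] {f f' : ℝ → F}
    (L : F →L[ℝ] G) (hf : HasACDeriv f f' T) :
    HasACDeriv (fun t => L (f t)) (fun t => L (f' t)) T := by
  refine ⟨?_, ?_⟩
  · have h := hf.1
    rw [absolutelyContinuousOnInterval_iff] at h ⊢
    intro ε hε
    obtain ⟨δ, hδ, H⟩ := h (ε / (‖L‖ + 1)) (by positivity)
    refine ⟨δ, hδ, fun E hE hs => ?_⟩
    have h1 := H E hE hs
    rw [lt_div_iff₀ (by positivity), mul_comm, Finset.mul_sum] at h1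
    refine lt_of_le_of_lt (Finset.sum_le_sum fun i _ => ?_) h1
    rw [dist_eq_norm, dist_eq_norm, ← map_sub]
    exact (L.le_opNorm _).trans (by gcongr; linarith)
  · filter_upwards [hf.2] with t h1 ht
    exact L.hasFDerivAt.comp_hasDerivAt t (h1 ht)

theorem re {f f' : ℝ → ℂ} (hf : HasACDeriv f f' T) :
    HasACDeriv (fun t => (f t).re) (fun t => (f' t).re) T := hf.clm_comp Complex.reCLM

theorem star {f f' : ℝ → ℂ} (hf : HasACDeriv f f' T) :
    HasACDeriv (fun t => starRingEnd ℂ (f t)) (fun t => starRingEnd ℂ (f' t)) T :=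
  hf.clm_comp (Complex.conjCLE : ℂ →L[ℝ] ℂ)

theorem integral {f : ℝ → ℂ} (hT : 0 ≤ T) (hf : IntervalIntegrable f volume 0 T) :
    HasACDeriv (fun t => ∫ s in (0 : ℝ)..t, f s) f T := by
  refine ⟨?_, ?_⟩
  · have hr : IntervalIntegrable (fun s => (f s).re) volume 0 T :=
      ⟨hf.1.re, hf.2.re⟩
    have hi : IntervalIntegrable (fun s => (f s).im) volume 0 T :=
      ⟨hf.1.im, hf.2.im⟩
    -- the absolute continuity of an indefinite integral is available for real functions
    have h1 := hr.absolutelyContinuousOnInterval_intervalIntegral (c := 0) left_mem_uIcc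
    have h2 := hi.absolutelyContinuousOnInterval_intervalIntegral (c := 0) left_mem_uIcc
    have hc : ∀ c : ℂ, AbsolutelyContinuousOnInterval (fun _ : ℝ => c) 0 T := fun c =>
      (contDiff_const (c := c)).contDiffOn.absolutelyContinuousOnInterval
    have h3 := (h1.smul (hc 1)).add (h2.smul (hc Complex.I))
    rw [absolutelyContinuousOnInterval_iff] at h3 ⊢
    intro ε hε
    obtain ⟨δ, hδ, H⟩ := h3 ε hε
    refine ⟨δ, hδ, fun E hE hs => ?_⟩
    have key : ∀ t ∈ uIcc 0 T, (∫ s in (0 : ℝ)..t, f s) =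
        ((((fun t => ∫ s in (0 : ℝ)..t, (f s).re) : ℝ → ℝ) • ((fun _ => 1) : ℝ → ℂ)) +
          ((fun t => ∫ s in (0 : ℝ)..t, (f s).im) : ℝ → ℝ) •
            ((fun _ => Complex.I) : ℝ → ℂ)) t := by
      intro t ht
      have hft : IntervalIntegrable f volume 0 t :=
        hf.mono_set (uIcc_subset_uIcc left_mem_uIcc ht)
      have e1 := Complex.reCLM.intervalIntegral_comp_comm hft
      have e2 := Complex.imCLM.intervalIntegral_comp_comm hft
      simp only [Complex.reCLM_apply, Complex.imCLM_apply] at e1 e2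
      simp only [Pi.add_apply, Pi.smul_apply', e1, e2, Complex.real_smul, mul_one,
        Complex.re_add_im]
    refine lt_of_eq_of_lt (Finset.sum_congr rfl fun i hi => ?_) (H E hE hs)
    have := hE.1 i (by simpa using hi)
    rw [key _ this.1, key _ this.2]
  · filter_upwards [hf.ae_hasDerivAt_integral] with t ht h
    exact ht (by rw [uIcc_of_le hT]; exact Ioo_subset_Icc_self h) 0 left_mem_uIcc

theorem congr {f g f' : ℝ → F} (hT : 0 ≤ T) (hf : HasACDeriv f f' T)
    (h : ∀ t ∈ Icc 0 T, f t = g t) : HasACDeriv g f' T := by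
  refine ⟨?_, ?_⟩
  · have h3 := hf.1
    rw [absolutelyContinuousOnInterval_iff] at h3 ⊢
    intro ε hε
    obtain ⟨δ, hδ, H⟩ := h3 ε hε
    refine ⟨δ, hδ, fun E hE hs => ?_⟩
    refine lt_of_eq_of_lt (Finset.sum_congr rfl fun i hi => ?_) (H E hE hs)
    have := hE.1 i (by simpa using hi)
    rw [uIcc_of_le hT] at this
    rw [h _ this.1, h _ this.2]
  · filter_upwards [hf.2] with t h1 ht
    refine (h1 ht).congr_of_eventuallyEq ?_
    filter_upwards [Ioo_mem_nhds ht.1 ht.2] with u hu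
    exact (h u (Ioo_subset_Icc_self hu)).symm

theorem continuousOn {f f' : ℝ → F} (hT : 0 ≤ T) (hf : HasACDeriv f f' T) :
    ContinuousOn f (Icc 0 T) := by
  simpa [uIcc_of_le hT] using hf.1.continuousOn

theorem eq_of_deriv_zero {f f' : ℝ → F} (hT : 0 ≤ T) (hf : HasACDeriv f f' T)
    (h : ∀ᵐ t : ℝ, t ∈ Ioo 0 T → f' t = 0) {t u : ℝ} (ht : t ∈ Icc 0 T) (hu : u ∈ Icc 0 T) :
    f t = f u := by
  have hne : ∀ c : ℝ, ∀ᵐ t : ℝ, t ≠ c := fun c => by simp [ae_iff, measure_singleton]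
  obtain ⟨C, hC⟩ := hf.1.const_of_ae_hasDerivAt_zero (by
    rw [uIcc_of_le hT]
    filter_upwards [hf.2, h, hne 0, hne T] with t h1 h2 h3 h4 ht
    have ht' : t ∈ Ioo 0 T := ⟨lt_of_le_of_ne ht.1 h3.symm, lt_of_le_of_ne ht.2 h4⟩
    simpa [h2 ht'] using h1 ht')
  rw [uIcc_of_le hT] at hC
  rw [hC t ht, hC u hu]

/-- Two absolutely continuous functions with the same derivative differ by a constant. -/
theorem sub_eq_sub {f g f' g' : ℝ → F} (hT : 0 ≤ T) (hf : HasACDeriv f f' T)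
    (hg : HasACDeriv g g' T) (h : ∀ᵐ t : ℝ, t ∈ Ioo 0 T → f' t = g' t)
    {t u : ℝ} (ht : t ∈ Icc 0 T) (hu : u ∈ Icc 0 T) : f t - f u = g t - g u := by
  have := (hf.add (hg.clm_comp (-(ContinuousLinearMap.id ℝ F)))).eq_of_deriv_zero hT (by
    filter_upwards [h] with t h ht
    simp [h ht]) ht hu
  simp only [neg_apply, ContinuousLinearMap.id_apply] at this
  rw [sub_eq_sub_iff_add_eq_add]
  calc f t + g u = (f t + -g t) + g t + g u := by abel
    _ = (f u + -g u) + g t + g u := by rw [this]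
    _ = g t + f u := by abel

theorem integral_eq_sub {f f' : ℝ → ℂ} (hf : HasACDeriv f f' T)
    (hi : IntervalIntegrable f' volume 0 T) {t u : ℝ} (ht : t ∈ Icc 0 T) (hu : u ∈ Icc 0 T) :
    ∫ s in t..u, f' s = f u - f t := by
  have hT : 0 ≤ T := ht.1.trans ht.2
  have := hf.sub_eq_sub hT (HasACDeriv.integral hT hi) (.of_forall fun _ _ => rfl) hu ht
  have hmem : ∀ r ∈ Icc 0 T, IntervalIntegrable f' volume 0 r := fun r hr =>
    hi.mono_set (uIcc_subset_uIcc left_mem_uIcc (by rwa [uIcc_of_le hT]))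
  rw [this, intervalIntegral.integral_interval_sub_left (hmem _ hu) (hmem _ ht)]

theorem integral_eq_sub_real {f f' : ℝ → ℝ} (hf : HasACDeriv f f' T)
    {t u : ℝ} (ht : t ∈ Icc 0 T) (hu : u ∈ Icc 0 T) :
    ∫ s in t..u, f' s = f u - f t := by
  have hT : 0 ≤ T := ht.1.trans ht.2
  have h := (hf.1.mono (c := t) (d := u)
    (by apply uIcc_subset_uIcc <;> rwa [uIcc_of_le hT])).integral_deriv_eq_sub
  rw [← h]
  refine intervalIntegral.integral_congr_ae ?_
  have hne : ∀ c : ℝ, ∀ᵐ t : ℝ, t ≠ c := fun c => by simp [ae_iff, measure_singleton]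
  filter_upwards [hf.2, hne 0, hne T] with r h1 h3 h4 hr
  have hr' : r ∈ Icc 0 T := by
    have := uIoc_subset_uIcc hr
    have h5 : uIcc t u ⊆ uIcc 0 T := by apply uIcc_subset_uIcc <;> rwa [uIcc_of_le hT]
    rw [uIcc_of_le hT] at h5
    exact h5 this
  exact (h1 ⟨lt_of_le_of_ne hr'.1 h3.symm, lt_of_le_of_ne hr'.2 h4⟩).deriv.symm

/-- The derivative of a determinant, column by column. -/
theorem det {n : Type*} [Fintype n] [DecidableEq n] {A A' : ℝ → Matrix n n ℂ}
    (h : ∀ a b, HasACDeriv (fun t => A t a b) (fun t => A' t a b) T) :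
    HasACDeriv (fun t => (A t).det)
      (fun t => ∑ b, ((A t).updateCol b fun a => A' t a b).det) T := by
  simp only [Matrix.det_apply']
  have hσ : ∀ σ : Equiv.Perm n, HasACDeriv
      (fun t => ((Equiv.Perm.sign σ : ℤ) : ℂ) * ∏ i, A t (σ i) i)
      (fun t => ((Equiv.Perm.sign σ : ℤ) : ℂ) *
        ∑ i, A' t (σ i) i * ∏ l ∈ Finset.univ.erase i, A t (σ l) l) T := fun σ =>
    (HasACDeriv.prod (f := fun i t => A t (σ i) i) (f' := fun i t => A' t (σ i) i)
      fun i _ => h (σ i) i).const_mul _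
  refine (HasACDeriv.sum fun σ _ => hσ σ).congr_deriv (.of_forall fun t _ => ?_)
  simp only [Finset.mul_sum]
  rw [Finset.sum_comm]
  refine Finset.sum_congr rfl fun b _ => Finset.sum_congr rfl fun σ _ => ?_
  congr 1
  rw [← Finset.mul_prod_erase Finset.univ _ (Finset.mem_univ b)]
  congr 1
  · simp
  · refine Finset.prod_congr rfl fun i hi => ?_
    rw [Matrix.updateCol_ne (Finset.ne_of_mem_erase hi)]

end HasACDeriv

/-! ### Minors indexed by arbitrary column selections -/

section Minors

variable {n ι : Type*} [Fintype n] [DecidableEq n]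

/-- The minor of `A` formed by all of its rows and by the columns `m a`, in this order and with
possible repetitions. As a function of `m` it is the antisymmetric tensor given by the exterior
product of the rows of `A`; every minor occurs `n!` times up to sign. -/
noncomputable def colMinor (A : Matrix n ι ℂ) (m : n → ι) : ℂ := (A.submatrix id m).det

theorem colMinor_comp_perm (A : Matrix n ι ℂ) (m : n → ι) (σ : Equiv.Perm n) :
    colMinor A (m ∘ σ) = (Equiv.Perm.sign σ : ℤ) * colMinor A m :=
  Matrix.det_permute' σ (A.submatrix id m)

theorem norm_colMinor_comp_perm (A : Matrix n ι ℂ) (m : n → ι) (σ : Equiv.Perm n) :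
    ‖colMinor A (m ∘ σ)‖ = ‖colMinor A m‖ := by
  rw [colMinor_comp_perm, norm_mul]
  rcases Int.units_eq_one_or (Equiv.Perm.sign σ) with h | h <;> simp [h]

theorem colMinor_eq_zero (A : Matrix n ι ℂ) {m : n → ι} (hm : ¬ Function.Injective m) :
    colMinor A m = 0 := by
  simp only [Function.Injective, not_forall] at hm
  obtain ⟨a, b, hab, hne⟩ := hm
  exact Matrix.det_zero_of_column_eq hne fun i => by simp [hab]

variable [Fintype ι]

/-- The Cauchy–Binet formula, with the sum taken over all column selections. -/
theorem factorial_mul_det_mul (A : Matrix n ι ℂ) (B : Matrix ι n ℂ) :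
    ((Fintype.card n).factorial : ℂ) * (A * B).det =
      ∑ m : n → ι, colMinor A m * colMinor B.transpose m := by
  have h1 : (A * B).det = ∑ m : n → ι, (∏ a, A a (m a)) * colMinor B.transpose m := by
    rw [← Matrix.det_transpose, Matrix.det_apply']
    simp only [Matrix.transpose_apply, Matrix.mul_apply, Finset.prod_univ_sum,
      Fintype.piFinset_univ, Finset.mul_sum]
    rw [Finset.sum_comm]
    refine Finset.sum_congr rfl fun m _ => ?_
    rw [colMinor, Matrix.det_apply', Finset.mul_sum]
    refine Finset.sum_congr rfl fun σ _ => ?_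
    rw [Finset.prod_mul_distrib]
    simp only [Matrix.submatrix_apply, id, Matrix.transpose_apply]
    ring
  have h2 : ∀ σ : Equiv.Perm n, (A * B).det = ∑ m : n → ι,
      ((Equiv.Perm.sign σ : ℤ) * ∏ a, A (σ a) (m a)) * colMinor B.transpose m := by
    intro σ
    rw [h1, ← Equiv.sum_comp (Equiv.arrowCongr σ.symm (Equiv.refl ι)).symm]
    refine Finset.sum_congr rfl fun m _ => ?_
    have e : (Equiv.arrowCongr σ.symm (Equiv.refl ι)).symm m = m ∘ (σ⁻¹ : Equiv.Perm n) := by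
      ext a; simp [Equiv.arrowCongr]
    rw [e, colMinor_comp_perm, Equiv.Perm.sign_inv]
    have : ∏ a, A a ((m ∘ (σ⁻¹ : Equiv.Perm n)) a) = ∏ a, A (σ a) (m a) := by
      rw [← Equiv.prod_comp σ]
      simp
    rw [this]
    ring
  have h3 : ((Fintype.card n).factorial : ℂ) * (A * B).det =
      ∑ _σ : Equiv.Perm n, (A * B).det := by
    rw [Finset.sum_const, Finset.card_univ, Fintype.card_perm, nsmul_eq_mul]
  rw [h3, Finset.sum_congr rfl fun σ _ => h2 σ, Finset.sum_comm]
  refine Finset.sum_congr rfl fun m _ => ?_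
  rw [← Finset.sum_mul]
  congr 1
  rw [colMinor, Matrix.det_apply']
  rfl

/-- A Hermitian matrix acts on tensors, as a derivation, by a Hermitian operator. -/
theorem conj_sum_update {W : Matrix ι ι ℂ} (hW : W.IsHermitian) (u : (n → ι) → ℂ) :
    starRingEnd ℂ (∑ m, starRingEnd ℂ (u m) *
        ∑ a, ∑ p, W p (m a) * u (Function.update m a p)) =
      ∑ m, starRingEnd ℂ (u m) * ∑ a, ∑ p, W p (m a) * u (Function.update m a p) := by
  have hs : ∀ f : (n → ι) → n → ι → ℂ, ∑ m, starRingEnd ℂ (u m) * ∑ a, ∑ p, f m a p =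
      ∑ a, ∑ x : (n → ι) × ι, starRingEnd ℂ (u x.1) * f x.1 a x.2 := by
    intro f
    simp only [Finset.mul_sum]
    rw [Finset.sum_comm]
    exact Finset.sum_congr rfl fun a _ => (Fintype.sum_prod_type
      fun x : (n → ι) × ι => starRingEnd ℂ (u x.1) * f x.1 a x.2).symm
  rw [hs (fun m a p => W p (m a) * u (Function.update m a p)), map_sum]
  refine Finset.sum_congr rfl fun a _ => ?_
  rw [map_sum]
  let E : (n → ι) × ι ≃ (n → ι) × ι :=
    { toFun := fun x => (Function.update x.1 a x.2, x.1 a)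
      invFun := fun x => (Function.update x.1 a x.2, x.1 a)
      left_inv := fun x => by simp
      right_inv := fun x => by simp }
  rw [← Equiv.sum_comp E]
  refine Finset.sum_congr rfl fun x _ => ?_
  simp only [E, Equiv.coe_fn_mk, map_mul, Complex.conj_conj, Function.update_self,
    Function.update_idem, Function.update_eq_self]
  have := hW.apply (x.2) (x.1 a)
  rw [← this, Complex.star_def]
  ring

end Minors

section Ordering

variable {N j : ℕ} (hj : j ≤ N) {lam : Fin N → ℝ}

/-- A sum of `j` distinct eigenvalues is at least the sum of the `j` smallest ones. -/
theorem sum_castLE_le_sum (hlam : Monotone lam) {m : Fin j → Fin N} (hm : Function.Injective m) :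
    ∑ a : Fin j, lam (Fin.castLE hj a) ≤ ∑ a, lam (m a) := by
  have hc : (Finset.univ.image m).card = j := by
    rw [Finset.card_image_of_injective _ hm]; simp
  have h1 : ∑ a, lam (m a) = ∑ x ∈ Finset.univ.image m, lam x := by
    rw [Finset.sum_image fun x _ y _ h => hm h]
  have h2 : ∑ x ∈ Finset.univ.image m, lam x =
      ∑ a : Fin j, lam ((Finset.univ.image m).orderEmbOfFin hc a) := by
    rw [← Finset.sum_coe_sort, ← Equiv.sum_comp
      ((Finset.univ.image m).orderIsoOfFin hc).toEquiv]
    rfl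
  rw [h1, h2]
  refine Finset.sum_le_sum fun a _ => hlam ?_
  -- the `a`-th smallest element of a set of indices is at least `a`
  rw [Fin.le_def]
  simp only [Fin.val_castLE]
  obtain ⟨a, ha⟩ := a
  induction a with
  | zero => exact Nat.zero_le _
  | succ b ih =>
    have hb : b < j := (Nat.lt_succ_self b).trans ha
    have : (Finset.univ.image m).orderEmbOfFin hc ⟨b, hb⟩ <
        (Finset.univ.image m).orderEmbOfFin hc ⟨b + 1, ha⟩ :=
      ((Finset.univ.image m).orderEmbOfFin hc).strictMono (Fin.mk_lt_mk.2 (Nat.lt_succ_self b))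
    have h3 := ih hb (Finset.mem_univ _)
    rw [Fin.lt_def] at this
    exact Nat.succ_le_of_lt (lt_of_le_of_lt h3 this)

theorem sum_update_castLE (a : Fin j) (p : Fin N) :
    ∑ b, lam (Function.update (Fin.castLE hj) a p b) =
      (∑ b, lam (Fin.castLE hj b)) + (lam p - lam (Fin.castLE hj a)) := by
  rw [← Finset.add_sum_erase _ _ (Finset.mem_univ a),
    ← Finset.add_sum_erase (f := fun b => lam (Fin.castLE hj b)) _ (Finset.mem_univ a)]
  have : ∀ b ∈ Finset.univ.erase a, lam (Function.update (Fin.castLE hj) a p b) =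
      lam (Fin.castLE hj b) := fun b hb => by
    rw [Function.update_of_ne (Finset.ne_of_mem_erase hb)]
  rw [Finset.sum_congr rfl this, Function.update_self]
  ring

/-- The single excitations `a ↦ p`, `a < j ≤ p`, together with their reorderings, are distinct
column selections, hence their energy is bounded by the total energy. -/
theorem factorial_mul_sum_excitations_le (hlam : Monotone lam) (A : Matrix (Fin j) (Fin N) ℂ) :
    (j.factorial : ℝ) * ∑ a : Fin j, ∑ p : Fin N with j ≤ p.val,
        (lam p - lam (Fin.castLE hj a)) *
          ‖colMinor A (Function.update (Fin.castLE hj) a p)‖ ^ 2 ≤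
      ∑ m : Fin j → Fin N, ((∑ a, lam (m a)) - ∑ a : Fin j, lam (Fin.castLE hj a)) *
        ‖colMinor A m‖ ^ 2 := by
  classical
  set f : (Fin j → Fin N) → ℝ := fun m =>
    ((∑ a, lam (m a)) - ∑ a : Fin j, lam (Fin.castLE hj a)) * ‖colMinor A m‖ ^ 2 with hf
  have hf0 : ∀ m, 0 ≤ f m := by
    intro m
    by_cases hm : Function.Injective m
    · exact mul_nonneg (sub_nonneg.2 (sum_castLE_le_sum hj hlam hm)) (sq_nonneg _)
    · simp [hf, colMinor_eq_zero A hm]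
  let S : Finset ((Fin j × Fin N) × Equiv.Perm (Fin j)) :=
    (Finset.univ ×ˢ Finset.univ.filter fun p : Fin N => j ≤ p.val) ×ˢ Finset.univ
  let φ : (Fin j × Fin N) × Equiv.Perm (Fin j) → (Fin j → Fin N) :=
    fun x => Function.update (Fin.castLE hj) x.1.1 x.1.2 ∘ x.2
  have hval : ∀ x, f (φ x) = (lam x.1.2 - lam (Fin.castLE hj x.1.1)) *
      ‖colMinor A (Function.update (Fin.castLE hj) x.1.1 x.1.2)‖ ^ 2 := by
    intro x
    simp only [hf, φ, norm_colMinor_comp_perm]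
    congr 1
    simp only [Function.comp_apply]
    rw [Equiv.sum_comp x.2 fun b => lam (Function.update (Fin.castLE hj) x.1.1 x.1.2 b),
      sum_update_castLE]
    ring
  have hinj : Set.InjOn φ S := by
    rintro ⟨⟨a, p⟩, σ⟩ h1 ⟨⟨b, q⟩, τ⟩ h2 h
    simp only [S, Finset.coe_product, Set.mem_prod, Finset.mem_coe,
      Finset.mem_univ, Finset.mem_filter, true_and, and_true] at h1 h2
    have key : ∀ c, Function.update (Fin.castLE hj) a p (σ c) =
        Function.update (Fin.castLE hj) b q (τ c) := fun c => congrFun h c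
    have hlt : ∀ c : Fin j, (Fin.castLE hj c).val < j := fun c => c.2
    have e1 : ∀ c, σ c = a ↔ τ c = b := by
      intro c
      have := key c
      constructor
      · intro hc
        by_contra hc'
        rw [hc, Function.update_self, Function.update_of_ne hc'] at this
        have := hlt (τ c); omega
      · intro hc
        by_contra hc'
        rw [hc, Function.update_self, Function.update_of_ne hc'] at this
        have := hlt (σ c); omega
    have e2 : ∀ c, σ c ≠ a → σ c = τ c := by
      intro c hc
      have := key c
      rw [Function.update_of_ne hc, Function.update_of_ne (fun h => hc ((e1 c).2 h))] at this
      exact Fin.castLE_injective hj this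
    have e3 : p = q := by
      have := key (σ.symm a)
      rwa [Equiv.apply_symm_apply, (e1 _).1 (Equiv.apply_symm_apply σ a), Function.update_self,
        Function.update_self] at this
    have e4 : a = b := by
      -- `b` cannot be attained by `σ` away from `σ⁻¹ a`, since there `σ` and `τ` agree
      by_contra hab
      have hs : σ (σ.symm b) ≠ a := by simpa using fun h => hab h.symm
      have h5 := e2 _ hs
      rw [Equiv.apply_symm_apply] at h5
      exact hs ((e1 _).2 h5.symm)
    have e5 : σ = τ := by
      ext c
      by_cases hc : σ c = a
      · rw [hc, (e1 c).1 hc, e4]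
      · rw [e2 c hc]
    simp [e3, e4, e5]
  calc (j.factorial : ℝ) * ∑ a : Fin j, ∑ p : Fin N with j ≤ p.val,
        (lam p - lam (Fin.castLE hj a)) *
          ‖colMinor A (Function.update (Fin.castLE hj) a p)‖ ^ 2
      = ∑ x ∈ S, f (φ x) := by
        rw [Finset.sum_congr rfl fun x _ => hval x, Finset.sum_product, Finset.sum_product,
          Finset.mul_sum]
        refine Finset.sum_congr rfl fun a _ => ?_
        rw [Finset.mul_sum]
        refine Finset.sum_congr rfl fun p _ => ?_
        simp [Fintype.card_perm]
    _ = ∑ m ∈ S.image φ, f m := (Finset.sum_image hinj).symm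
    _ ≤ ∑ m, f m := Finset.sum_le_univ_sum_of_nonneg hf0

end Ordering

/-! ### Dissipation of energy for the minors -/

/-- If `u' = σ i (k M u + H u)` with `M` real diagonal and `H` Hermitian, then only the imaginary
part of `k` contributes to the derivative of the energy `∑ |u_m|²`. -/
theorem HasACDeriv.sum_norm_sq {κ : Type*} [Fintype κ] {u Hu : κ → ℝ → ℂ} {M : κ → ℝ}
    {σ T : ℝ} {k : ℂ}
    (hu : ∀ m, HasACDeriv (u m) (fun t => σ * Complex.I * (k * M m * u m t + Hu m t)) T)
    (hH : ∀ᵐ t : ℝ, t ∈ Ioo 0 T → starRingEnd ℂ (∑ m, starRingEnd ℂ (u m t) * Hu m t) =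
      ∑ m, starRingEnd ℂ (u m t) * Hu m t) :
    HasACDeriv (fun t => ∑ m, ‖u m t‖ ^ 2)
      (fun t => -2 * σ * k.im * ∑ m, M m * ‖u m t‖ ^ 2) T := by
  have h1 := (HasACDeriv.sum (s := Finset.univ) fun m _ => (hu m).star.mul (hu m)).re
  have e1 : ∀ t, (∑ m, starRingEnd ℂ (u m t) * u m t).re = ∑ m, ‖u m t‖ ^ 2 := by
    intro t
    rw [Complex.re_sum]
    refine Finset.sum_congr rfl fun m _ => ?_
    rw [mul_comm, Complex.mul_conj, Complex.ofReal_re, Complex.normSq_eq_norm_sq]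
  simp only [e1] at h1
  refine h1.congr_deriv ?_
  filter_upwards [hH] with t ht h
  set q := ∑ m, starRingEnd ℂ (u m t) * Hu m t with hq
  have hqi : q.im = 0 := Complex.conj_eq_iff_im.1 (ht h)
  set P : ℝ := ∑ m, M m * ‖u m t‖ ^ 2 with hP
  have hPc : (P : ℂ) = ∑ m, starRingEnd ℂ (u m t) * (M m * u m t) := by
    rw [hP]
    push_cast
    refine Finset.sum_congr rfl fun m _ => ?_
    rw [← Complex.ofReal_pow, ← Complex.normSq_eq_norm_sq, ← Complex.mul_conj]
    ring
  have e2 : ∑ m, (starRingEnd ℂ (σ * Complex.I * (k * M m * u m t + Hu m t)) * u m t +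
      starRingEnd ℂ (u m t) * (σ * Complex.I * (k * M m * u m t + Hu m t))) =
      starRingEnd ℂ (σ * Complex.I * (k * P + q)) + σ * Complex.I * (k * P + q) := by
    have : σ * Complex.I * (k * P + q) = ∑ m, starRingEnd ℂ (u m t) *
        (σ * Complex.I * (k * M m * u m t + Hu m t)) := by
      rw [hPc, hq, Finset.mul_sum, ← Finset.sum_add_distrib, Finset.mul_sum]
      exact Finset.sum_congr rfl fun m _ => by ring
    rw [this, map_sum, ← Finset.sum_add_distrib]
    refine Finset.sum_congr rfl fun m _ => ?_
    rw [map_mul (starRingEnd ℂ) (starRingEnd ℂ (u m t)), Complex.conj_conj]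
    ring
  rw [e2, Complex.add_re, Complex.conj_re]
  simp [hqi]
  ring

section RowEvolution

variable {N j : ℕ} {lam : Fin N → ℝ} {A : ℝ → Matrix (Fin j) (Fin N) ℂ}
  {W : ℝ → Matrix (Fin N) (Fin N) ℂ} {σ T : ℝ} {k : ℂ}

/-- The equation `A' = σ i A (k Λ + W)` acts on the maximal minors of `A` as a derivation. -/
theorem HasACDeriv.colMinor
    (hA : ∀ a b, HasACDeriv (fun t => A t a b) (fun t => σ * Complex.I *
      (k * lam b * A t a b + ∑ p, A t a p * W t p b)) T) (m : Fin j → Fin N) :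
    HasACDeriv (fun t => colMinor (A t) m) (fun t => σ * Complex.I *
      (k * (∑ a, lam (m a) : ℝ) * colMinor (A t) m +
        ∑ a, ∑ p, W t p (m a) * colMinor (A t) (Function.update m a p))) T := by
  have h1 := HasACDeriv.det (A := fun t => (A t).submatrix id m)
    (A' := fun t => Matrix.of fun a b => σ * Complex.I *
      (k * lam (m b) * A t a (m b) + ∑ p, A t a p * W t p (m b))) (T := T)
    fun a b => hA a (m b)
  refine h1.congr_deriv (.of_forall fun t _ => ?_)
  have hcol : ∀ (b : Fin j) (p : Fin N), ((A t).submatrix id m).updateCol b (fun a => A t a p) =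
      (A t).submatrix id (Function.update m b p) := by
    intro b p
    ext a c
    by_cases hc : c = b
    · subst hc; simp
    · simp [Matrix.updateCol_ne hc, Function.update_of_ne hc]
  have hself : ∀ b : Fin j, ((A t).submatrix id m).updateCol b (fun a => A t a (m b)) =
      (A t).submatrix id m := by
    intro b
    rw [hcol, Function.update_eq_self]
  have hb : ∀ b : Fin j, (((A t).submatrix id m).updateCol b fun a => σ * Complex.I *
      (k * lam (m b) * A t a (m b) + ∑ p, A t a p * W t p (m b))).det =
      σ * Complex.I * (k * lam (m b) * _root_.colMinor (A t) m +
        ∑ p, W t p (m b) * _root_.colMinor (A t) (Function.update m b p)) := by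
    intro b
    have hv : (fun a => σ * Complex.I *
        (k * lam (m b) * A t a (m b) + ∑ p, A t a p * W t p (m b))) =
        (σ * Complex.I) • ((k * lam (m b)) • (fun a => A t a (m b)) +
          ∑ p, W t p (m b) • (fun a => A t a p)) := by
      ext a
      simp only [Pi.smul_apply, Pi.add_apply, Finset.sum_apply, smul_eq_mul]
      congr 2
      exact Finset.sum_congr rfl fun p _ => mul_comm _ _
    rw [hv, Matrix.det_updateCol_smul, Matrix.det_updateCol_add, Matrix.det_updateCol_smul, hself]
    congr 2
    have hl : ∀ s : Finset (Fin N), (((A t).submatrix id m).updateCol b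
        (∑ p ∈ s, W t p (m b) • (fun a => A t a p))).det =
        ∑ p ∈ s, W t p (m b) * _root_.colMinor (A t) (Function.update m b p) := by
      intro s
      classical
      induction s using Finset.induction_on with
      | empty =>
        refine Matrix.det_eq_zero_of_column_eq_zero b fun i => ?_
        simp
      | insert p s hp ih =>
        rw [Finset.sum_insert hp, Finset.sum_insert hp, Matrix.det_updateCol_add, ih,
          Matrix.det_updateCol_smul, hcol]
        rfl
    exact hl _
  simp only [Matrix.of_apply]
  rw [Finset.sum_congr rfl fun b _ => hb b, ← Finset.mul_sum, Finset.sum_add_distrib]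
  congr 2
  push_cast
  rw [Finset.mul_sum, Finset.sum_mul]

variable (hj : j ≤ N)

/-- The maximal minors of `A`, normalized by the factor `exp (-σ i k μ (t - t₀))`,
`μ = λ_1 + … + λ_j`, which removes the free evolution of the leading minor. -/
noncomputable def normMinor (lam : Fin N → ℝ) (A : ℝ → Matrix (Fin j) (Fin N) ℂ) (σ : ℝ) (k : ℂ)
    (t₀ : ℝ) (m : Fin j → Fin N) (t : ℝ) : ℂ :=
  Complex.exp (-(σ * Complex.I * k * (∑ a : Fin j, lam (Fin.castLE hj a) : ℝ) * (t - t₀))) *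
    colMinor (A t) m

/-- The excess of the sum of the selected eigenvalues over the sum of the `j` smallest ones. -/
noncomputable def excess (lam : Fin N → ℝ) (m : Fin j → Fin N) : ℝ :=
  (∑ a, lam (m a)) - ∑ a : Fin j, lam (Fin.castLE hj a)

/-- After the normalization the spectral parameter acts through the excess, which is nonnegative on
the selections of distinct columns. -/
theorem HasACDeriv.normMinor
    (hA : ∀ a b, HasACDeriv (fun t => A t a b) (fun t => σ * Complex.I *
      (k * lam b * A t a b + ∑ p, A t a p * W t p b)) T) (t₀ : ℝ) (m : Fin j → Fin N) :
    HasACDeriv (normMinor hj lam A σ k t₀ m) (fun t => σ * Complex.I *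
      (k * excess hj lam m * normMinor hj lam A σ k t₀ m t +
        ∑ a, ∑ p, W t p (m a) * normMinor hj lam A σ k t₀ (Function.update m a p) t)) T := by
  set μ : ℝ := ∑ a : Fin j, lam (Fin.castLE hj a) with hμ
  set ω : ℂ := -(σ * Complex.I * k * μ) with hω
  have hexp : HasACDeriv (fun t : ℝ => Complex.exp (-(σ * Complex.I * k * μ * (t - t₀))))
      (fun t => ω * Complex.exp (-(σ * Complex.I * k * μ * (t - t₀)))) T := by
    refine HasACDeriv.of_contDiff ?_ fun t => ?_
    · have : ContDiff ℝ 1 fun t : ℝ => -(σ * Complex.I * k * μ * ((t : ℂ) - t₀)) :=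
        (contDiff_const.mul (Complex.ofRealCLM.contDiff.sub contDiff_const)).neg
      exact this.cexp
    · have h1 : HasDerivAt (fun t : ℝ => -(σ * Complex.I * k * μ * ((t : ℂ) - t₀))) ω t := by
        have := ((Complex.ofRealCLM.hasDerivAt (x := t)).sub_const (t₀ : ℂ)).const_mul
          (σ * Complex.I * k * μ) |>.neg
        simpa [hω] using! this
      exact h1.cexp.congr_deriv (mul_comm _ _)
  refine (hexp.mul (HasACDeriv.colMinor hA m)).congr_deriv (.of_forall fun t _ => ?_)
  have hsum : ∑ a, ∑ p, W t p (m a) *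
      _root_.normMinor hj lam A σ k t₀ (Function.update m a p) t =
      Complex.exp (-(σ * Complex.I * k * μ * (t - t₀))) *
        ∑ a, ∑ p, W t p (m a) * _root_.colMinor (A t) (Function.update m a p) := by
    rw [Finset.mul_sum]
    refine Finset.sum_congr rfl fun a _ => ?_
    rw [Finset.mul_sum]
    refine Finset.sum_congr rfl fun p _ => ?_
    rw [_root_.normMinor]
    ring
  rw [hsum, excess, _root_.normMinor, ← hμ, hω]
  push_cast
  ring

/-- The energy balance for the normalized minors; the sign `σ` gives the direction of decay when
`Im k > 0`. -/
theorem HasACDeriv.sum_norm_sq_normMinor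
    (hA : ∀ a b, HasACDeriv (fun t => A t a b) (fun t => σ * Complex.I *
      (k * lam b * A t a b + ∑ p, A t a p * W t p b)) T)
    (hW : ∀ᵐ t : ℝ, t ∈ Ioo 0 T → (W t).IsHermitian) (t₀ : ℝ) :
    HasACDeriv (fun t => ∑ m, ‖_root_.normMinor hj lam A σ k t₀ m t‖ ^ 2)
      (fun t => -2 * σ * k.im *
        ∑ m, excess hj lam m * ‖_root_.normMinor hj lam A σ k t₀ m t‖ ^ 2) T := by
  refine HasACDeriv.sum_norm_sq (fun m => HasACDeriv.normMinor hj hA t₀ m) ?_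
  filter_upwards [hW] with t h ht
  exact conj_sum_update (h ht) fun m => _root_.normMinor hj lam A σ k t₀ m t

theorem excess_mul_norm_sq_nonneg (hlam : Monotone lam) (t₀ t : ℝ) (m : Fin j → Fin N) :
    0 ≤ excess hj lam m * ‖normMinor hj lam A σ k t₀ m t‖ ^ 2 := by
  by_cases hm : Function.Injective m
  · exact mul_nonneg (sub_nonneg.2 (sum_castLE_le_sum hj hlam hm)) (sq_nonneg _)
  · simp [normMinor, colMinor_eq_zero _ hm]

/-- The minors of the first `j` rows of the identity matrix: `± 1` on the reorderings of the leading
columns, and `0` otherwise. -/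
noncomputable def idMinor (m : Fin j → Fin N) : ℂ :=
  colMinor ((1 : Matrix (Fin N) (Fin N) ℂ).submatrix (Fin.castLE hj) id) m

theorem conj_idMinor (m : Fin j → Fin N) : starRingEnd ℂ (idMinor hj m) = idMinor hj m := by
  rw [idMinor, colMinor, RingHom.map_det]
  congr 1
  ext a b
  simp [Matrix.one_apply, apply_ite (starRingEnd ℂ)]

theorem sum_colMinor_mul_idMinor (B : Matrix (Fin j) (Fin N) ℂ) :
    ∑ m, colMinor B m * idMinor hj m = j.factorial * colMinor B (Fin.castLE hj) := by
  have h := factorial_mul_det_mul B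
    ((1 : Matrix (Fin N) (Fin N) ℂ).submatrix id (Fin.castLE hj))
  rw [Fintype.card_fin] at h
  have e : B * (1 : Matrix (Fin N) (Fin N) ℂ).submatrix id (Fin.castLE hj) =
      B.submatrix id (Fin.castLE hj) := by
    ext a b
    simp [Matrix.mul_apply, Matrix.one_apply]
  have e' : ((1 : Matrix (Fin N) (Fin N) ℂ).submatrix id (Fin.castLE hj)).transpose =
      (1 : Matrix (Fin N) (Fin N) ℂ).submatrix (Fin.castLE hj) id := by
    rw [Matrix.transpose_submatrix, Matrix.transpose_one]
  rw [e, e'] at h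
  exact h.symm

theorem idMinor_castLE : idMinor hj (Fin.castLE hj) = 1 := by
  have : ((1 : Matrix (Fin N) (Fin N) ℂ).submatrix (Fin.castLE hj) id).submatrix id
      (Fin.castLE hj) = (1 : Matrix (Fin j) (Fin j) ℂ) := by
    ext a b
    simp [Matrix.one_apply, (Fin.castLE_injective hj).eq_iff]
  rw [idMinor, colMinor, this, Matrix.det_one]

theorem sum_norm_sq_idMinor : ∑ m, ‖idMinor hj m‖ ^ 2 = (j.factorial : ℝ) := by
  have h := sum_colMinor_mul_idMinor hj
    ((1 : Matrix (Fin N) (Fin N) ℂ).submatrix (Fin.castLE hj) id)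
  have e : ∀ m : Fin j → Fin N,
      colMinor ((1 : Matrix (Fin N) (Fin N) ℂ).submatrix (Fin.castLE hj) id) m * idMinor hj m =
      ((‖idMinor hj m‖ ^ 2 : ℝ) : ℂ) := by
    intro m
    rw [← Complex.normSq_eq_norm_sq, ← Complex.mul_conj, conj_idMinor]
    rfl
  have h1 : colMinor ((1 : Matrix (Fin N) (Fin N) ℂ).submatrix (Fin.castLE hj) id)
      (Fin.castLE hj) = 1 := idMinor_castLE hj
  rw [Finset.sum_congr rfl fun m _ => e m, ← Complex.ofReal_sum, h1, mul_one] at h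
  exact_mod_cast h

end RowEvolution

/-! ### The evolution matrix -/

section Evolution

variable {N j : ℕ} {lam : Fin N → ℝ} {V : ℝ → Matrix (Fin N) (Fin N) ℂ}
  {X : ℝ → ℂ → Matrix (Fin N) (Fin N) ℂ}

theorem intervalIntegrable_entry
    (hV : ∀ m n : Fin N, LocallyIntegrableOn (fun t => V t m n) (Ici (0 : ℝ)))
    (m n : Fin N) {T : ℝ} (hT : 0 ≤ T) : IntervalIntegrable (fun t => V t m n) volume 0 T := by
  rw [intervalIntegrable_iff_integrableOn_Icc_of_le hT]
  exact (hV m n).integrableOn_compact_subset Icc_subset_Ici_self isCompact_Icc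

theorem ae_Ioo_of_ae_Ici {P : ℝ → Prop} (h : ∀ᵐ t ∂(volume.restrict (Ici (0 : ℝ))), P t)
    (T : ℝ) : ∀ᵐ t : ℝ, t ∈ Ioo 0 T → P t := by
  filter_upwards [(ae_restrict_iff' measurableSet_Ici).1 h] with t ht h0
  exact ht h0.1.le

theorem IsEvolution.continuousOn (hX : IsEvolution lam V X) (k : ℂ) (m n : Fin N) {T : ℝ} :
    ContinuousOn (fun t => X t k m n) (Icc 0 T) :=
  (continuous_apply_apply (ρ := fun _ _ => ℂ) m n).comp_continuousOn
    ((hX k).1.mono Icc_subset_Ici_self)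

theorem IsEvolution.zero (hX : IsEvolution lam V X) (k : ℂ) : X 0 k = 1 := by
  ext m n
  simpa using (hX k).2 0 le_rfl m n

theorem IsEvolution.hasACDeriv (hX : IsEvolution lam V X)
    (hV : ∀ m n : Fin N, LocallyIntegrableOn (fun t => V t m n) (Ici (0 : ℝ)))
    (k : ℂ) (m n : Fin N) {T : ℝ} (hT : 0 ≤ T) :
    HasACDeriv (fun t => X t k m n) (fun t => Complex.I *
      (k * lam m * X t k m n + ∑ p, V t m p * X t k p n)) T := by
  have hint : IntervalIntegrable (fun t => Complex.I *
      (k * lam m * X t k m n + ∑ p, V t m p * X t k p n)) volume 0 T := by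
    have hc : ∀ p, ContinuousOn (fun t => X t k p n) (uIcc 0 T) := fun p => by
      rw [uIcc_of_le hT]; exact hX.continuousOn k p n
    refine (IntervalIntegrable.add (f := fun t => k * lam m * X t k m n)
      (g := fun t => ∑ p, V t m p * X t k p n) ?_ ?_).const_mul _
    · exact ((continuousOn_const.mul (hc m))).intervalIntegrable
    · have := IntervalIntegrable.sum Finset.univ (f := fun p t => V t m p * X t k p n)
        fun p _ => (intervalIntegrable_entry hV m p hT).mul_continuousOn (hc p)
      simpa only [Finset.sum_fn] using this
  have heq : ∀ s, (Complex.I • ((k • Matrix.diagonal (fun a => (lam a : ℂ)) + V s) * X s k)) m n =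
      Complex.I * (k * lam m * X s k m n + ∑ p, V s m p * X s k p n) := by
    intro s
    rw [Matrix.smul_apply, smul_eq_mul, Matrix.add_mul, Matrix.add_apply, Matrix.smul_mul,
      Matrix.smul_apply, Matrix.diagonal_mul, Matrix.mul_apply, smul_eq_mul, mul_assoc k]
  have h := ((HasACDeriv.const ((1 : Matrix (Fin N) (Fin N) ℂ) m n)).add
    (HasACDeriv.integral hT hint))
  refine (h.congr hT fun t ht => ?_).congr_deriv (.of_forall fun t _ => by simp)
  rw [(hX k).2 t ht.1 m n]
  simp only [heq]

/-- As `V` is Hermitian, `X(t, k̄)*` is a left inverse of `X(t, k)`. It solves an equation in which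
`k Λ + V` acts from the right. -/
theorem IsEvolution.hasACDeriv_star (hX : IsEvolution lam V X)
    (hV : ∀ m n : Fin N, LocallyIntegrableOn (fun t => V t m n) (Ici (0 : ℝ)))
    (hH : ∀ᵐ t ∂(volume.restrict (Ici (0 : ℝ))), (V t).IsHermitian)
    (k : ℂ) (a b : Fin N) {T : ℝ} (hT : 0 ≤ T) :
    HasACDeriv (fun t => (X t (starRingEnd ℂ k)).conjTranspose a b) (fun t => -Complex.I *
      (k * lam b * (X t (starRingEnd ℂ k)).conjTranspose a b +
        ∑ p, (X t (starRingEnd ℂ k)).conjTranspose a p * V t p b)) T := by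
  refine (hX.hasACDeriv hV (starRingEnd ℂ k) b a hT).star.congr_deriv ?_
  filter_upwards [ae_Ioo_of_ae_Ici hH T] with t h ht
  simp only [map_mul, map_add, Complex.conj_I, Complex.conj_conj, Complex.conj_ofReal, map_sum,
    Matrix.conjTranspose_apply, Complex.star_def]
  congr 2
  refine Finset.sum_congr rfl fun p _ => ?_
  have e := (h ht).apply p b
  rw [Complex.star_def] at e
  rw [e, mul_comm]

/-- The product of `X(t, k̄)*` with `X(t, l)` is constant for `l = k`, which gives the inverse, and
of order `l - k` in general, which gives the derivative in the spectral parameter. -/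
theorem IsEvolution.hasACDeriv_star_mul (hX : IsEvolution lam V X)
    (hV : ∀ m n : Fin N, LocallyIntegrableOn (fun t => V t m n) (Ici (0 : ℝ)))
    (hH : ∀ᵐ t ∂(volume.restrict (Ici (0 : ℝ))), (V t).IsHermitian)
    (k l : ℂ) (a b : Fin N) {T : ℝ} (hT : 0 ≤ T) :
    HasACDeriv (fun t => ((X t (starRingEnd ℂ k)).conjTranspose * X t l) a b)
      (fun t => Complex.I * (l - k) *
        ∑ p, (X t (starRingEnd ℂ k)).conjTranspose a p * lam p * X t l p b) T := by
  simp only [Matrix.mul_apply]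
  refine (HasACDeriv.sum fun p _ => (hX.hasACDeriv_star hV hH k a p hT).mul
    (hX.hasACDeriv hV l p b hT)).congr_deriv (.of_forall fun t _ => ?_)
  set Y := (X t (starRingEnd ℂ k)).conjTranspose
  have e : ∑ p, (∑ q, Y a q * V t q p) * X t l p b =
      ∑ p, Y a p * ∑ q, V t p q * X t l q b := by
    simp only [Finset.sum_mul, Finset.mul_sum]
    rw [Finset.sum_comm]
    exact Finset.sum_congr rfl fun p _ => Finset.sum_congr rfl fun q _ => mul_assoc _ _ _
  calc ∑ p, (-Complex.I * (k * lam p * Y a p + ∑ q, Y a q * V t q p) * X t l p b +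
        Y a p * (Complex.I * (l * lam p * X t l p b + ∑ q, V t p q * X t l q b)))
      = Complex.I * (l - k) * ∑ p, Y a p * lam p * X t l p b +
        Complex.I * (∑ p, Y a p * (∑ q, V t p q * X t l q b) -
          ∑ p, (∑ q, Y a q * V t q p) * X t l p b) := by
        rw [← Finset.sum_sub_distrib, Finset.mul_sum, Finset.mul_sum, ← Finset.sum_add_distrib]
        refine Finset.sum_congr rfl fun p _ => ?_
        ring
    _ = _ := by rw [e, sub_self, mul_zero, add_zero]

theorem IsEvolution.star_mul_self (hX : IsEvolution lam V X)
    (hV : ∀ m n : Fin N, LocallyIntegrableOn (fun t => V t m n) (Ici (0 : ℝ)))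
    (hH : ∀ᵐ t ∂(volume.restrict (Ici (0 : ℝ))), (V t).IsHermitian)
    (k : ℂ) {t : ℝ} (ht : 0 ≤ t) : (X t (starRingEnd ℂ k)).conjTranspose * X t k = 1 := by
  ext a b
  rw [(hX.hasACDeriv_star_mul hV hH k k a b ht).eq_of_deriv_zero ht
    (.of_forall fun s _ => by simp) (right_mem_Icc.2 ht) (left_mem_Icc.2 ht)]
  simp [hX.zero]

theorem IsEvolution.mul_star_self (hX : IsEvolution lam V X)
    (hV : ∀ m n : Fin N, LocallyIntegrableOn (fun t => V t m n) (Ici (0 : ℝ)))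
    (hH : ∀ᵐ t ∂(volume.restrict (Ici (0 : ℝ))), (V t).IsHermitian)
    (k : ℂ) {t : ℝ} (ht : 0 ≤ t) : X t k * (X t (starRingEnd ℂ k)).conjTranspose = 1 :=
  mul_eq_one_comm.1 (hX.star_mul_self hV hH k ht)

/-- In the upper half-plane the evolution is a contraction, because `Λ ≥ 0`. -/
theorem IsEvolution.norm_entry_le (hX : IsEvolution lam V X) (hlam : ∀ a, 0 ≤ lam a)
    (hV : ∀ m n : Fin N, LocallyIntegrableOn (fun t => V t m n) (Ici (0 : ℝ)))
    (hH : ∀ᵐ t ∂(volume.restrict (Ici (0 : ℝ))), (V t).IsHermitian)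
    {k : ℂ} (hk : 0 < k.im) {t : ℝ} (ht : 0 ≤ t) (a b : Fin N) : ‖X t k a b‖ ≤ 1 := by
  have h := HasACDeriv.sum_norm_sq (κ := Fin N) (σ := 1) (M := lam) (k := k)
    (u := fun m t => X t k m b) (Hu := fun m t => ∑ p, V t m p * X t k p b) (T := t)
    (fun m => by simpa using hX.hasACDeriv hV k m b ht) (by
      filter_upwards [ae_Ioo_of_ae_Ici hH t] with s h hs
      simp only [map_sum, map_mul, Complex.conj_conj, Finset.mul_sum]
      rw [Finset.sum_comm]
      refine Finset.sum_congr rfl fun p _ => Finset.sum_congr rfl fun q _ => ?_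
      have e := (h hs).apply p q
      rw [Complex.star_def] at e
      rw [e]
      ring)
  have h1 := h.integral_eq_sub_real (left_mem_Icc.2 ht) (right_mem_Icc.2 ht)
  have h2 : ∑ m, ‖X 0 k m b‖ ^ 2 = 1 := by
    simp [hX.zero, Matrix.one_apply, apply_ite norm, ite_pow]
  have h3 : ∫ s in (0 : ℝ)..t, -2 * (1 : ℝ) * k.im * ∑ m, lam m * ‖X s k m b‖ ^ 2 ≤ 0 := by
    rw [intervalIntegral.integral_of_le ht]
    refine MeasureTheory.integral_nonpos fun s => ?_
    change _ ≤ (0 : ℝ)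
    have : 0 ≤ ∑ m, lam m * ‖X s k m b‖ ^ 2 :=
      Finset.sum_nonneg fun m _ => mul_nonneg (hlam m) (sq_nonneg _)
    nlinarith [mul_nonneg hk.le this]
  have h4 : ‖X t k a b‖ ^ 2 ≤ ∑ m, ‖X t k m b‖ ^ 2 :=
    Finset.single_le_sum (f := fun m => ‖X t k m b‖ ^ 2) (fun m _ => sq_nonneg _)
      (Finset.mem_univ a)
  nlinarith [norm_nonneg (X t k a b)]

theorem isOpen_upperHalf : IsOpen upperHalf := isOpen_lt continuous_const Complex.continuous_im

/-- The evolution matrix is holomorphic in the spectral parameter: the difference quotients are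
computed by variation of constants, and pass to the limit by dominated convergence. -/
theorem IsEvolution.differentiableAt (hX : IsEvolution lam V X) (hlam : ∀ a, 0 ≤ lam a)
    (hV : ∀ m n : Fin N, LocallyIntegrableOn (fun t => V t m n) (Ici (0 : ℝ)))
    (hH : ∀ᵐ t ∂(volume.restrict (Ici (0 : ℝ))), (V t).IsHermitian)
    {k : ℂ} (hk : 0 < k.im) {t : ℝ} (ht : 0 ≤ t) (a b : Fin N) :
    DifferentiableAt ℂ (fun l => X t l a b) k := by
  set Y : ℝ → Matrix (Fin N) (Fin N) ℂ := fun s => (X s (starRingEnd ℂ k)).conjTranspose with hY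
  set F : ℝ → Fin N → ℂ → Fin N → ℂ :=
    fun s c l b => ∑ p, Y s c p * lam p * X s l p b with hF
  have hYc : ∀ c p, ∀ r, ContinuousOn (fun s => Y s c p) (Icc 0 r) := fun c p r =>
    Complex.continuous_conj.comp_continuousOn (hX.continuousOn (starRingEnd ℂ k) p c)
  have hFc : ∀ c l b r, ContinuousOn (fun s => F s c l b) (Icc 0 r) := fun c l b r =>
    continuousOn_finsetSum _ fun p _ =>
      ((hYc c p r).mul continuousOn_const).mul (hX.continuousOn l p b)
  -- variation of constants
  have hduh : ∀ l : ℂ, ∀ s, 0 ≤ s → ∀ a b, X s l a b - X s k a b =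
      (l - k) * (Complex.I * ∑ c, X s k a c * ∫ r in (0 : ℝ)..s, F r c l b) := by
    intro l s hs a b
    have h1 : ∀ c, (Y s * X s l) c b - (1 : Matrix (Fin N) (Fin N) ℂ) c b =
        Complex.I * (l - k) * ∫ r in (0 : ℝ)..s, F r c l b := by
      intro c
      have hd := hX.hasACDeriv_star_mul hV hH k l c b hs
      have hi : IntervalIntegrable (fun r => Complex.I * (l - k) * F r c l b) volume 0 s := by
        refine ContinuousOn.intervalIntegrable ?_
        rw [uIcc_of_le hs]
        exact continuousOn_const.mul (hFc c l b s)
      have := hd.integral_eq_sub hi (left_mem_Icc.2 hs) (right_mem_Icc.2 hs)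
      rw [intervalIntegral.integral_const_mul] at this
      rw [this]
      simp [hY, hX.zero]
    have h2 : X s l = X s k * (Y s * X s l) := by
      rw [← Matrix.mul_assoc, hY, hX.mul_star_self hV hH k hs, Matrix.one_mul]
    calc X s l a b - X s k a b
        = ∑ c, X s k a c * ((Y s * X s l) c b - (1 : Matrix (Fin N) (Fin N) ℂ) c b) := by
          conv_lhs => rw [h2, Matrix.mul_apply]
          simp only [mul_sub, Finset.sum_sub_distrib]
          rw [← Matrix.mul_apply (M := X s k) (N := 1), Matrix.mul_one]
      _ = _ := by
          rw [Finset.mul_sum, Finset.mul_sum]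
          refine Finset.sum_congr rfl fun c _ => ?_
          rw [h1]
          ring
  -- continuity in `k`, first with a crude bound for the integrals
  have hbound : ∀ c b s, 0 ≤ s → ∃ C, ∀ l : ℂ, 0 < l.im → ∀ r ∈ Icc 0 s, ‖F r c l b‖ ≤ C := by
    intro c b s hs
    have : ∀ p, ∃ C, ∀ r ∈ Icc 0 s, ‖Y r c p * lam p‖ ≤ C := fun p =>
      isCompact_Icc.exists_bound_of_continuousOn ((hYc c p s).mul continuousOn_const)
    choose C hC using this
    refine ⟨∑ p, C p, fun l hl r hr => (norm_sum_le _ _).trans (Finset.sum_le_sum fun p _ => ?_)⟩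
    rw [norm_mul]
    calc _ ≤ C p * 1 := by
          gcongr
          · exact (norm_nonneg _).trans (hC p r hr)
          · exact hC p r hr
          · exact hX.norm_entry_le hlam hV hH hl hr.1 p b
      _ = C p := mul_one _
  have hnhds : ∀ᶠ l in 𝓝 k, 0 < l.im := isOpen_upperHalf.mem_nhds hk
  have hcont : ∀ s, 0 ≤ s → ∀ a b, Tendsto (fun l => X s l a b) (𝓝 k) (𝓝 (X s k a b)) := by
    intro s hs a b
    choose C hC using fun c => hbound c b s hs
    rw [tendsto_iff_norm_sub_tendsto_zero]
    have hlim : Tendsto (fun l : ℂ => ‖l - k‖ * ∑ c, ‖X s k a c‖ * (C c * s)) (𝓝 k) (𝓝 0) := by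
      have : Tendsto (fun l : ℂ => ‖l - k‖) (𝓝 k) (𝓝 0) :=
        tendsto_iff_norm_sub_tendsto_zero.1 tendsto_id
      simpa using this.mul_const _
    refine squeeze_zero' (.of_forall fun _ => norm_nonneg _) ?_ hlim
    filter_upwards [hnhds] with l hl
    rw [hduh l s hs a b, norm_mul, norm_mul, Complex.norm_I, one_mul]
    gcongr
    refine (norm_sum_le _ _).trans (Finset.sum_le_sum fun c _ => ?_)
    rw [norm_mul]
    gcongr
    have := intervalIntegral.norm_integral_le_of_norm_le_const (a := 0) (b := s)
      (f := fun r => F r c l b) (C := C c) fun r hr => by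
        rw [uIoc_of_le hs] at hr
        exact hC c l hl r (Ioc_subset_Icc_self hr)
    simpa [abs_of_nonneg hs] using this
  refine HasDerivAt.differentiableAt
    (f' := Complex.I * ∑ c, X t k a c * ∫ r in (0 : ℝ)..t, F r c k b) ?_
  rw [hasDerivAt_iff_tendsto_slope]
  have hlim : Tendsto (fun l => Complex.I * ∑ c, X t k a c * ∫ r in (0 : ℝ)..t, F r c l b) (𝓝 k)
      (𝓝 (Complex.I * ∑ c, X t k a c * ∫ r in (0 : ℝ)..t, F r c k b)) := by
    refine tendsto_const_nhds.mul (tendsto_finsetSum _ fun c _ => tendsto_const_nhds.mul ?_)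
    obtain ⟨C, hC⟩ := hbound c b t ht
    refine intervalIntegral.tendsto_integral_filter_of_dominated_convergence (fun _ => C) ?_ ?_
      intervalIntegrable_const ?_
    · refine .of_forall fun l => ?_
      rw [uIoc_of_le ht]
      exact ((hFc c l b t).mono Ioc_subset_Icc_self).aestronglyMeasurable measurableSet_Ioc
    · filter_upwards [hnhds] with l hl
      refine .of_forall fun r hr => ?_
      rw [uIoc_of_le ht] at hr
      exact hC l hl r (Ioc_subset_Icc_self hr)
    · refine .of_forall fun r hr => ?_
      rw [uIoc_of_le ht] at hr
      exact tendsto_finsetSum _ fun p _ => tendsto_const_nhds.mul (hcont r hr.1.le p b)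
  refine (hlim.mono_left nhdsWithin_le_nhds).congr' ?_
  filter_upwards [self_mem_nhdsWithin] with l hl
  rw [slope_def_field, hduh l t ht a b]
  have : l - k ≠ 0 := sub_ne_zero.2 hl
  field_simp

end Evolution

/-! ### The leading minor of the propagator -/

section Propagator

variable {N j : ℕ} (hj : j ≤ N) {lam : Fin N → ℝ} {V : ℝ → Matrix (Fin N) (Fin N) ℂ}
  {X : ℝ → ℂ → Matrix (Fin N) (Fin N) ℂ}

/-- The leading `j` rows of the propagator `U(s, t) = X(s) X(t)⁻¹`, as a function of `t`; the
inverse is written as `X(t, k̄)*`. -/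
noncomputable def propagatorRows (X : ℝ → ℂ → Matrix (Fin N) (Fin N) ℂ) (s : ℝ) (k : ℂ) (t : ℝ) :
    Matrix (Fin j) (Fin N) ℂ :=
  (X s k * (X t (starRingEnd ℂ k)).conjTranspose).submatrix (Fin.castLE hj) id

/-- The normalized minors of the leading `j` rows of the propagator `U(s, t)`, as functions of `t`.
The sign is `-1` since `t` enters through the inverse of `X(t)`. -/
noncomputable def propagatorMinor (lam : Fin N → ℝ) (X : ℝ → ℂ → Matrix (Fin N) (Fin N) ℂ) (s : ℝ)
    (k : ℂ) : (Fin j → Fin N) → ℝ → ℂ :=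
  normMinor hj lam (propagatorRows hj X s k) (-1) k s

/-- The integrand of the potential energy. -/
noncomputable def energyDensity (lam : Fin N → ℝ) (V : ℝ → Matrix (Fin N) (Fin N) ℂ) (t : ℝ) : ℝ :=
  ∑ a : Fin j, ∑ p : Fin N with j ≤ p.val,
    (lam p - lam (Fin.castLE hj a))⁻¹ * ‖V t (Fin.castLE hj a) p‖ ^ 2

theorem gap_pos (hlam : StrictMono lam) (a : Fin j) {p : Fin N} (hp : j ≤ p.val) :
    0 < lam p - lam (Fin.castLE hj a) :=
  sub_pos.2 (hlam (Fin.lt_def.2 (lt_of_lt_of_le a.2 hp)))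

theorem energyDensity_nonneg (hlam : StrictMono lam) (t : ℝ) : 0 ≤ energyDensity hj lam V t :=
  Finset.sum_nonneg fun a _ => Finset.sum_nonneg fun p hp => by
    have := gap_pos hj hlam a (Finset.mem_filter.1 hp).2
    positivity

theorem hasACDeriv_propagatorRows (hX : IsEvolution lam V X)
    (hV : ∀ m n : Fin N, LocallyIntegrableOn (fun t => V t m n) (Ici (0 : ℝ)))
    (hH : ∀ᵐ t ∂(volume.restrict (Ici (0 : ℝ))), (V t).IsHermitian)
    (s : ℝ) (k : ℂ) (a : Fin j) (b : Fin N) {T : ℝ} (hT : 0 ≤ T) :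
    HasACDeriv (fun t => propagatorRows hj X s k t a b) (fun t => ((-1 : ℝ) : ℂ) * Complex.I *
      (k * lam b * propagatorRows hj X s k t a b +
        ∑ p, propagatorRows hj X s k t a p * V t p b)) T := by
  simp only [propagatorRows, Matrix.submatrix_apply, Matrix.mul_apply, id]
  refine (HasACDeriv.sum fun q _ => (hX.hasACDeriv_star hV hH k q b hT).const_mul
    (X s k (Fin.castLE hj a) q)).congr_deriv (.of_forall fun t _ => ?_)
  have e : ∑ p, (∑ q, X s k (Fin.castLE hj a) q * (X t (starRingEnd ℂ k)).conjTranspose q p) *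
      V t p b = ∑ q, X s k (Fin.castLE hj a) q *
        ∑ p, (X t (starRingEnd ℂ k)).conjTranspose q p * V t p b := by
    simp only [Finset.sum_mul, Finset.mul_sum]
    rw [Finset.sum_comm]
    exact Finset.sum_congr rfl fun p _ => Finset.sum_congr rfl fun q _ => mul_assoc _ _ _
  rw [e, Finset.mul_sum, ← Finset.sum_add_distrib, Finset.mul_sum]
  refine Finset.sum_congr rfl fun q _ => ?_
  push_cast
  ring

variable (hX : IsEvolution lam V X)
  (hV : ∀ m n : Fin N, LocallyIntegrableOn (fun t => V t m n) (Ici (0 : ℝ)))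
  (hH : ∀ᵐ t ∂(volume.restrict (Ici (0 : ℝ))), (V t).IsHermitian)

include hX hV hH in
theorem propagatorMinor_self {s : ℝ} (hs : 0 ≤ s) (k : ℂ) (m : Fin j → Fin N) :
    propagatorMinor hj lam X s k m s = idMinor hj m := by
  simp [propagatorMinor, normMinor, propagatorRows, hX.mul_star_self hV hH k hs, idMinor]

theorem normalizedMinor_eq (t : ℝ) (k : ℂ) :
    normalizedMinor hj lam X t k =
      Complex.exp (-(Complex.I * k * t * (∑ a : Fin j, lam (Fin.castLE hj a) : ℝ))) *
        colMinor ((X t k).submatrix (Fin.castLE hj) id) (Fin.castLE hj) := by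
  rw [normalizedMinor, leadingMinor, colMinor, mul_comm]
  simp

include hX in
theorem propagatorMinor_zero (s : ℝ) (k : ℂ) :
    propagatorMinor hj lam X s k (Fin.castLE hj) 0 = normalizedMinor hj lam X s k := by
  rw [normalizedMinor_eq, propagatorMinor, normMinor, propagatorRows, hX.zero]
  simp only [Matrix.conjTranspose_one, Matrix.mul_one]
  congr 2
  push_cast
  ring

include hX hV hH

theorem continuousOn_propagatorMinor {s : ℝ} (hs : 0 ≤ s) (k : ℂ) (m : Fin j → Fin N) :
    ContinuousOn (propagatorMinor hj lam X s k m) (Icc 0 s) :=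
  (HasACDeriv.normMinor hj (fun a b => hasACDeriv_propagatorRows hj hX hV hH s k a b hs) s m
    ).continuousOn hs

/-- The energy balance for the minors of the propagator. -/
theorem propagator_energy {k : ℂ} {s t : ℝ} (ht : 0 ≤ t) (hts : t ≤ s) :
    ∑ m, ‖propagatorMinor hj lam X s k m t‖ ^ 2 +
      2 * k.im * ∫ r in t..s, ∑ m, excess hj lam m * ‖propagatorMinor hj lam X s k m r‖ ^ 2 =
      j.factorial := by
  have hs : 0 ≤ s := ht.trans hts
  have h := (HasACDeriv.sum_norm_sq_normMinor hj
    (fun a b => hasACDeriv_propagatorRows hj hX hV hH s k a b hs)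
    (ae_Ioo_of_ae_Ici hH s) s).integral_eq_sub_real ⟨ht, hts⟩ (right_mem_Icc.2 hs)
  rw [intervalIntegral.integral_const_mul] at h
  have hself : ∑ m, ‖normMinor hj lam (propagatorRows hj X s k) (-1) k s m s‖ ^ 2 =
      (j.factorial : ℝ) := by
    rw [← sum_norm_sq_idMinor hj]
    exact Finset.sum_congr rfl fun m _ => by
      rw [← propagatorMinor_self hj hX hV hH hs k m, propagatorMinor]
  rw [hself] at h
  simp only [propagatorMinor]
  linarith

theorem sum_norm_sq_propagatorMinor_le (hlam : StrictMono lam) {k : ℂ} (hk : 0 < k.im) {s t : ℝ}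
    (ht : 0 ≤ t) (hts : t ≤ s) :
    ∑ m, ‖propagatorMinor hj lam X s k m t‖ ^ 2 ≤ j.factorial := by
  rw [← propagator_energy hj hX hV hH ht hts (k := k)]
  have : 0 ≤ ∫ r in t..s, ∑ m, excess hj lam m * ‖propagatorMinor hj lam X s k m r‖ ^ 2 :=
    intervalIntegral.integral_nonneg hts fun r _ => Finset.sum_nonneg fun m _ =>
      excess_mul_norm_sq_nonneg hj hlam.monotone s r m
  nlinarith [mul_nonneg hk.le this]

omit hX hV hH in
theorem sum_propagatorMinor_mul_idMinor (s t : ℝ) (k : ℂ) :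
    ∑ m, propagatorMinor hj lam X s k m t * idMinor hj m =
      j.factorial * propagatorMinor hj lam X s k (Fin.castLE hj) t := by
  simp only [propagatorMinor, normMinor, mul_assoc]
  rw [← Finset.mul_sum, sum_colMinor_mul_idMinor]
  ring

omit hX hV hH in
/-- The leading minor and its reorderings contribute `j!` equal terms to the energy. -/
theorem factorial_mul_norm_sq_propagatorMinor_le (s t : ℝ) (k : ℂ) :
    (j.factorial : ℝ) * ‖propagatorMinor hj lam X s k (Fin.castLE hj) t‖ ^ 2 ≤
      ∑ m, ‖propagatorMinor hj lam X s k m t‖ ^ 2 := by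
  have h1 : ‖∑ m, propagatorMinor hj lam X s k m t * idMinor hj m‖ ≤
      ∑ m, ‖propagatorMinor hj lam X s k m t‖ * ‖idMinor hj m‖ :=
    (norm_sum_le _ _).trans (Finset.sum_le_sum fun m _ => (norm_mul _ _).le)
  rw [sum_propagatorMinor_mul_idMinor, norm_mul, Complex.norm_natCast] at h1
  have h2 := Finset.sum_mul_sq_le_sq_mul_sq Finset.univ
    (fun m => ‖propagatorMinor hj lam X s k m t‖) (fun m : Fin j → Fin N => ‖idMinor hj m‖)
  rw [sum_norm_sq_idMinor] at h2
  have hf : (0 : ℝ) < j.factorial := by exact_mod_cast j.factorial_pos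
  have h3 : ((j.factorial : ℝ) * ‖propagatorMinor hj lam X s k (Fin.castLE hj) t‖) ^ 2 ≤
      (∑ m, ‖propagatorMinor hj lam X s k m t‖ ^ 2) * j.factorial :=
    (pow_le_pow_left₀ (by positivity) h1 2).trans h2
  nlinarith

theorem norm_propagatorMinor_le_one (hlam : StrictMono lam) {k : ℂ} (hk : 0 < k.im) {s t : ℝ}
    (ht : 0 ≤ t) (hts : t ≤ s) : ‖propagatorMinor hj lam X s k (Fin.castLE hj) t‖ ≤ 1 := by
  have h1 := factorial_mul_norm_sq_propagatorMinor_le hj s t k (lam := lam) (X := X)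
  have h2 := sum_norm_sq_propagatorMinor_le hj hX hV hH hlam hk ht hts
  have hf : (0 : ℝ) < j.factorial := by exact_mod_cast j.factorial_pos
  have h3 := h1.trans h2
  have h4 : ‖propagatorMinor hj lam X s k (Fin.castLE hj) t‖ ^ 2 ≤ 1 := by
    by_contra h
    nlinarith
  nlinarith [norm_nonneg (propagatorMinor hj lam X s k (Fin.castLE hj) t)]

/-- The energy of the normalized minors of the first `j` columns of `X` does not increase. -/
theorem sum_norm_sq_columns_le (hlam : StrictMono lam) {k : ℂ} (hk : 0 < k.im) {t : ℝ}
    (ht : 0 ≤ t) :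
    ∑ m, ‖normMinor hj lam (fun t => ((X t k).submatrix id (Fin.castLE hj)).transpose) 1 k 0 m t‖
      ^ 2 ≤ j.factorial := by
  have hd := HasACDeriv.sum_norm_sq_normMinor (T := t) (k := k) (σ := 1) hj
    (A := fun t => ((X t k).submatrix id (Fin.castLE hj)).transpose)
    (W := fun t => (V t).transpose) (lam := lam)
    (fun a b => (hX.hasACDeriv hV k b (Fin.castLE hj a) ht).congr_deriv
      (.of_forall fun s _ => by simp [mul_comm]))
    (by
      filter_upwards [ae_Ioo_of_ae_Ici hH t] with s h hs
      exact (h hs).transpose) 0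
  have h := hd.integral_eq_sub_real (left_mem_Icc.2 ht) (right_mem_Icc.2 ht)
  have h0 : ∑ m, ‖normMinor hj lam (fun t => ((X t k).submatrix id (Fin.castLE hj)).transpose)
      1 k 0 m 0‖ ^ 2 = (j.factorial : ℝ) := by
    rw [← sum_norm_sq_idMinor hj]
    refine Finset.sum_congr rfl fun m _ => ?_
    simp [normMinor, hX.zero, idMinor]
  rw [h0, intervalIntegral.integral_const_mul] at h
  have : 0 ≤ ∫ r in (0 : ℝ)..t, ∑ m, excess hj lam m *
      ‖normMinor hj lam (fun t => ((X t k).submatrix id (Fin.castLE hj)).transpose)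
        1 k 0 m r‖ ^ 2 :=
    intervalIntegral.integral_nonneg ht fun r _ => Finset.sum_nonneg fun m _ =>
      excess_mul_norm_sq_nonneg hj hlam.monotone 0 r m
  nlinarith [mul_nonneg hk.le this]

/-- The increment of `g` is controlled by the real part of the leading minor of the
propagator: by Cauchy–Binet it is a pairing of the minors of `U(s, t)`, minus those of the
identity, with the minors of `X(t)`. -/
theorem norm_sq_normalizedMinor_sub_le (hlam : StrictMono lam) {k : ℂ} (hk : 0 < k.im) {s t : ℝ}
    (ht : 0 ≤ t) (hts : t ≤ s) :
    ‖normalizedMinor hj lam X s k - normalizedMinor hj lam X t k‖ ^ 2 ≤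
      2 * (1 - propagatorMinor hj lam X s k (Fin.castLE hj) t).re := by
  set u := fun m => propagatorMinor hj lam X s k m t with hu
  set d := fun m => normMinor hj lam
    (fun t => ((X t k).submatrix id (Fin.castLE hj)).transpose) 1 k 0 m t with hd
  set J : ℝ := (j.factorial : ℝ) with hJ
  have hJ0 : 0 < J := by rw [hJ]; exact_mod_cast j.factorial_pos
  have hgs : ∑ m, u m * d m = J * normalizedMinor hj lam X s k := by
    have h := factorial_mul_det_mul (propagatorRows hj X s k t)
      ((X t k).submatrix id (Fin.castLE hj))
    have e : propagatorRows hj X s k t * (X t k).submatrix id (Fin.castLE hj) =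
        ((X s k).submatrix (Fin.castLE hj) id).submatrix id (Fin.castLE hj) := by
      rw [propagatorRows, ← Matrix.submatrix_mul _ _ _ _ _ Function.bijective_id, Matrix.mul_assoc,
        hX.star_mul_self hV hH k ht, Matrix.mul_one, Matrix.submatrix_submatrix]
      rfl
    rw [e, Fintype.card_fin] at h
    rw [normalizedMinor_eq, colMinor]
    have : ∀ m, u m * d m =
        Complex.exp (-(Complex.I * k * s * (∑ a : Fin j, lam (Fin.castLE hj a) : ℝ))) *
        (colMinor (propagatorRows hj X s k t) m *
          colMinor ((X t k).submatrix id (Fin.castLE hj)).transpose m) := by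
      intro m
      simp only [hu, hd, propagatorMinor, normMinor]
      rw [mul_mul_mul_comm, ← Complex.exp_add]
      congr 2
      push_cast
      ring
    rw [Finset.sum_congr rfl fun m _ => this m, ← Finset.mul_sum, ← h, hJ]
    push_cast
    ring
  have hgt : ∑ m, idMinor hj m * d m = J * normalizedMinor hj lam X t k := by
    have h := sum_colMinor_mul_idMinor hj ((X t k).submatrix id (Fin.castLE hj)).transpose
    have e : colMinor ((X t k).submatrix id (Fin.castLE hj)).transpose (Fin.castLE hj) =
        colMinor ((X t k).submatrix (Fin.castLE hj) id) (Fin.castLE hj) := by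
      rw [colMinor, colMinor, ← Matrix.det_transpose]
      rfl
    rw [normalizedMinor_eq, ← e, hJ, mul_left_comm]
    push_cast
    rw [← h, Finset.mul_sum]
    refine Finset.sum_congr rfl fun m _ => ?_
    simp only [hd, normMinor]
    rw [mul_left_comm, mul_comm (idMinor hj m)]
    congr 2
    push_cast
    ring
  have hnorm : J * ‖normalizedMinor hj lam X s k - normalizedMinor hj lam X t k‖ ≤
      ∑ m, ‖u m - idMinor hj m‖ * ‖d m‖ := by
    have e : (J : ℂ) * (normalizedMinor hj lam X s k - normalizedMinor hj lam X t k) =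
        ∑ m, (u m - idMinor hj m) * d m := by
      simp only [sub_mul, Finset.sum_sub_distrib, hgs, hgt, mul_sub]
    calc _ = ‖(J : ℂ) * (normalizedMinor hj lam X s k - normalizedMinor hj lam X t k)‖ := by
          rw [norm_mul, Complex.norm_real, Real.norm_of_nonneg hJ0.le]
      _ ≤ _ := by
          rw [e]
          exact (norm_sum_le _ _).trans (Finset.sum_le_sum fun m _ => (norm_mul _ _).le)
  have hcs := Finset.sum_mul_sq_le_sq_mul_sq Finset.univ
    (fun m => ‖u m - idMinor hj m‖) (fun m => ‖d m‖)
  have hd2 : ∑ m, ‖d m‖ ^ 2 ≤ J := sum_norm_sq_columns_le hj hX hV hH hlam hk ht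
  have hu2 : ∑ m, ‖u m‖ ^ 2 ≤ J := sum_norm_sq_propagatorMinor_le hj hX hV hH hlam hk ht hts
  -- expand the square: the energies of `u` and of the minors of the identity are at most `j!`
  have hdiff : ∑ m, ‖u m - idMinor hj m‖ ^ 2 ≤ J * (2 * (1 - u (Fin.castLE hj)).re) := by
    have e : ∀ m, ‖u m - idMinor hj m‖ ^ 2 =
        ‖u m‖ ^ 2 - 2 * (u m * idMinor hj m).re + ‖idMinor hj m‖ ^ 2 := by
      intro m
      rw [← Complex.normSq_eq_norm_sq, Complex.normSq_sub, Complex.normSq_eq_norm_sq,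
        Complex.normSq_eq_norm_sq, conj_idMinor]
      ring
    rw [Finset.sum_congr rfl fun m _ => e m, Finset.sum_add_distrib, Finset.sum_sub_distrib,
      sum_norm_sq_idMinor, ← Finset.mul_sum, ← Complex.re_sum, sum_propagatorMinor_mul_idMinor,
      ← Complex.ofReal_natCast, Complex.re_ofReal_mul, ← hJ, Complex.sub_re, Complex.one_re]
    simp only [hu] at hu2 ⊢
    linarith
  have h0 : 0 ≤ ∑ m, ‖u m - idMinor hj m‖ ^ 2 := Finset.sum_nonneg fun _ _ => sq_nonneg _
  have h3 : (J * ‖normalizedMinor hj lam X s k - normalizedMinor hj lam X t k‖) ^ 2 ≤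
      J * (2 * (1 - u (Fin.castLE hj)).re) * J :=
    (pow_le_pow_left₀ (by positivity) hnorm 2).trans (hcs.trans
      (mul_le_mul hdiff hd2 (Finset.sum_nonneg fun _ _ => sq_nonneg _) (h0.trans hdiff)))
  have h4 : J ^ 2 * ‖normalizedMinor hj lam X s k - normalizedMinor hj lam X t k‖ ^ 2 ≤
      J ^ 2 * (2 * (1 - u (Fin.castLE hj)).re) := by nlinarith
  exact le_of_mul_le_mul_left h4 (by positivity)

end Propagator

/-! ### The distance of the leading minor from one -/

section Propagator

variable {N j : ℕ} (hj : j ≤ N) {lam : Fin N → ℝ} {V : ℝ → Matrix (Fin N) (Fin N) ℂ}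
  {X : ℝ → ℂ → Matrix (Fin N) (Fin N) ℂ}

theorem aestronglyMeasurable_energyDensity
    (hV : ∀ m n : Fin N, LocallyIntegrableOn (fun t => V t m n) (Ici (0 : ℝ))) :
    AEStronglyMeasurable (energyDensity hj lam V) (volume.restrict (Ici 0)) := by
  have h : ∀ m n, AEStronglyMeasurable (fun t => V t m n) (volume.restrict (Ici 0)) :=
    fun m n => (hV m n).aestronglyMeasurable
  refine Finset.aestronglyMeasurable_fun_sum _ fun a _ =>
    Finset.aestronglyMeasurable_fun_sum _ fun p _ => ?_
  exact ((h _ _).norm.pow 2).const_mul _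

theorem lintegral_energyDensity (hlam : StrictMono lam)
    (hV : ∀ m n : Fin N, LocallyIntegrableOn (fun t => V t m n) (Ici (0 : ℝ))) :
    ∫⁻ t in Ici (0 : ℝ), ENNReal.ofReal (energyDensity hj lam V t) = potentialEnergy j lam V := by
  have h : ∀ m n, AEMeasurable (fun t => V t m n) (volume.restrict (Ici 0)) :=
    fun m n => (hV m n).aestronglyMeasurable.aemeasurable
  have e : ∀ t, ENNReal.ofReal (energyDensity hj lam V t) =
      ∑ a : Fin j, ∑ p : Fin N with j ≤ p.val,
        ENNReal.ofReal (|lam p - lam (Fin.castLE hj a)|⁻¹) * ‖V t (Fin.castLE hj a) p‖ₑ ^ 2 := by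
    intro t
    have hpos : ∀ a : Fin j, ∀ p ∈ Finset.univ.filter fun p : Fin N => j ≤ p.val,
        0 < lam p - lam (Fin.castLE hj a) := fun a p hp =>
      gap_pos hj hlam a (Finset.mem_filter.1 hp).2
    rw [energyDensity, ENNReal.ofReal_sum_of_nonneg fun a _ => Finset.sum_nonneg fun p hp => by
      have := hpos a p hp; positivity]
    refine Finset.sum_congr rfl fun a _ => ?_
    rw [ENNReal.ofReal_sum_of_nonneg fun p hp => by have := hpos a p hp; positivity]
    refine Finset.sum_congr rfl fun p hp => ?_
    rw [abs_of_pos (hpos a p hp), ENNReal.ofReal_mul (inv_nonneg.2 (hpos a p hp).le),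
      ENNReal.ofReal_pow (norm_nonneg _), ofReal_norm]
  have hm : ∀ (c : ENNReal) m n, AEMeasurable (fun t => c * ‖V t m n‖ₑ ^ 2)
      (volume.restrict (Ici 0)) := fun c m n => ((h m n).enorm.pow_const 2).const_mul c
  simp only [e]
  rw [lintegral_finsetSum' _ fun a _ => Finset.aemeasurable_fun_sum _ fun p _ => hm _ _ _]
  rw [potentialEnergy]
  have himg : (Finset.univ.filter fun k : Fin N => k.val < j) =
      Finset.univ.map (Fin.castLEEmb hj) := by
    ext k
    simp only [Finset.mem_filter, Finset.mem_univ, true_and, Finset.mem_map, Fin.castLEEmb_apply]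
    exact ⟨fun h => ⟨⟨k.val, h⟩, rfl⟩, fun ⟨a, ha⟩ => by rw [← ha]; exact a.2⟩
  rw [himg, Finset.sum_map]
  refine Finset.sum_congr rfl fun a _ => ?_
  rw [lintegral_finsetSum' _ fun p _ => hm _ _ _]
  refine Finset.sum_congr rfl fun p _ => ?_
  rw [lintegral_const_mul'' _ ((h _ _).enorm.pow_const 2)]
  rfl

theorem integrableOn_energyDensity (hlam : StrictMono lam)
    (hV : ∀ m n : Fin N, LocallyIntegrableOn (fun t => V t m n) (Ici (0 : ℝ)))
    (hI : potentialEnergy j lam V < ⊤) : IntegrableOn (energyDensity hj lam V) (Ici 0) := by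
  refine ⟨aestronglyMeasurable_energyDensity hj hV, ?_⟩
  rw [hasFiniteIntegral_iff_ofReal (.of_forall fun t => energyDensity_nonneg hj hlam t),
    lintegral_energyDensity hj hlam hV]
  exact hI

theorem integral_energyDensity (hlam : StrictMono lam)
    (hV : ∀ m n : Fin N, LocallyIntegrableOn (fun t => V t m n) (Ici (0 : ℝ))) :
    ∫ t in Ici (0 : ℝ), energyDensity hj lam V t = (potentialEnergy j lam V).toReal := by
  rw [integral_eq_lintegral_of_nonneg_ae (.of_forall fun t => energyDensity_nonneg hj hlam t)
    (aestronglyMeasurable_energyDensity hj hV), lintegral_energyDensity hj hlam hV]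

variable (hX : IsEvolution lam V X)
  (hV : ∀ m n : Fin N, LocallyIntegrableOn (fun t => V t m n) (Ici (0 : ℝ)))
  (hH : ∀ᵐ t ∂(volume.restrict (Ici (0 : ℝ))), (V t).IsHermitian)

/-- The energy of the single excitations, in which one leading column `a` is replaced by a column
`p ≥ j`, weighted by the gaps `λ_p - λ_a`. -/
noncomputable def excitationEnergy (lam : Fin N → ℝ) (X : ℝ → ℂ → Matrix (Fin N) (Fin N) ℂ)
    (s : ℝ) (k : ℂ) (r : ℝ) : ℝ :=
  ∑ a : Fin j, ∑ p : Fin N with j ≤ p.val, (lam p - lam (Fin.castLE hj a)) *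
    ‖propagatorMinor hj lam X s k (Function.update (Fin.castLE hj) a p) r‖ ^ 2

theorem factorial_mul_excitationEnergy_le (hlam : StrictMono lam) (s r : ℝ) (k : ℂ) :
    (j.factorial : ℝ) * excitationEnergy hj lam X s k r ≤
      ∑ m, excess hj lam m * ‖propagatorMinor hj lam X s k m r‖ ^ 2 := by
  set c := ‖Complex.exp (-(((-1 : ℝ) : ℂ) * Complex.I * k *
    (∑ a : Fin j, lam (Fin.castLE hj a) : ℝ) * (r - s)))‖ with hc
  have hn : ∀ m, ‖propagatorMinor hj lam X s k m r‖ =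
      c * ‖colMinor (propagatorRows hj X s k r) m‖ := fun m => by
    rw [propagatorMinor, normMinor, norm_mul]
  have h := mul_le_mul_of_nonneg_left (factorial_mul_sum_excitations_le hj hlam.monotone
    (propagatorRows hj X s k r)) (sq_nonneg c)
  calc (j.factorial : ℝ) * excitationEnergy hj lam X s k r
      = c ^ 2 * (j.factorial * ∑ a : Fin j, ∑ p : Fin N with j ≤ p.val,
        (lam p - lam (Fin.castLE hj a)) * ‖colMinor (propagatorRows hj X s k r)
          (Function.update (Fin.castLE hj) a p)‖ ^ 2) := by
        rw [excitationEnergy, mul_left_comm (c ^ 2), Finset.mul_sum (a := c ^ 2)]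
        congr 1
        refine Finset.sum_congr rfl fun a _ => ?_
        rw [Finset.mul_sum]
        refine Finset.sum_congr rfl fun p _ => ?_
        rw [hn]
        ring
    _ ≤ _ := h
    _ = _ := by
        rw [Finset.mul_sum]
        refine Finset.sum_congr rfl fun m _ => ?_
        rw [hn, excess]
        ring

include hX hV hH

theorem continuousOn_excitationEnergy {s : ℝ} (hs : 0 ≤ s) (k : ℂ) :
    ContinuousOn (excitationEnergy hj lam X s k) (Icc 0 s) :=
  continuousOn_finsetSum _ fun _ _ => continuousOn_finsetSum _ fun _ _ =>
    continuousOn_const.mul ((continuousOn_propagatorMinor hj hX hV hH hs k _).norm.pow 2)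

theorem integral_excitationEnergy_le (hlam : StrictMono lam) {k : ℂ} (hk : 0 < k.im) {s t : ℝ}
    (ht : 0 ≤ t) (hts : t ≤ s) :
    2 * k.im * ∫ r in t..s, excitationEnergy hj lam X s k r ≤
      1 - ‖propagatorMinor hj lam X s k (Fin.castLE hj) t‖ ^ 2 := by
  have hs : 0 ≤ s := ht.trans hts
  have hsub : uIcc t s ⊆ Icc 0 s := by rw [uIcc_of_le hts]; exact Icc_subset_Icc_left ht
  have hf : (0 : ℝ) < j.factorial := by exact_mod_cast j.factorial_pos
  have h1 : ∫ r in t..s, (j.factorial : ℝ) * excitationEnergy hj lam X s k r ≤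
      ∫ r in t..s, ∑ m, excess hj lam m * ‖propagatorMinor hj lam X s k m r‖ ^ 2 := by
    refine intervalIntegral.integral_mono_on hts ?_ ?_ fun r _ =>
      factorial_mul_excitationEnergy_le hj hlam s r k
    · exact (continuousOn_const.mul
        ((continuousOn_excitationEnergy hj hX hV hH hs k).mono hsub)).intervalIntegrable
    · refine ContinuousOn.intervalIntegrable (continuousOn_finsetSum _ fun m _ =>
        continuousOn_const.mul (ContinuousOn.pow (ContinuousOn.norm ?_) 2))
      exact (continuousOn_propagatorMinor hj hX hV hH hs k m).mono hsub
  rw [intervalIntegral.integral_const_mul] at h1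
  have h2 := propagator_energy hj hX hV hH ht hts (k := k)
  have h3 := factorial_mul_norm_sq_propagatorMinor_le hj s t k (lam := lam) (X := X)
  have h4 := mul_le_mul_of_nonneg_left h1 (by linarith : 0 ≤ 2 * k.im)
  have h5 : (j.factorial : ℝ) * (2 * k.im * ∫ r in t..s, excitationEnergy hj lam X s k r) ≤
      j.factorial * (1 - ‖propagatorMinor hj lam X s k (Fin.castLE hj) t‖ ^ 2) := by nlinarith
  exact le_of_mul_le_mul_left h5 hf

/-- The key estimate. The leading minor `a` of the propagator satisfies `a' = -i ∑ V u`, the sum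
running over the single excitations `u`, whose total energy is at most `1 - |a|²`. -/
theorem norm_sq_one_sub_propagatorMinor_le (hlam : StrictMono lam)
    (hD : ∀ᵐ t ∂(volume.restrict (Ici (0 : ℝ))), ∀ m : Fin N, V t m m = 0)
    (hI : potentialEnergy j lam V < ⊤) {k : ℂ} (hk : 0 < k.im) {s t : ℝ}
    (ht : 0 ≤ t) (hts : t ≤ s) :
    2 * k.im * ‖1 - propagatorMinor hj lam X s k (Fin.castLE hj) t‖ ^ 2 ≤
      (∫ r in t..s, energyDensity hj lam V r) *
        (1 - ‖propagatorMinor hj lam X s k (Fin.castLE hj) t‖ ^ 2) := by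
  have hs : 0 ≤ s := ht.trans hts
  set u := propagatorMinor hj lam X s k with hu
  set f : ℝ → ℂ := fun r => ((-1 : ℝ) : ℂ) * Complex.I *
      (k * excess hj lam (Fin.castLE hj) * u (Fin.castLE hj) r +
        ∑ a, ∑ p, V r p (Fin.castLE hj a) * u (Function.update (Fin.castLE hj) a p) r) with hf
  have hder : HasACDeriv (u (Fin.castLE hj)) f s := HasACDeriv.normMinor hj
    (fun a b => hasACDeriv_propagatorRows hj hX hV hH s k a b hs) s (Fin.castLE hj)
  have hsub : uIcc t s ⊆ Icc 0 s := by rw [uIcc_of_le hts]; exact Icc_subset_Icc_left ht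
  have huc : ∀ m, ContinuousOn (u m) (uIcc 0 s) := fun m => by
    rw [uIcc_of_le hs]; exact continuousOn_propagatorMinor hj hX hV hH hs k m
  have hfi : IntervalIntegrable f volume 0 s := by
    refine (IntervalIntegrable.add
      (f := fun r => k * excess hj lam (Fin.castLE hj) * u (Fin.castLE hj) r)
      (g := fun r => ∑ a, ∑ p, V r p (Fin.castLE hj a) *
        u (Function.update (Fin.castLE hj) a p) r) ?_ ?_).const_mul _
    · exact (continuousOn_const.mul (huc _)).intervalIntegrable
    · have : IntervalIntegrable (∑ x : Fin j × Fin N, fun r => V r x.2 (Fin.castLE hj x.1) *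
          u (Function.update (Fin.castLE hj) x.1 x.2) r) volume 0 s :=
        IntervalIntegrable.sum _ fun x _ =>
          (intervalIntegrable_entry hV _ _ hs).mul_continuousOn (huc _)
      convert this using 1
      ext r
      rw [Finset.sum_apply, Fintype.sum_prod_type]
  have hself : u (Fin.castLE hj) s = 1 := by
    rw [hu, propagatorMinor_self hj hX hV hH hs, idMinor_castLE]
  have hint := hder.integral_eq_sub hfi ⟨ht, hts⟩ (right_mem_Icc.2 hs)
  rw [hself] at hint
  -- the pointwise bound: for `p < j` either the diagonal entry of `V` vanishes, or the column `p`
  -- occurs twice, so that only the excitations `a ↦ p` with `p ≥ j` contribute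
  have hpt : ∀ᵐ r : ℝ, r ∈ Ioo 0 s → ∀ x : ℝ, 0 ≤ x →
      2 * x * ‖f r‖ ≤ x ^ 2 * excitationEnergy hj lam X s k r + energyDensity hj lam V r := by
    filter_upwards [ae_Ioo_of_ae_Ici hH s, ae_Ioo_of_ae_Ici hD s] with r hr1 hr2 hr x hx
    have hz : excess hj lam (Fin.castLE hj) = 0 := by simp [excess]
    have hsum : ∀ a : Fin j, ∑ p, V r p (Fin.castLE hj a) *
        u (Function.update (Fin.castLE hj) a p) r =
        ∑ p with j ≤ p.val, V r p (Fin.castLE hj a) *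
          u (Function.update (Fin.castLE hj) a p) r := by
      intro a
      symm
      refine Finset.sum_subset (Finset.filter_subset _ _) fun p _ hp => ?_
      have hpj : p.val < j := by simpa using hp
      by_cases hpa : p = Fin.castLE hj a
      · rw [hpa, hr2 hr, zero_mul]
      · have hni : ¬ Function.Injective (Function.update (Fin.castLE hj) a p) := by
          intro hinj
          have hne : (⟨p.val, hpj⟩ : Fin j) ≠ a := fun h => hpa (by rw [← h]; rfl)
          refine hne (hinj ?_)
          rw [Function.update_self, Function.update_of_ne hne]
          rfl
        rw [hu, propagatorMinor, normMinor, colMinor_eq_zero _ hni, mul_zero, mul_zero]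
    have hfn : ‖f r‖ ≤ ∑ a : Fin j, ∑ p : Fin N with j ≤ p.val, ‖V r (Fin.castLE hj a) p‖ *
        ‖u (Function.update (Fin.castLE hj) a p) r‖ := by
      simp only [hf, hz, Finset.sum_congr rfl fun a _ => hsum a, Complex.ofReal_zero, mul_zero,
        zero_mul, zero_add]
      rw [norm_mul]
      have e1 : ‖((-1 : ℝ) : ℂ) * Complex.I‖ = 1 := by simp
      rw [e1, one_mul]
      refine (norm_sum_le _ _).trans (Finset.sum_le_sum fun a _ => (norm_sum_le _ _).trans
        (Finset.sum_le_sum fun p _ => ?_))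
      rw [norm_mul, ← (hr1 hr).apply (Fin.castLE hj a) p, norm_star]
    refine (mul_le_mul_of_nonneg_left hfn (by linarith)).trans ?_
    rw [excitationEnergy, energyDensity, Finset.mul_sum, Finset.mul_sum, ← Finset.sum_add_distrib]
    refine Finset.sum_le_sum fun a _ => ?_
    rw [Finset.mul_sum, Finset.mul_sum, ← Finset.sum_add_distrib]
    refine Finset.sum_le_sum fun p hp => ?_
    have hc := gap_pos hj hlam a (Finset.mem_filter.1 hp).2
    set c := lam p - lam (Fin.castLE hj a)
    set v := ‖V r (Fin.castLE hj a) p‖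
    set w := ‖u (Function.update (Fin.castLE hj) a p) r‖ with hw
    have : x ^ 2 * (c * w ^ 2) + c⁻¹ * v ^ 2 - 2 * x * (v * w) = c⁻¹ * (c * w * x - v) ^ 2 := by
      field_simp
      ring
    have h0 : 0 ≤ c⁻¹ * (c * w * x - v) ^ 2 := by positivity
    linarith
  have hqi : IntervalIntegrable (excitationEnergy hj lam X s k) volume t s :=
    ((continuousOn_excitationEnergy hj hX hV hH hs k).mono hsub).intervalIntegrable
  have hvi : IntervalIntegrable (energyDensity hj lam V) volume t s := by
    rw [intervalIntegrable_iff_integrableOn_Icc_of_le hts]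
    exact (integrableOn_energyDensity hj hlam hV hI).mono_set
      ((Icc_subset_Icc_left ht).trans Icc_subset_Ici_self)
  set P := ∫ r in t..s, excitationEnergy hj lam X s k r with hP
  set v := ∫ r in t..s, energyDensity hj lam V r with hv
  have hv0 : 0 ≤ v :=
    intervalIntegral.integral_nonneg hts fun r _ => energyDensity_nonneg hj hlam r
  have hP0 : 0 ≤ P := intervalIntegral.integral_nonneg hts fun r _ =>
    Finset.sum_nonneg fun a _ => Finset.sum_nonneg fun p hp =>
      mul_nonneg (gap_pos hj hlam a (Finset.mem_filter.1 hp).2).le (sq_nonneg _)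
  have hx : ∀ x : ℝ, 0 ≤ x → 2 * x * ‖1 - u (Fin.castLE hj) t‖ ≤ x ^ 2 * P + v := by
    intro x hx
    have h1 := intervalIntegral.norm_integral_le_of_norm_le (μ := volume)
      (f := fun r => ((2 * x : ℝ) : ℂ) * f r)
      (g := fun r => x ^ 2 * excitationEnergy hj lam X s k r + energyDensity hj lam V r) hts (by
        have hne : ∀ᵐ r : ℝ, r ≠ s := by simp [ae_iff, measure_singleton]
        filter_upwards [hpt, hne] with r hr hrs hmem
        rw [norm_mul, Complex.norm_real, Real.norm_of_nonneg (by linarith)]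
        exact hr ⟨lt_of_le_of_lt ht hmem.1, lt_of_le_of_ne hmem.2 hrs⟩ x hx)
      ((hqi.const_mul _).add hvi)
    rw [intervalIntegral.integral_const_mul, hint, norm_mul, Complex.norm_real,
      Real.norm_of_nonneg (by linarith), intervalIntegral.integral_add (hqi.const_mul _) hvi,
      intervalIntegral.integral_const_mul] at h1
    exact h1
  -- the Cauchy–Schwarz inequality, as the discriminant of a nonnegative polynomial in `x`
  have hdisc : discrim P (-2 * ‖1 - u (Fin.castLE hj) t‖) v ≤ 0 := by
    refine discrim_le_zero fun x => ?_
    rcases le_or_gt 0 x with h | h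
    · nlinarith [hx x h]
    · nlinarith [mul_nonneg hP0 (mul_self_nonneg x),
        mul_nonneg (norm_nonneg (1 - u (Fin.castLE hj) t)) (neg_nonneg.2 h.le)]
  have hle := integral_excitationEnergy_le hj hX hV hH hlam hk ht hts
  rw [discrim] at hdisc
  rw [← hP] at hle
  nlinarith [mul_le_mul_of_nonneg_left hle hv0]

theorem differentiableAt_propagatorMinor (hlam : ∀ a, 0 ≤ lam a) {k : ℂ} (hk : 0 < k.im) {s t : ℝ}
    (hs : 0 ≤ s) (ht : 0 ≤ t) :
    DifferentiableAt ℂ (fun k => propagatorMinor hj lam X s k (Fin.castLE hj) t) k := by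
  have hdet : ∀ (n : ℕ) (M : ℂ → Matrix (Fin n) (Fin n) ℂ),
      (∀ a b, DifferentiableAt ℂ (fun k => M k a b) k) →
      DifferentiableAt ℂ (fun k => (M k).det) k := by
    intro n M hM
    simp only [Matrix.det_apply']
    refine DifferentiableAt.fun_sum fun σ _ => (differentiableAt_const _).mul ?_
    exact DifferentiableAt.fun_finsetProd fun i _ => hM _ _
  have hXd : ∀ r, 0 ≤ r → ∀ a b, DifferentiableAt ℂ (fun k => X r k a b) k :=
    fun r hr a b => hX.differentiableAt hlam hV hH hk hr a b
  have hinv : ∀ l : ℂ, (X t (starRingEnd ℂ l)).conjTranspose = (X t l)⁻¹ := fun l =>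
    (Matrix.inv_eq_left_inv (hX.star_mul_self hV hH l ht)).symm
  have hunit : ∀ l, (X t l).det ≠ 0 := fun l h => by
    have := congrArg Matrix.det (hX.star_mul_self hV hH l ht)
    simp [h] at this
  simp only [propagatorMinor, normMinor, propagatorRows, colMinor, hinv]
  refine DifferentiableAt.mul ?_ (hdet _ _ fun a b => ?_)
  · exact (by fun_prop : Differentiable ℂ fun k : ℂ => Complex.exp (-(((-1 : ℝ) : ℂ) * Complex.I *
      k * (∑ a : Fin j, lam (Fin.castLE hj a) : ℝ) * (t - s)))).differentiableAt
  · simp only [Matrix.submatrix_apply, Matrix.mul_apply, id]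
    refine DifferentiableAt.fun_sum fun p _ => (hXd s hs _ _).mul ?_
    simp only [Matrix.inv_def, Matrix.smul_apply, smul_eq_mul, Ring.inverse_eq_inv']
    refine ((hdet _ _ (hXd t ht)).inv (hunit k)).mul ?_
    simp only [Matrix.adjugate_apply]
    refine hdet _ _ fun c d => ?_
    by_cases hc : c = Fin.castLE hj b
    · subst hc; simp
    · simpa [Matrix.updateRow_ne hc] using hXd t ht c d

end Propagator

/-! ### The Cayley transform and the Poisson formula for the half-plane -/

theorem ofReal_add_mul_I_ne_zero {R : ℝ} (hR : R ≠ 0) (x : ℝ) : (x : ℂ) + R * Complex.I ≠ 0 := by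
  intro h
  have := congrArg Complex.im h
  simp at this
  exact hR this

/-- The Cayley transform `z ↦ (z - i R) / (z + i R)` on the real line. -/
noncomputable def cayleyReal (R x : ℝ) : ℂ :=
  ((x : ℂ) - R * Complex.I) / ((x : ℂ) + R * Complex.I)

/-- The inverse of the Cayley transform; it maps the unit disc onto the upper half-plane, and `0` to
`i R`. -/
noncomputable def cayleyInv (R : ℝ) (w : ℂ) : ℂ := R * Complex.I * (1 + w) / (1 - w)

/-- The angle of the Cayley transform of `x` is `2 arctan (x / R) + π`. -/
theorem circleMap_arctan {R : ℝ} (hR : 0 < R) (r x : ℝ) :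
    circleMap 0 r (2 * Real.arctan (x / R) + Real.pi) = r * cayleyReal R x := by
  have hs : (0 : ℝ) < 1 + (x / R) ^ 2 := by positivity
  have hsq : (Real.sqrt (1 + (x / R) ^ 2)) ^ 2 = 1 + (x / R) ^ 2 := Real.sq_sqrt hs.le
  have hs0 : Real.sqrt (1 + (x / R) ^ 2) ≠ 0 := (Real.sqrt_pos.2 hs).ne'
  have e1 : Complex.exp (Real.arctan (x / R) * Complex.I) =
      (1 + (x / R : ℝ) * Complex.I) / (Real.sqrt (1 + (x / R) ^ 2) : ℝ) := by
    rw [Complex.exp_mul_I, ← Complex.ofReal_cos, ← Complex.ofReal_sin, Real.cos_arctan,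
      Real.sin_arctan]
    push_cast
    ring
  have e2 : Complex.exp (((2 * Real.arctan (x / R) + Real.pi : ℝ) : ℂ) * Complex.I) =
      -(Complex.exp (Real.arctan (x / R) * Complex.I)) ^ 2 := by
    rw [← Complex.exp_nat_mul]
    push_cast
    rw [add_mul, Complex.exp_add, Complex.exp_pi_mul_I]
    ring_nf
  rw [circleMap_zero, e2, e1, div_pow, ← Complex.ofReal_pow, hsq, cayleyReal]
  have h1 := ofReal_add_mul_I_ne_zero hR.ne' x
  have hR' : (R : ℂ) ≠ 0 := by exact_mod_cast hR.ne'
  have h2 : ((1 + (x / R) ^ 2 : ℝ) : ℂ) =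
      ((x : ℂ) + R * Complex.I) * ((x : ℂ) - R * Complex.I) / R ^ 2 := by
    push_cast
    field_simp
    linear_combination ((R : ℂ) ^ 2) * Complex.I_sq
  have h3 : (x : ℂ) - R * Complex.I ≠ 0 := by
    have := ofReal_add_mul_I_ne_zero (neg_ne_zero.2 hR.ne') x
    push_cast at this
    simpa [sub_eq_add_neg] using this
  rw [h2]
  push_cast
  congr 1
  field_simp
  linear_combination (-(x : ℂ) ^ 2 - R ^ 2) * Complex.I_sq

theorem hasDerivAt_two_mul_arctan {R : ℝ} (hR : 0 < R) (x : ℝ) :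
    HasDerivAt (fun x => 2 * Real.arctan (x / R) + Real.pi) (2 * (R / (x ^ 2 + R ^ 2))) x := by
  have h := ((Real.hasDerivAt_arctan (x / R)).comp x ((hasDerivAt_id x).div_const R)).const_mul 2
    |>.add_const Real.pi
  refine h.congr_deriv ?_
  field_simp
  ring

theorem injective_two_mul_arctan {R : ℝ} (hR : 0 < R) :
    Function.Injective fun x => 2 * Real.arctan (x / R) + Real.pi := by
  intro x y h
  have h1 : Real.arctan (x / R) = Real.arctan (y / R) := by
    simp only at h
    linarith
  have h2 := Real.arctan_injective h1
  field_simp at h2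
  exact h2

theorem image_two_mul_arctan {R : ℝ} (hR : 0 < R) :
    (fun x => 2 * Real.arctan (x / R) + Real.pi) '' univ = Ioo 0 (2 * Real.pi) := by
  ext θ
  constructor
  · rintro ⟨x, -, rfl⟩
    have h1 := Real.neg_pi_div_two_lt_arctan (x / R)
    have h2 := Real.arctan_lt_pi_div_two (x / R)
    constructor <;> simp only <;> linarith
  · rintro ⟨h1, h2⟩
    refine ⟨R * Real.tan ((θ - Real.pi) / 2), mem_univ _, ?_⟩
    simp only
    rw [mul_div_cancel_left₀ _ hR.ne', Real.arctan_tan (by linarith) (by linarith)]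
    ring

/-- The Cayley transform takes the normalized arc length of the circle to the Poisson kernel. -/
theorem integral_cayley_eq_circleAverage {E : Type*} [NormedAddCommGroup E] [NormedSpace ℝ E]
    {R : ℝ} (hR : 0 < R) (r : ℝ) (h : ℂ → E) :
    ∫ x : ℝ, (R / (x ^ 2 + R ^ 2)) • h (r * cayleyReal R x) =
      Real.pi • Real.circleAverage h 0 r := by
  have := integral_image_eq_integral_abs_deriv_smul (s := univ) MeasurableSet.univ
    (fun x _ => (hasDerivAt_two_mul_arctan hR x).hasDerivWithinAt)
    (injective_two_mul_arctan hR).injOn (fun θ => h (circleMap 0 r θ))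
  rw [image_two_mul_arctan hR, setIntegral_univ] at this
  rw [Real.circleAverage, intervalIntegral.integral_of_le Real.two_pi_pos.le,
    integral_Ioc_eq_integral_Ioo, this, smul_smul]
  simp only [circleMap_arctan hR]
  rw [← integral_smul]
  refine integral_congr_ae (.of_forall fun x => ?_)
  simp only
  rw [abs_of_nonneg (by positivity), smul_smul]
  congr 1
  field_simp [Real.pi_ne_zero]

theorem integrable_cayley_of_circleIntegrable {E : Type*} [NormedAddCommGroup E] [NormedSpace ℝ E]
    {R : ℝ} (hR : 0 < R) (r : ℝ) (h : ℂ → E) (hi : CircleIntegrable h 0 r) :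
    Integrable fun x : ℝ => (R / (x ^ 2 + R ^ 2)) • h (r * cayleyReal R x) := by
  have := integrableOn_image_iff_integrableOn_abs_deriv_smul (s := univ) MeasurableSet.univ
    (fun x _ => (hasDerivAt_two_mul_arctan hR x).hasDerivWithinAt)
    (injective_two_mul_arctan hR).injOn (fun θ => h (circleMap 0 r θ))
  rw [image_two_mul_arctan hR, integrableOn_univ] at this
  have h1 : IntegrableOn (fun θ => h (circleMap 0 r θ)) (Ioo 0 (2 * Real.pi)) := by
    rw [← integrableOn_Ioc_iff_integrableOn_Ioo]
    exact hi.1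
  have h2 := (this.1 h1).smul (1 / 2 : ℝ)
  refine h2.congr (.of_forall fun x => ?_)
  simp only [Pi.smul_apply]
  rw [abs_of_nonneg (by positivity), smul_smul, circleMap_arctan hR]
  congr 1
  ring

theorem integrable_poissonKernel {R : ℝ} (hR : 0 < R) :
    Integrable fun x : ℝ => R / (x ^ 2 + R ^ 2) := by
  have := integrable_cayley_of_circleIntegrable hR 1 (fun _ => (1 : ℝ)) (circleIntegrable_const _ _ _)
  simpa using this

theorem norm_cayleyReal {R : ℝ} (hR : 0 < R) (x : ℝ) : ‖cayleyReal R x‖ = 1 := by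
  have := circleMap_arctan hR 1 x
  rw [Complex.ofReal_one, one_mul] at this
  rw [← this]
  simp

theorem cayleyInv_mem_upperHalf {R : ℝ} (hR : 0 < R) {w : ℂ} (hw : ‖w‖ < 1) :
    cayleyInv R w ∈ upperHalf := by
  have h1 : 1 - w ≠ 0 := fun h => by
    rw [← sub_eq_zero.1 h] at hw
    simp at hw
  have h2 : 0 < Complex.normSq (1 - w) := Complex.normSq_pos.2 h1
  have h3 : Complex.normSq w < 1 := by
    rw [Complex.normSq_eq_norm_sq]
    nlinarith [norm_nonneg w]
  have e : (cayleyInv R w).im = R * (1 - Complex.normSq w) / Complex.normSq (1 - w) := by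
    rw [cayleyInv, Complex.div_im]
    simp [Complex.normSq_apply]
    field_simp
    ring
  change 0 < (cayleyInv R w).im
  rw [e]
  exact div_pos (mul_pos hR (by linarith)) h2

theorem differentiableAt_cayleyInv (R : ℝ) {w : ℂ} (hw : ‖w‖ < 1) :
    DifferentiableAt ℂ (cayleyInv R) w := by
  have h1 : 1 - w ≠ 0 := fun h => by
    rw [← sub_eq_zero.1 h] at hw
    simp at hw
  unfold cayleyInv
  fun_prop (disch := exact h1)

/-- The images of the radii of the disc approach the real line nontangentially. -/
theorem tendsto_cayleyInv_cayleyReal {R : ℝ} (hR : 0 < R) (x : ℝ) :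
    Tendsto (fun r : ℝ => cayleyInv R (r * cayleyReal R x)) (𝓝[<] 1)
      (𝓝[boundaryCone 2 x] (x : ℂ)) := by
  set D : ℝ → ℂ := fun r => ((x * (1 - r) : ℝ) : ℂ) + ((R * (1 + r) : ℝ) : ℂ) * Complex.I with hD
  have hD0 : ∀ r : ℝ, 0 < r → D r ≠ 0 := fun r hr =>
    ofReal_add_mul_I_ne_zero (by positivity) _
  have key : ∀ r : ℝ, 0 < r → cayleyInv R (r * cayleyReal R x) =
      x - ((1 - r) * (R ^ 2 + x ^ 2) : ℝ) / D r := by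
    intro r hr
    have h1 := ofReal_add_mul_I_ne_zero hR.ne' x
    have h2 := hD0 r hr
    have e1 : 1 - r * cayleyReal R x = D r / (x + R * Complex.I) := by
      rw [cayleyReal, hD]
      field_simp
      push_cast
      ring
    have e2 : 1 + r * cayleyReal R x =
        (x * (1 + r) + R * (1 - r) * Complex.I) / (x + R * Complex.I) := by
      rw [cayleyReal]
      field_simp
      ring
    rw [cayleyInv, e1, e2]
    field_simp
    rw [hD]
    push_cast
    linear_combination ((R : ℂ) ^ 2 * (1 - r)) * Complex.I_sq
  have hpos : ∀ᶠ r : ℝ in 𝓝[<] 1, 0 < r :=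
    (eventually_gt_nhds one_pos).filter_mono nhdsWithin_le_nhds
  rw [tendsto_nhdsWithin_iff]
  constructor
  · have hc : Tendsto (fun r : ℝ => (x : ℂ) - ((1 - r) * (R ^ 2 + x ^ 2) : ℝ) / D r) (𝓝[<] 1)
        (𝓝 ((x : ℂ) - ((1 - 1) * (R ^ 2 + x ^ 2) : ℝ) / D 1)) := by
      refine Tendsto.mono_left ?_ nhdsWithin_le_nhds
      have hDc : Continuous D := by
        rw [hD]
        fun_prop
      refine tendsto_const_nhds.sub (Tendsto.div ?_ hDc.continuousAt (hD0 1 one_pos))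
      exact Continuous.tendsto
        (by fun_prop : Continuous fun r : ℝ => (((1 - r) * (R ^ 2 + x ^ 2) : ℝ) : ℂ)) 1
    rw [sub_self, zero_mul, Complex.ofReal_zero, zero_div, sub_zero] at hc
    refine hc.congr' ?_
    filter_upwards [hpos] with r hr
    rw [key r hr]
  · have hsmall : ∀ᶠ r : ℝ in 𝓝[<] 1, |x| * (1 - r) < 2 * (R * (1 + r)) := by
      refine Eventually.filter_mono nhdsWithin_le_nhds ?_
      refine ContinuousAt.eventually_lt (by fun_prop) (by fun_prop) ?_
      rw [sub_self, mul_zero]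
      positivity
    filter_upwards [hpos, hsmall, self_mem_nhdsWithin] with r hr hs hr1
    rw [key r hr]
    have hr1' : 0 < 1 - r := sub_pos.2 hr1
    have hn : 0 < Complex.normSq (D r) := Complex.normSq_pos.2 (hD0 r hr)
    have hre : (D r).re = x * (1 - r) := by simp [hD]
    have him : (D r).im = R * (1 + r) := by simp [hD]
    set c := (1 - r) * (R ^ 2 + x ^ 2) with hc
    have hc0 : 0 < c := by positivity
    have e1 : ((x : ℂ) - (c : ℝ) / D r).im = c * (R * (1 + r)) / Complex.normSq (D r) := by
      rw [Complex.sub_im, Complex.div_im, him]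
      simp
    have e2 : ((x : ℂ) - (c : ℝ) / D r).re - x = -(c * (x * (1 - r)) / Complex.normSq (D r)) := by
      rw [Complex.sub_re, Complex.div_re, hre]
      simp
    refine ⟨?_, ?_⟩
    · rw [e1]
      positivity
    · rw [e1, e2, abs_neg, abs_div, abs_mul c, abs_mul x, abs_of_pos hc0, abs_of_pos hr1',
        abs_of_pos hn, ← mul_div_assoc]
      refine div_lt_div_of_pos_right ?_ hn
      nlinarith

/-- Averages over circles of radius `r < 1` of a bounded continuous function on the disc tend, as
`r → 1`, to the Poisson integral of its radial limits. -/
theorem tendsto_circleAverage_one {E : Type*} [NormedAddCommGroup E] [NormedSpace ℝ E]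
    {u : ℂ → E} {v : ℝ → E} {C R : ℝ} (hR : 0 < R) (hu : ContinuousOn u (Metric.ball 0 1))
    (hC : ∀ w ∈ Metric.ball (0 : ℂ) 1, ‖u w‖ ≤ C)
    (hv : ∀ᵐ x : ℝ, Tendsto (fun r : ℝ => u (r * cayleyReal R x)) (𝓝[<] 1) (𝓝 (v x))) :
    Tendsto (fun r => Real.pi • Real.circleAverage u 0 r) (𝓝[<] 1)
      (𝓝 (∫ x : ℝ, (R / (x ^ 2 + R ^ 2)) • v x)) := by
  have hev : ∀ᶠ r : ℝ in 𝓝[<] 1, 0 < r ∧ r < 1 :=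
    ((eventually_gt_nhds one_pos).filter_mono nhdsWithin_le_nhds).and self_mem_nhdsWithin
  have hmem : ∀ r : ℝ, 0 < r ∧ r < 1 → ∀ x, (r : ℂ) * cayleyReal R x ∈ Metric.ball (0 : ℂ) 1 := by
    intro r hr x
    rw [mem_ball_zero_iff, norm_mul, norm_cayleyReal hR, mul_one, Complex.norm_real,
      Real.norm_of_nonneg hr.1.le]
    exact hr.2
  simp only [← integral_cayley_eq_circleAverage hR]
  refine tendsto_integral_filter_of_dominated_convergence (fun x => R / (x ^ 2 + R ^ 2) * C) ?_ ?_
    ((integrable_poissonKernel hR).mul_const C) ?_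
  · filter_upwards [hev] with r hr
    refine Continuous.aestronglyMeasurable ?_
    have hc : Continuous fun x : ℝ => R / (x ^ 2 + R ^ 2) :=
      continuous_const.div (by fun_prop) fun x => by positivity
    refine hc.smul (continuous_iff_continuousAt.2 fun x => ?_)
    refine ContinuousAt.comp (g := u)
      (hu.continuousAt (Metric.isOpen_ball.mem_nhds (hmem r hr x))) ?_
    unfold cayleyReal
    exact continuousAt_const.mul (ContinuousAt.div (by fun_prop) (by fun_prop)
      (ofReal_add_mul_I_ne_zero hR.ne' x))
  · filter_upwards [hev] with r hr
    refine .of_forall fun x => ?_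
    rw [norm_smul, Real.norm_of_nonneg (by positivity)]
    gcongr
    exact hC _ (hmem r hr x)
  · filter_upwards [hv] with x hx
    exact hx.const_smul _

theorem differentiableOn_comp_cayleyInv {f : ℂ → ℂ} {R : ℝ} (hR : 0 < R)
    (hf : DifferentiableOn ℂ f upperHalf) :
    DifferentiableOn ℂ (fun w => f (cayleyInv R w)) (Metric.ball 0 1) := by
  intro w hw
  rw [mem_ball_zero_iff] at hw
  exact ((hf.differentiableAt (isOpen_upperHalf.mem_nhds (cayleyInv_mem_upperHalf hR hw))).comp w
    (differentiableAt_cayleyInv R hw)).differentiableWithinAt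

/-- The Poisson formula, at a point of the imaginary axis, for a bounded holomorphic function on the
upper half-plane with a boundary function. -/
theorem integral_poissonKernel_smul {f : ℂ → ℂ} {b : ℝ → ℂ} {C R : ℝ} (hR : 0 < R)
    (hf : DifferentiableOn ℂ f upperHalf) (hC : ∀ z ∈ upperHalf, ‖f z‖ ≤ C)
    (hb : ∀ᵐ x : ℝ, Tendsto f (𝓝[boundaryCone 2 x] (x : ℂ)) (𝓝 (b x))) :
    ∫ x : ℝ, ((R / (x ^ 2 + R ^ 2) : ℝ) : ℂ) * b x = Real.pi * f (R * Complex.I) := by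
  set F : ℂ → ℂ := fun w => f (cayleyInv R w) with hF
  have hFd := differentiableOn_comp_cayleyInv hR hf
  have hF0 : F 0 = f (R * Complex.I) := by simp [hF, cayleyInv]
  have hlim := tendsto_circleAverage_one (u := F) (v := b) hR hFd.continuousOn
    (fun w hw => hC _ (cayleyInv_mem_upperHalf hR (by simpa using hw))) (by
      filter_upwards [hb] with x hx
      exact hx.comp (tendsto_cayleyInv_cayleyReal hR x))
  have hconst : Tendsto (fun r : ℝ => Real.pi • Real.circleAverage F 0 r) (𝓝[<] 1)
      (𝓝 (Real.pi * f (R * Complex.I))) := by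
    refine tendsto_const_nhds.congr' ?_
    have hpos : ∀ᶠ r : ℝ in 𝓝[<] 1, 0 < r :=
      (eventually_gt_nhds one_pos).filter_mono nhdsWithin_le_nhds
    filter_upwards [hpos, self_mem_nhdsWithin] with r hr0 hr1
    have : Real.circleAverage F 0 r = F 0 := by
      refine DiffContOnCl.circleAverage (DifferentiableOn.diffContOnCl (hFd.mono ?_))
      rw [abs_of_pos hr0]
      exact Metric.closure_ball_subset_closedBall.trans (Metric.closedBall_subset_ball hr1)
    rw [this, Complex.real_smul, hF0]
  have := tendsto_nhds_unique hlim hconst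
  simpa only [Complex.real_smul] using this

/-- The Poisson formula at an arbitrary point. -/
theorem integral_poissonKernel_smul_add {f : ℂ → ℂ} {b : ℝ → ℂ} {C R : ℝ} (hR : 0 < R) (x₀ : ℝ)
    (hf : DifferentiableOn ℂ f upperHalf) (hC : ∀ z ∈ upperHalf, ‖f z‖ ≤ C)
    (hb : ∀ᵐ x : ℝ, Tendsto f (𝓝[boundaryCone 2 x] (x : ℂ)) (𝓝 (b x))) :
    ∫ x : ℝ, ((R / (x ^ 2 + R ^ 2) : ℝ) : ℂ) * b (x + x₀) =
      Real.pi * f (x₀ + R * Complex.I) := by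
  have hmaps : MapsTo (fun z : ℂ => z + x₀) upperHalf upperHalf := fun z hz => by
    have h : 0 < z.im := hz
    change 0 < (z + x₀).im
    simpa using h
  have := integral_poissonKernel_smul (f := fun z => f (z + x₀)) (b := fun x => b (x + x₀)) hR
    (hf.comp (by fun_prop) hmaps) (fun z hz => hC _ (hmaps hz)) (by
      have hqm := (measurePreserving_add_right volume x₀).quasiMeasurePreserving.ae hb
      filter_upwards [hqm] with x hx
      refine hx.comp ?_
      rw [tendsto_nhdsWithin_iff]
      constructor
      · refine Tendsto.mono_left ?_ nhdsWithin_le_nhds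
        exact Continuous.tendsto' (by fun_prop) _ _ (by push_cast; rfl)
      · filter_upwards [self_mem_nhdsWithin] with z hz
        refine ⟨hmaps hz.1, ?_⟩
        have := hz.2
        simpa using this)
  rw [this, add_comm (x₀ : ℂ)]

/-- The Poisson formula on a horizontal line inside the half-plane. -/
theorem integral_poissonKernel_smul_line {f : ℂ → ℂ} {C R y : ℝ} (hR : 0 < R) (hy : 0 < y)
    (hf : DifferentiableOn ℂ f upperHalf) (hC : ∀ z ∈ upperHalf, ‖f z‖ ≤ C) :
    ∫ x : ℝ, ((R / (x ^ 2 + R ^ 2) : ℝ) : ℂ) * f (x + y * Complex.I) =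
      Real.pi * f (((R + y : ℝ) : ℂ) * Complex.I) := by
  have hmem : ∀ z : ℂ, 0 ≤ z.im → z + y * Complex.I ∈ upperHalf := fun z hz => by
    change 0 < (z + y * Complex.I).im
    simp
    linarith
  have := integral_poissonKernel_smul (f := fun z => f (z + y * Complex.I))
    (b := fun x => f (x + y * Complex.I)) hR
    (hf.comp (by fun_prop) fun z hz => hmem z (le_of_lt hz))
    (fun z hz => hC _ (hmem z (le_of_lt hz))) (.of_forall fun x => by
      have hd : ContinuousAt f ((x : ℂ) + y * Complex.I) :=
        (hf.differentiableAt (isOpen_upperHalf.mem_nhds (hmem x (by simp)))).continuousAt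
      have h2 : ContinuousAt (fun z : ℂ => f (z + y * Complex.I)) (x : ℂ) :=
        ContinuousAt.comp (g := f) hd (by fun_prop)
      exact h2.mono_left nhdsWithin_le_nhds)
  rw [this]
  push_cast
  rw [add_mul]

/-! ### Nontangential boundary values of bounded holomorphic functions -/

theorem convex_upperHalf : Convex ℝ upperHalf := convex_halfSpace_im_gt 0

theorem add_I_ne_zero {z : ℂ} (hz : z ∈ upperHalf) : z + Complex.I ≠ 0 := by
  intro h
  have h1 := congrArg Complex.im h
  have h2 : 0 < z.im := hz
  simp at h1
  linarith

theorem norm_cayley_lt_one {z : ℂ} (hz : z ∈ upperHalf) :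
    ‖(z - Complex.I) / (z + Complex.I)‖ < 1 := by
  have h2 : 0 < z.im := hz
  rw [norm_div, div_lt_one (norm_pos_iff.2 (add_I_ne_zero hz))]
  refine lt_of_pow_lt_pow_left₀ 2 (norm_nonneg _) ?_
  rw [← Complex.normSq_eq_norm_sq, ← Complex.normSq_eq_norm_sq, Complex.normSq_apply,
    Complex.normSq_apply]
  simp
  nlinarith

/-- A holomorphic function on the half-plane has a primitive, transported from the disc. -/
theorem exists_primitive_upperHalf {f : ℂ → ℂ} (hf : DifferentiableOn ℂ f upperHalf) :
    ∃ H : ℂ → ℂ, ∀ z ∈ upperHalf, HasDerivAt H (f z) z := by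
  have hg : DifferentiableOn ℂ (fun w => f (cayleyInv 1 w) * (2 * Complex.I / (1 - w) ^ 2))
      (Metric.ball 0 1) := by
    intro w hw
    rw [mem_ball_zero_iff] at hw
    have h1 : 1 - w ≠ 0 := fun h => by
      rw [← sub_eq_zero.1 h] at hw
      simp at hw
    refine DifferentiableAt.differentiableWithinAt (DifferentiableAt.mul ?_ ?_)
    · exact (hf.differentiableAt (isOpen_upperHalf.mem_nhds
        (cayleyInv_mem_upperHalf one_pos hw))).comp w (differentiableAt_cayleyInv 1 hw)
    · fun_prop (disch := exact pow_ne_zero 2 h1)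
  obtain ⟨K, hK⟩ := hg.isExactOn_ball
  refine ⟨fun z => K ((z - Complex.I) / (z + Complex.I)), fun z hz => ?_⟩
  have h0 := add_I_ne_zero hz
  have hw := norm_cayley_lt_one hz
  have h1 : HasDerivAt (fun z : ℂ => (z - Complex.I) / (z + Complex.I))
      (2 * Complex.I / (z + Complex.I) ^ 2) z := by
    refine (((hasDerivAt_id z).sub_const Complex.I).div ((hasDerivAt_id z).add_const Complex.I)
      h0).congr_deriv ?_
    simp only [id]
    ring
  have e : 1 - (z - Complex.I) / (z + Complex.I) = 2 * Complex.I / (z + Complex.I) := by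
    field_simp
    ring
  have e' : cayleyInv 1 ((z - Complex.I) / (z + Complex.I)) = z := by
    rw [cayleyInv, e]
    field_simp
    push_cast
    ring
  refine ((hK _ (by simpa using hw)).comp z h1).congr_deriv ?_
  beta_reduce
  rw [e', e]
  field_simp

/-- **Fatou's theorem**: a bounded holomorphic function on the upper half-plane has nontangential
limits almost everywhere. Its primitive `H` is Lipschitz up to the real line, hence differentiable
there almost everywhere; if `a` is the derivative at `x₀`, the difference quotient
`(H z - H x₀) / (z - x₀) - a` is bounded and its boundary values tend to `0` at `x₀`, so by the
Poisson formula it tends to `0` in the half-plane, and Cauchy's estimate gives `H' → a` in cones. -/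
theorem exists_hasBoundaryFunction {f : ℂ → ℂ} (hf : DifferentiableOn ℂ f upperHalf)
    (hb : ∀ z ∈ upperHalf, ‖f z‖ ≤ 1) : ∃ b : ℝ → ℂ, HasBoundaryFunction f b := by
  obtain ⟨H₀, hH₀⟩ := exists_primitive_upperHalf hf
  have hlip : LipschitzOnWith 1 H₀ upperHalf :=
    convex_upperHalf.lipschitzOnWith_of_nnnorm_hasDerivWithin_le
      (fun z hz => (hH₀ z hz).hasDerivWithinAt) (fun z hz => hb z hz)
  obtain ⟨H, hHlip, hHeq⟩ := hlip.extend_finite_dimension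
  set K := lipschitzExtensionConstant ℂ * 1
  have hH : ∀ z ∈ upperHalf, HasDerivAt H (f z) z := fun z hz =>
    (hH₀ z hz).congr_of_eventuallyEq
      (Filter.eventuallyEq_of_mem (isOpen_upperHalf.mem_nhds hz) fun w hw => (hHeq hw).symm)
  have hhlip : LipschitzWith (K * 1) fun x : ℝ => H x :=
    hHlip.comp (Complex.isometry_ofReal.lipschitz)
  refine ⟨deriv fun x : ℝ => H x, ?_⟩
  filter_upwards [hhlip.ae_differentiableAt_real] with x₀ hx₀ α hα
  set a := deriv (fun x : ℝ => H x) x₀ with ha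
  have hda : HasDerivAt (fun x : ℝ => H x) a x₀ := hx₀.hasDerivAt
  set Q : ℂ → ℂ := fun z => (H z - H x₀ - a * (z - x₀)) / (z - x₀) with hQ
  have hQb : ∀ z, ‖Q z‖ ≤ K + ‖a‖ := by
    intro z
    by_cases hz : z - x₀ = 0
    · simp only [hQ, hz, div_zero, norm_zero]
      positivity
    rw [hQ]
    simp only
    rw [norm_div, div_le_iff₀ (norm_pos_iff.2 hz), add_mul]
    refine (norm_sub_le _ _).trans (add_le_add ?_ (norm_mul _ _).le)
    have := hHlip.dist_le_mul z x₀
    rwa [dist_eq_norm, dist_eq_norm] at this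
  have hne : ∀ z ∈ upperHalf, z - x₀ ≠ 0 := fun z hz h => by
    have h1 : 0 < z.im := hz
    rw [sub_eq_zero.1 h] at h1
    simp at h1
  have hQd : DifferentiableOn ℂ Q upperHalf := fun z hz =>
    DifferentiableAt.differentiableWithinAt
      ((((hH z hz).differentiableAt.sub_const _).sub (by fun_prop)).div (by fun_prop) (hne z hz))
  have hQc : ∀ x : ℝ, x ≠ x₀ → ContinuousAt Q x := fun x hx =>
    ContinuousAt.div (((hHlip.continuous.continuousAt).sub continuousAt_const).sub
      (by fun_prop)) (by fun_prop) (by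
        rw [sub_ne_zero]
        exact_mod_cast hx)
  have hQr : Tendsto (fun x : ℝ => Q x) (𝓝 x₀) (𝓝 0) := by
    have h1 := hasDerivAt_iff_isLittleO.1 hda
    have h3 := (Asymptotics.isLittleO_iff.1 h1)
    rw [Metric.tendsto_nhds]
    intro ε hε
    filter_upwards [h3 (half_pos hε)] with x hx
    rw [dist_zero_right, hQ]
    simp only
    by_cases hxx : (x : ℂ) - x₀ = 0
    · rw [hxx, div_zero, norm_zero]
      exact hε
    · rw [norm_div, div_lt_iff₀ (norm_pos_iff.2 hxx)]
      have e1 : ‖H x - H x₀ - (x - x₀ : ℝ) • a‖ = ‖H x - H x₀ - a * (x - x₀)‖ := by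
        rw [Complex.real_smul]
        push_cast
        rw [mul_comm]
      have e2 : ‖(x - x₀ : ℝ)‖ = ‖(x : ℂ) - x₀‖ := by
        rw [← Complex.ofReal_sub, Complex.norm_real]
      rw [e1, e2] at hx
      have := norm_pos_iff.2 hxx
      nlinarith
  have hmeas : Measurable fun x : ℝ => Q x := by
    have h1 : Measurable fun x : ℝ => H x :=
      (hHlip.continuous.comp Complex.continuous_ofReal).measurable
    exact ((h1.sub_const _).sub (by fun_prop)).div (by fun_prop)
  -- the Poisson formula, rescaled to a kernel that does not depend on `z`
  have hpois : ∀ z ∈ upperHalf, ∫ s : ℝ, ((1 / (s ^ 2 + 1) : ℝ) : ℂ) * Q ((s * z.im + z.re : ℝ)) =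
      Real.pi * Q z := by
    intro z hz
    have hz' : 0 < z.im := hz
    have h1 := integral_poissonKernel_smul_add (b := fun x => Q x) (R := z.im) hz' z.re hQd
      (fun w _ => hQb w) (by
        have : ∀ᵐ x : ℝ, x ≠ x₀ := by simp [ae_iff, measure_singleton]
        filter_upwards [this] with x hx
        exact (hQc x hx).mono_left nhdsWithin_le_nhds)
    rw [Complex.re_add_im] at h1
    rw [← h1]
    have h2 := Measure.integral_comp_mul_right (fun x : ℝ =>
      ((z.im / (x ^ 2 + z.im ^ 2) : ℝ) : ℂ) * Q ((x + z.re : ℝ))) z.im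
    rw [abs_of_pos (inv_pos.2 hz')] at h2
    have h3 : ∫ y : ℝ, ((z.im / (y ^ 2 + z.im ^ 2) : ℝ) : ℂ) * Q ((y + z.re : ℝ)) =
        z.im • ∫ x : ℝ, ((z.im / ((x * z.im) ^ 2 + z.im ^ 2) : ℝ) : ℂ) *
          Q ((x * z.im + z.re : ℝ)) := by
      rw [h2, smul_smul, mul_inv_cancel₀ hz'.ne', one_smul]
    rw [h3, ← integral_smul]
    refine integral_congr_ae (.of_forall fun s => ?_)
    simp only
    rw [Complex.real_smul, ← mul_assoc, ← Complex.ofReal_mul]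
    congr 2
    field_simp
  have hQ0 : Tendsto Q (𝓝[upperHalf] (x₀ : ℂ)) (𝓝 0) := by
    have hI : Tendsto (fun z : ℂ => ∫ s : ℝ, ((1 / (s ^ 2 + 1) : ℝ) : ℂ) *
        Q ((s * z.im + z.re : ℝ))) (𝓝[upperHalf] (x₀ : ℂ))
        (𝓝 (∫ s : ℝ, ((1 / (s ^ 2 + 1) : ℝ) : ℂ) * 0)) := by
      refine tendsto_integral_filter_of_dominated_convergence
        (fun s => 1 / (s ^ 2 + 1) * (K + ‖a‖)) ?_ ?_ ?_ ?_
      · refine .of_forall fun z => Measurable.aestronglyMeasurable ?_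
        refine Measurable.mul (by fun_prop) (hmeas.comp (by fun_prop))
      · refine .of_forall fun z => .of_forall fun s => ?_
        rw [norm_mul, Complex.norm_real, Real.norm_of_nonneg (by positivity)]
        gcongr
        exact hQb _
      · have := (integrable_poissonKernel one_pos).mul_const (K + ‖a‖)
        simpa only [one_pow] using this
      · refine .of_forall fun s => tendsto_const_nhds.mul (hQr.comp ?_)
        refine Tendsto.mono_left ?_ nhdsWithin_le_nhds
        exact Continuous.tendsto' (by fun_prop) _ _ (by simp)
    simp only [mul_zero, integral_zero] at hI
    have h2 := hI.const_mul ((Real.pi : ℂ)⁻¹)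
    rw [mul_zero] at h2
    refine h2.congr' ?_
    filter_upwards [self_mem_nhdsWithin] with z hz
    rw [hpois z hz, inv_mul_cancel_left₀ (by exact_mod_cast Real.pi_ne_zero)]
  -- Cauchy's estimate on the disc of radius `Im z / 2` around `z`
  rw [Metric.tendsto_nhdsWithin_nhds]
  intro ε hε
  set η := ε / (2 * α + 5) with hη
  have hη0 : 0 < η := by positivity
  obtain ⟨δ, hδ, hδQ⟩ := Metric.tendsto_nhdsWithin_nhds.1 hQ0 η hη0
  refine ⟨δ / 2, half_pos hδ, fun z hz hzδ => ?_⟩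
  have hz0 : 0 < z.im := hz.1
  have hball : ∀ w ∈ Metric.closedBall z (z.im / 2), w ∈ upperHalf := by
    intro w hw
    rw [mem_closedBall_iff_norm] at hw
    have h1 := (Complex.abs_im_le_norm (w - z)).trans hw
    rw [Complex.sub_im, abs_le] at h1
    change 0 < w.im
    linarith [h1.1]
  have hzx : ‖z - x₀‖ ≤ (α + 1) * z.im := by
    refine (Complex.norm_le_abs_re_add_abs_im _).trans ?_
    have h1 := hz.2
    simp only [Complex.sub_re, Complex.ofReal_re, Complex.sub_im, Complex.ofReal_im, sub_zero]
    rw [abs_of_pos hz0]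
    linarith
  have hder : ∀ w ∈ upperHalf, HasDerivAt (fun w => H w - H x₀ - a * (w - x₀)) (f w - a) w := by
    intro w hw
    have h1 : HasDerivAt (fun w : ℂ => a * (w - x₀)) a w := by
      simpa using ((hasDerivAt_id w).sub_const (x₀ : ℂ)).const_mul a
    exact ((hH w hw).sub_const _).sub h1
  have hcauchy := Complex.norm_deriv_le_of_forall_mem_sphere_norm_le (c := z) (R := z.im / 2)
    (C := (α + 2) * z.im * η) (f := fun w => H w - H x₀ - a * (w - x₀)) (half_pos hz0)
    (DifferentiableOn.diffContOnCl fun w hw =>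
      (hder w (hball w (Metric.closure_ball_subset_closedBall hw))).differentiableAt.differentiableWithinAt)
    (by
      intro w hw
      have hwu := hball w (Metric.sphere_subset_closedBall hw)
      rw [mem_sphere_iff_norm] at hw
      have h1 : ‖w - x₀‖ ≤ z.im / 2 + ‖z - x₀‖ := by
        rw [← hw]
        simpa using norm_add_le (w - z) (z - x₀)
      have h2 : z.im ≤ ‖z - x₀‖ := by
        have := (le_abs_self _).trans (Complex.abs_im_le_norm (z - x₀))
        simpa using this
      rw [dist_eq_norm] at hzδ
      have h3 := hδQ hwu (by rw [dist_eq_norm]; linarith)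
      rw [dist_zero_right] at h3
      have h4 : H w - H x₀ - a * (w - x₀) = (w - x₀) * Q w := by
        rw [hQ]
        field_simp [hne w hwu]
      rw [h4, norm_mul]
      gcongr
      nlinarith)
  rw [(hder z hz0).deriv] at hcauchy
  rw [dist_eq_norm]
  calc ‖f z - a‖ ≤ (α + 2) * z.im * η / (z.im / 2) := hcauchy
    _ = (2 * α + 4) * η := by field_simp; ring
    _ < (2 * α + 5) * η := by nlinarith
    _ = ε := by rw [hη]; field_simp

/-! ### Boundary functions -/

theorem line_mem_upperHalf {y : ℝ} (hy : 0 < y) (x : ℝ) :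
    (x : ℂ) + y * Complex.I ∈ upperHalf := by
  change 0 < ((x : ℂ) + y * Complex.I).im
  simpa using hy

theorem continuous_line {f : ℂ → ℂ} (hf : DifferentiableOn ℂ f upperHalf) {y : ℝ} (hy : 0 < y) :
    Continuous fun x : ℝ => f (x + y * Complex.I) :=
  hf.continuousOn.comp_continuous (by fun_prop) (line_mem_upperHalf hy)

theorem HasBoundaryFunction.tendsto_vertical {f : ℂ → ℂ} {b : ℝ → ℂ}
    (hb : HasBoundaryFunction f b) : ∀ᵐ x : ℝ, Tendsto
      (fun n : ℕ => f (x + ((1 / ((n : ℝ) + 1) : ℝ) : ℂ) * Complex.I)) atTop (𝓝 (b x)) := by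
  filter_upwards [hb] with x hx
  refine (hx 1 one_pos).comp ?_
  rw [tendsto_nhdsWithin_iff]
  constructor
  · have h1 : Tendsto (fun n : ℕ => ((1 / ((n : ℝ) + 1) : ℝ) : ℂ)) atTop (𝓝 0) :=
      (Complex.continuous_ofReal.tendsto' 0 0 rfl).comp tendsto_one_div_add_atTop_nhds_zero_nat
    simpa using (h1.mul_const Complex.I).const_add (x : ℂ)
  · refine .of_forall fun n => ?_
    have hn : (0 : ℝ) < 1 / ((n : ℝ) + 1) := by positivity
    set y := 1 / ((n : ℝ) + 1)
    refine ⟨line_mem_upperHalf hn x, ?_⟩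
    simpa using hn

theorem HasBoundaryFunction.norm_le {f : ℂ → ℂ} {b : ℝ → ℂ} {C : ℝ}
    (hb : HasBoundaryFunction f b) (hC : ∀ z ∈ upperHalf, ‖f z‖ ≤ C) : ∀ᵐ x, ‖b x‖ ≤ C := by
  filter_upwards [hb.tendsto_vertical] with x hx
  exact le_of_tendsto hx.norm (.of_forall fun n => hC _ (line_mem_upperHalf (by positivity) x))

/-! ### Jensen's inequality in the half-plane -/

theorem lintegral_le_of_tendsto {g : ℕ → ℝ → ENNReal} {f : ℝ → ENNReal} {c : ℕ → ENNReal}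
    {C : ENNReal} (hg : ∀ n, AEMeasurable (g n))
    (hlim : ∀ᵐ x, Tendsto (fun n => g n x) atTop (𝓝 (f x)))
    (hle : ∀ᶠ n in atTop, ∫⁻ x, g n x ≤ c n) (hc : Tendsto c atTop (𝓝 C)) : ∫⁻ x, f x ≤ C :=
  calc ∫⁻ x, f x = ∫⁻ x, liminf (fun n => g n x) atTop := by
        refine lintegral_congr_ae ?_
        filter_upwards [hlim] with x hx
        exact hx.liminf_eq.symm
    _ ≤ liminf (fun n => ∫⁻ x, g n x) atTop := lintegral_liminf_le' hg
    _ ≤ liminf c atTop := liminf_le_liminf hle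
    _ = C := hc.liminf_eq

/-- As `R → ∞`, the measures `R² / (x² + R²) dx` exhaust Lebesgue measure. -/
theorem lintegral_le_of_poisson {φ : ℝ → ℝ} (hφ : AEMeasurable φ) {c : ℝ → ℝ} {C : ℝ}
    (hc : Tendsto c atTop (𝓝 C))
    (h : ∀ᶠ R in atTop,
      ∫⁻ x, ENNReal.ofReal (R / (x ^ 2 + R ^ 2) * φ x) ≤ ENNReal.ofReal (c R / R)) :
    ∫⁻ x, ENNReal.ofReal (φ x) ≤ ENNReal.ofReal C := by
  refine lintegral_le_of_tendsto
    (g := fun n x => ENNReal.ofReal ((n : ℝ) * ((n : ℝ) / (x ^ 2 + (n : ℝ) ^ 2) * φ x)))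
    (c := fun n => ENNReal.ofReal (c n)) (fun n => ?_) (.of_forall fun x => ?_) ?_
    ((ENNReal.continuous_ofReal.tendsto C).comp (hc.comp tendsto_natCast_atTop_atTop))
  · exact (((by fun_prop : Measurable fun x : ℝ => (n : ℝ) / (x ^ 2 + (n : ℝ) ^ 2)).aemeasurable.mul
      hφ).const_mul _).ennreal_ofReal
  · refine (ENNReal.continuous_ofReal.tendsto _).comp ?_
    have h1 : Tendsto (fun n : ℕ => (1 + x ^ 2 * ((n : ℝ)⁻¹) ^ 2)⁻¹ * φ x) atTop
        (𝓝 ((1 + x ^ 2 * 0 ^ 2)⁻¹ * φ x)) := by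
      refine Tendsto.mul_const _ (Tendsto.inv₀ ?_ (by norm_num))
      exact tendsto_const_nhds.add (tendsto_const_nhds.mul
        ((tendsto_inv_atTop_zero.comp tendsto_natCast_atTop_atTop).pow 2))
    have e : (1 + x ^ 2 * 0 ^ 2)⁻¹ * φ x = φ x := by norm_num
    rw [e] at h1
    refine h1.congr' ?_
    filter_upwards [eventually_gt_atTop 0] with n hn
    have hn' : (0 : ℝ) < n := by exact_mod_cast hn
    field_simp
    ring
  · filter_upwards [tendsto_natCast_atTop_atTop.eventually h, eventually_gt_atTop 0] with n hn hn0
    have hn' : (0 : ℝ) < n := by exact_mod_cast hn0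
    simp only [ENNReal.ofReal_mul hn'.le]
    rw [lintegral_const_mul' _ _ ENNReal.ofReal_ne_top]
    refine (mul_le_mul_right hn _).trans ?_
    rw [← ENNReal.ofReal_mul hn'.le, mul_div_cancel₀ _ hn'.ne']

/-- Jensen's inequality for the truncated logarithm on circles. -/
theorem log_norm_le_circleAverage {F : ℂ → ℂ} (hF : DifferentiableOn ℂ F (Metric.ball 0 1))
    (hF0 : F 0 ≠ 0) {ε : ℝ} (hε : 0 < ε) {r : ℝ} (hr0 : 0 < r) (hr1 : r < 1) :
    Real.log ‖F 0‖ ≤ Real.circleAverage (fun w => Real.log (max ‖F w‖ ε)) 0 r := by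
  have hsub : Metric.closedBall (0 : ℂ) r ⊆ Metric.ball 0 1 := Metric.closedBall_subset_ball hr1
  have han : AnalyticOnNhd ℂ F (Metric.ball 0 1) := hF.analyticOnNhd Metric.isOpen_ball
  have han' : AnalyticOnNhd ℂ F (Metric.closedBall 0 |r|) := by
    rw [abs_of_pos hr0]; exact han.mono hsub
  have hsph : Metric.sphere (0 : ℂ) |r| ⊆ Metric.closedBall 0 |r| := Metric.sphere_subset_closedBall
  -- Jensen's formula: the zeros contribute with a nonnegative sign
  have hJ := han'.circleAverage_log_norm hr0.ne' hF0
  have hnn : 0 ≤ ∑ᶠ u, (MeromorphicOn.divisor F (Metric.closedBall 0 |r|) u : ℝ) *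
      Real.log (r * ‖0 - u‖⁻¹) := by
    refine finsum_nonneg fun u => ?_
    by_cases hu : u ∈ Metric.closedBall (0 : ℂ) |r|
    · have h1 : 0 ≤ MeromorphicOn.divisor F (Metric.closedBall 0 |r|) u :=
        MeromorphicOn.AnalyticOnNhd.divisor_nonneg han' u
      refine mul_nonneg (by exact_mod_cast h1) ?_
      rw [mem_closedBall_zero_iff, abs_of_pos hr0] at hu
      rcases eq_or_ne u 0 with rfl | hu0
      · simp
      · refine Real.log_nonneg ?_
        rw [zero_sub, norm_neg, ← div_eq_mul_inv, le_div_iff₀ (norm_pos_iff.2 hu0), one_mul]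
        exact hu
    · rw [Function.locallyFinsuppWithin.apply_eq_zero_of_notMem _ hu]
      simp
  have hle : Real.log ‖F 0‖ ≤ Real.circleAverage (fun w => Real.log ‖F w‖) 0 r := by
    rw [hJ]; linarith
  -- the zeros on the circle, where `log 0 = 0`, are negligible
  classical
  set h' : ℂ → ℝ := fun w => if F w = 0 then 0 else Real.log (max ‖F w‖ ε) with hh'
  have hcod : h' =ᶠ[codiscreteWithin (Metric.sphere (0 : ℂ) |r|)]
      fun w => Real.log (max ‖F w‖ ε) := by
    have h1 : F ⁻¹' {0}ᶜ ∈ codiscreteWithin (Metric.ball (0 : ℂ) 1) :=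
      han.preimage_zero_mem_codiscreteWithin hF0 (by simp)
        ⟨⟨0, by simp⟩, (convex_ball (0 : ℂ) 1).isPreconnected⟩
    have h2 := Filter.codiscreteWithin_mono (X := ℂ)
      (hsph.trans (by rw [abs_of_pos hr0]; exact hsub)) h1
    filter_upwards [h2] with w hw
    have : F w ≠ 0 := hw
    simp [hh', this]
  have hci : CircleIntegrable (fun w => Real.log (max ‖F w‖ ε)) 0 r := by
    refine ContinuousOn.circleIntegrable hr0.le ?_
    have hc : ContinuousOn F (Metric.sphere 0 r) :=
      hF.continuousOn.mono (Metric.sphere_subset_closedBall.trans hsub)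
    exact ContinuousOn.log (hc.norm.sup continuousOn_const) fun w _ =>
      (lt_of_lt_of_le hε (le_max_right _ _)).ne'
  have hci' : CircleIntegrable h' 0 r := hci.congr_codiscreteWithin hcod.symm
  rw [← Real.circleAverage_congr_codiscreteWithin hcod hr0.ne']
  refine hle.trans (Real.circleAverage_mono ?_ hci' fun w _ => ?_)
  · exact (han'.mono hsph).meromorphicOn.circleIntegrable_log_norm
  · by_cases hw : F w = 0
    · simp [hh', hw]
    · simp only [hh', hw, if_false]
      exact Real.log_le_log (norm_pos_iff.2 hw) (le_max_left _ _)

/-- Jensen's inequality for a function in the unit ball of `H^∞`, with a truncated logarithm. -/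
theorem integral_poissonKernel_mul_log_max {G : ℂ → ℂ} {b : ℝ → ℂ} {R ε : ℝ} (hR : 0 < R)
    (hε : 0 < ε) (hε1 : ε ≤ 1)
    (hG : DifferentiableOn ℂ G upperHalf) (hG1 : ∀ z ∈ upperHalf, ‖G z‖ ≤ 1)
    (hb : HasBoundaryFunction G b) (hG0 : G (R * Complex.I) ≠ 0) :
    Real.pi * Real.log ‖G (R * Complex.I)‖ ≤
      ∫ x : ℝ, R / (x ^ 2 + R ^ 2) * Real.log (max ‖b x‖ ε) := by
  set F : ℂ → ℂ := fun w => G (cayleyInv R w) with hF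
  have hFd := differentiableOn_comp_cayleyInv hR hG
  have hF0 : F 0 = G (R * Complex.I) := by simp [hF, cayleyInv]
  have hmax : ∀ z : ℂ, 0 < max ‖z‖ ε := fun z => lt_of_lt_of_le hε (le_max_right _ _)
  have hlogc : Continuous fun z : ℂ => Real.log (max ‖z‖ ε) :=
    (continuous_norm.max continuous_const).log fun z => (hmax z).ne'
  have hlim := tendsto_circleAverage_one (u := fun w => Real.log (max ‖F w‖ ε))
    (v := fun x => Real.log (max ‖b x‖ ε)) (C := -Real.log ε) hR
    (hlogc.comp_continuousOn hFd.continuousOn) (fun w hw => by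
      have h1 := hG1 _ (cayleyInv_mem_upperHalf hR (by simpa using hw))
      have h2 : Real.log ε ≤ Real.log (max ‖F w‖ ε) := Real.log_le_log hε (le_max_right _ _)
      have h3 : Real.log (max ‖F w‖ ε) ≤ 0 :=
        Real.log_nonpos (hmax _).le (max_le h1 hε1)
      rw [Real.norm_eq_abs, abs_of_nonpos h3]
      linarith) (by
      filter_upwards [hb] with x hx
      exact (hlogc.tendsto _).comp ((hx 2 two_pos).comp (tendsto_cayleyInv_cayleyReal hR x)))
  refine ge_of_tendsto hlim ?_
  have hpos : ∀ᶠ r : ℝ in 𝓝[<] 1, 0 < r :=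
    (eventually_gt_nhds one_pos).filter_mono nhdsWithin_le_nhds
  filter_upwards [hpos, self_mem_nhdsWithin] with r hr0 hr1
  rw [smul_eq_mul, ← hF0]
  exact mul_le_mul_of_nonneg_left
    (log_norm_le_circleAverage hFd (by rwa [← hF0] at hG0) hε hr0 hr1)
    Real.pi_pos.le

theorem HasBoundaryFunction.aemeasurable {G : ℂ → ℂ} {b : ℝ → ℂ}
    (hG : DifferentiableOn ℂ G upperHalf) (hb : HasBoundaryFunction G b) : AEMeasurable b := by
  refine aemeasurable_of_tendsto_metrizable_ae' (f := fun (n : ℕ) (x : ℝ) =>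
    G (x + ((1 / ((n : ℝ) + 1) : ℝ) : ℂ) * Complex.I)) (fun n => ?_) (hb.tendsto_vertical)
  exact (continuous_line hG (by positivity)).measurable.aemeasurable

/-- The logarithmic integral. By Jensen's inequality at the point `i R` the logarithm of the
boundary function has at most the Poisson mass of `log |G(i R)|`, and `|1 - G(i R)| ≤ J / R` bounds
the latter as `R → ∞`. -/
theorem log_boundary_integrable {G : ℂ → ℂ} {b : ℝ → ℂ} {J : ℝ} (hJ : 0 ≤ J)
    (hG : DifferentiableOn ℂ G upperHalf) (hG1 : ∀ z ∈ upperHalf, ‖G z‖ ≤ 1)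
    (hGJ : ∀ z ∈ upperHalf, ‖1 - G z‖ ≤ J / z.im)
    (hb : HasBoundaryFunction G b) :
    (∀ᵐ x, b x ≠ 0) ∧ Integrable (fun x => Real.log ‖b x‖) ∧
      (∫ x, Real.log ‖b x‖) ≤ 0 ∧ -(Real.pi * J) ≤ ∫ x, Real.log ‖b x‖ := by
  have hbm := hb.aemeasurable hG
  have hb1 := hb.norm_le hG1
  have hpt : ∀ R : ℝ, J < R → 1 - J / R ≤ ‖G (R * Complex.I)‖ := by
    intro R hR
    have hR0 : 0 < R := hJ.trans_lt hR
    have h1 := hGJ (R * Complex.I) (by change 0 < (R * Complex.I).im; simpa using hR0)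
    have h2 : ((R : ℂ) * Complex.I).im = R := by simp
    rw [h2] at h1
    have h3 := norm_sub_norm_le 1 (G (R * Complex.I))
    rw [norm_one] at h3
    linarith
  have hpt0 : ∀ R : ℝ, J < R → 0 < 1 - J / R := fun R hR => by
    rw [sub_pos, div_lt_one (hJ.trans_lt hR)]
    exact hR
  -- the extended logarithm, infinite at the zeros of `b`
  classical
  have hext : ∀ R : ℝ, J < R → ∫⁻ x, (if b x = 0 then ⊤ else
      ENNReal.ofReal (R / (x ^ 2 + R ^ 2) * -Real.log ‖b x‖)) ≤
      ENNReal.ofReal (-(R * Real.pi * Real.log (1 - J / R)) / R) := by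
    intro R hR
    have hR0 : 0 < R := hJ.trans_lt hR
    have hK : ∀ x : ℝ, 0 < R / (x ^ 2 + R ^ 2) := fun x => by positivity
    have hmono : Real.log (1 - J / R) ≤ Real.log ‖G (R * Complex.I)‖ :=
      Real.log_le_log (hpt0 R hR) (hpt R hR)
    have hmax : ∀ (n : ℕ) (x : ℝ), 0 < max ‖b x‖ (Real.exp (-n)) := fun n x =>
      lt_of_lt_of_le (Real.exp_pos _) (le_max_right _ _)
    have hlogm : ∀ n : ℕ, AEMeasurable fun x => Real.log (max ‖b x‖ (Real.exp (-n))) := fun n =>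
      (hbm.norm.max aemeasurable_const).log
    refine lintegral_le_of_tendsto (g := fun n x => ENNReal.ofReal (R / (x ^ 2 + R ^ 2) *
      -Real.log (max ‖b x‖ (Real.exp (-n))))) (c := fun _ => _) (fun n => ?_) (.of_forall fun x => ?_)
      (.of_forall fun n => ?_) tendsto_const_nhds
    · exact ((by fun_prop : Measurable fun x : ℝ => R / (x ^ 2 + R ^ 2)).aemeasurable.mul
        (hlogm n).neg).ennreal_ofReal
    · by_cases hx : b x = 0
      · simp only [hx, if_true, norm_zero]
        have e : ∀ n : ℕ, max 0 (Real.exp (-(n : ℝ))) = Real.exp (-n) := fun n =>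
          max_eq_right (Real.exp_pos _).le
        simp only [e, Real.log_exp, neg_neg]
        exact ENNReal.tendsto_ofReal_atTop.comp
          (tendsto_natCast_atTop_atTop.const_mul_atTop (hK x))
      · simp only [hx, if_false]
        refine tendsto_const_nhds.congr' ?_
        have hlim : Tendsto (fun n : ℕ => Real.exp (-(n : ℝ))) atTop (𝓝 0) :=
          Real.tendsto_exp_neg_atTop_nhds_zero.comp tendsto_natCast_atTop_atTop
        filter_upwards [hlim.eventually_lt_const (norm_pos_iff.2 hx)] with n hn
        rw [max_eq_left hn.le]
    · have h1 := integral_poissonKernel_mul_log_max hR0 (Real.exp_pos (-(n : ℝ)))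
        (Real.exp_le_one_iff.2 (by simp)) hG hG1 hb
        (norm_pos_iff.1 ((hpt0 R hR).trans_le (hpt R hR)))
      have hle0 : ∀ᵐ x, Real.log (max ‖b x‖ (Real.exp (-n))) ≤ 0 := by
        filter_upwards [hb1] with x hx
        exact Real.log_nonpos (hmax n x).le (max_le hx (Real.exp_le_one_iff.2 (by simp)))
      have hint : Integrable fun x =>
          R / (x ^ 2 + R ^ 2) * -Real.log (max ‖b x‖ (Real.exp (-n))) := by
        refine ((integrable_poissonKernel hR0).mul_bdd (c := n) (hlogm n).neg.aestronglyMeasurable ?_)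
        filter_upwards [hle0] with x hx
        have h2 : -(n : ℝ) ≤ Real.log (max ‖b x‖ (Real.exp (-n))) := by
          rw [Real.le_log_iff_exp_le (hmax n x)]
          exact le_max_right _ _
        rw [Real.norm_eq_abs, abs_of_nonneg (neg_nonneg.2 hx)]
        linarith
      rw [← ofReal_integral_eq_lintegral_ofReal hint (by
        filter_upwards [hle0] with x hx
        exact mul_nonneg (hK x).le (neg_nonneg.2 hx))]
      refine ENNReal.ofReal_le_ofReal ?_
      simp only [mul_neg, integral_neg]
      have e : -(R * Real.pi * Real.log (1 - J / R)) / R = -(Real.pi * Real.log (1 - J / R)) := by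
        field_simp
      rw [e, neg_le_neg_iff]
      exact (mul_le_mul_of_nonneg_left hmono Real.pi_pos.le).trans h1
  have hne : ∀ᵐ x, b x ≠ 0 := by
    have h1 := hext (J + 1) (by linarith)
    have hm : AEMeasurable fun x => if b x = 0 then (⊤ : ENNReal) else
        ENNReal.ofReal ((J + 1) / (x ^ 2 + (J + 1) ^ 2) * -Real.log ‖b x‖) := by
      have hΦ : Measurable fun q : ℝ × ℂ => if q.2 = 0 then (⊤ : ENNReal) else
          ENNReal.ofReal ((J + 1) / (q.1 ^ 2 + (J + 1) ^ 2) * -Real.log ‖q.2‖) :=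
        Measurable.ite (measurable_snd (measurableSet_singleton 0)) measurable_const (by fun_prop)
      exact hΦ.comp_aemeasurable (aemeasurable_id.prodMk hbm)
    filter_upwards [ae_lt_top' hm (h1.trans_lt ENNReal.ofReal_lt_top).ne] with x hx h0
    simp [h0] at hx
  have hlim : Tendsto (fun R : ℝ => -(R * Real.pi * Real.log (1 - J / R))) atTop
      (𝓝 (Real.pi * J)) := by
    have h1 := Real.tendsto_mul_log_one_add_div_atTop (-J)
    have h2 := (h1.const_mul Real.pi).neg
    simp only [mul_neg, neg_neg] at h2
    refine h2.congr fun R => ?_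
    rw [neg_div, ← sub_eq_add_neg]
    ring
  have hfin : ∫⁻ x, ENNReal.ofReal (-Real.log ‖b x‖) ≤ ENNReal.ofReal (Real.pi * J) := by
    refine lintegral_le_of_poisson (Real.measurable_log.comp_aemeasurable hbm.norm).neg hlim ?_
    filter_upwards [eventually_gt_atTop J] with R hR
    refine (lintegral_congr_ae ?_).trans_le (hext R hR)
    filter_upwards [hne] with x hx
    simp [hx]
  have hnn : ∀ᵐ x, 0 ≤ -Real.log ‖b x‖ := by
    filter_upwards [hb1] with x hx
    exact neg_nonneg.2 (Real.log_nonpos (norm_nonneg _) hx)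
  have hmeas : AEStronglyMeasurable (fun x => -Real.log ‖b x‖) :=
    (Real.measurable_log.comp_aemeasurable hbm.norm).neg.aestronglyMeasurable
  have hint : Integrable fun x => -Real.log ‖b x‖ :=
    ⟨hmeas, by
      rw [hasFiniteIntegral_iff_ofReal hnn]
      exact hfin.trans_lt ENNReal.ofReal_lt_top⟩
  have hle : ∫ x, -Real.log ‖b x‖ ≤ Real.pi * J := by
    rw [integral_eq_lintegral_of_nonneg_ae hnn hmeas]
    exact ENNReal.toReal_le_of_le_ofReal (by positivity) hfin
  have h0 : 0 ≤ ∫ x, -Real.log ‖b x‖ := integral_nonneg_of_ae hnn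
  rw [integral_neg] at hle h0
  exact ⟨hne, by simpa using hint.neg, by linarith, by linarith⟩

/-! ### Integrals over horizontal lines -/

theorem re_integral_poisson_line {f : ℂ → ℂ} {C R y : ℝ} (hR : 0 < R) (hy : 0 < y)
    (hf : DifferentiableOn ℂ f upperHalf) (hC : ∀ z ∈ upperHalf, ‖f z‖ ≤ C) :
    Integrable (fun x : ℝ => R / (x ^ 2 + R ^ 2) * (f (x + y * Complex.I)).re) ∧
    ∫ x : ℝ, R / (x ^ 2 + R ^ 2) * (f (x + y * Complex.I)).re =
      Real.pi * (f (((R + y : ℝ) : ℂ) * Complex.I)).re := by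
  have hint : Integrable fun x : ℝ =>
      ((R / (x ^ 2 + R ^ 2) : ℝ) : ℂ) * f (x + y * Complex.I) :=
    (integrable_poissonKernel hR).ofReal.mul_bdd (c := C)
      (continuous_line hf hy).aestronglyMeasurable
      (.of_forall fun x => hC _ (line_mem_upperHalf hy x))
  have h := congrArg Complex.re (integral_poissonKernel_smul_line hR hy hf hC)
  have h2 := integral_re hint
  simp only [RCLike.re_to_complex] at h2
  rw [← h2, Complex.re_ofReal_mul] at h
  simp only [Complex.re_ofReal_mul] at h
  refine ⟨?_, h⟩
  have := hint.re
  simpa only [RCLike.re_to_complex, Complex.re_ofReal_mul] using this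

/-- A bounded holomorphic function of nonnegative real part which is `O(1 / Im z)` has real parts of
bounded mass on all horizontal lines. -/
theorem lintegral_re_line_le {F : ℂ → ℂ} {C J y : ℝ} (hy : 0 < y) (hJ : 0 ≤ J)
    (hF : DifferentiableOn ℂ F upperHalf) (hC : ∀ z ∈ upperHalf, ‖F z‖ ≤ C)
    (hre : ∀ z ∈ upperHalf, 0 ≤ (F z).re) (hFJ : ∀ z ∈ upperHalf, ‖F z‖ ≤ J / z.im) :
    ∫⁻ x : ℝ, ENNReal.ofReal (F (x + y * Complex.I)).re ≤ ENNReal.ofReal (Real.pi * J) := by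
  refine lintegral_le_of_poisson (φ := fun x : ℝ => (F (x + y * Complex.I)).re)
    (c := fun _ => Real.pi * J)
    (Complex.continuous_re.comp (continuous_line hF hy)).measurable.aemeasurable
    tendsto_const_nhds ?_
  filter_upwards [eventually_gt_atTop 0] with R hR
  obtain ⟨hi, he⟩ := re_integral_poisson_line hR hy hF hC
  rw [← ofReal_integral_eq_lintegral_ofReal hi (.of_forall fun x =>
    mul_nonneg (by positivity) (hre _ (line_mem_upperHalf hy x))), he]
  refine ENNReal.ofReal_le_ofReal ?_
  have hmem : (((R + y : ℝ) : ℂ) * Complex.I) ∈ upperHalf := by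
    change 0 < (((R + y : ℝ) : ℂ) * Complex.I).im
    rw [Complex.im_ofReal_mul]
    simp
    positivity
  have h1 := (Complex.re_le_norm _).trans (hFJ _ hmem)
  have h2 : ((((R + y : ℝ) : ℂ) * Complex.I)).im = R + y := by
    rw [Complex.im_ofReal_mul]; simp
  rw [h2] at h1
  rw [mul_div_assoc]
  refine mul_le_mul_of_nonneg_left (h1.trans ?_) Real.pi_pos.le
  gcongr
  linarith

/-- The pointwise inequality behind M. Riesz' theorem: in the right half-plane `|w|^p` is dominated
by a multiple of `(Re w)^p`, up to a multiple of the harmonic function `Re w^p`. -/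
theorem exists_norm_rpow_le {p : ℝ} (hp1 : 1 < p) (hp2 : p ≤ 2) :
    ∃ A B : ℝ, 0 ≤ A ∧ 0 ≤ B ∧ ∀ w : ℂ, 0 < w.re →
      ‖w‖ ^ p ≤ A * w.re ^ p - B * (w ^ (p : ℂ)).re := by
  have hpi := Real.pi_pos
  have hp0 : 0 < p := by linarith
  -- an angle `θ₀ < π / 2` with `p θ₀ > π / 2`
  obtain ⟨θ₀, h1, h2⟩ : ∃ θ₀, Real.pi / (2 * p) < θ₀ ∧ θ₀ < Real.pi / 2 := by
    refine exists_between ?_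
    rw [div_lt_div_iff_of_pos_left hpi (by positivity) two_pos]
    linarith
  have h3 : Real.pi / 2 < p * θ₀ := by
    rw [div_lt_iff₀ (by positivity)] at h1
    linarith
  have hθ0 : 0 < θ₀ := lt_trans (by positivity) h1
  set c := -Real.cos (p * θ₀) with hc
  have hpθ : p * θ₀ ≤ Real.pi := by nlinarith
  have hc0 : 0 < c := neg_pos.2 (Real.cos_neg_of_pi_div_two_lt_of_lt h3 (by linarith))
  have hd0 : 0 < Real.cos θ₀ := Real.cos_pos_of_mem_Ioo ⟨by linarith, h2⟩
  set d := Real.cos θ₀ ^ p with hd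
  have hdp : 0 < d := Real.rpow_pos_of_pos hd0 p
  refine ⟨(1 + c⁻¹) / d, c⁻¹, by positivity, by positivity, fun w hw => ?_⟩
  have hw0 : w ≠ 0 := fun h => by simp [h] at hw
  have harg := Complex.abs_arg_lt_pi_div_two_iff.2 (Or.inl hw)
  have hre : w.re = ‖w‖ * Real.cos |Complex.arg w| := by
    rw [Real.cos_abs, Complex.norm_mul_cos_arg]
  have hcpow : (w ^ (p : ℂ)).re = ‖w‖ ^ p * Real.cos (p * |Complex.arg w|) := by
    have e : Real.cos (p * |Complex.arg w|) = Real.cos (Complex.arg w * p) := by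
      rw [← Real.cos_abs (Complex.arg w * p), abs_mul, abs_of_pos hp0, mul_comm]
    rw [e, Complex.cpow_ofReal_re]
  set θ := |Complex.arg w| with hθ
  have hθn : 0 ≤ θ := abs_nonneg _
  have hcos : 0 ≤ Real.cos θ := Real.cos_nonneg_of_mem_Icc ⟨by linarith, harg.le⟩
  have key : 1 ≤ (1 + c⁻¹) / d * Real.cos θ ^ p - c⁻¹ * Real.cos (p * θ) := by
    rcases le_or_gt θ θ₀ with h | h
    · have h4 : Real.cos θ₀ ≤ Real.cos θ :=
        Real.cos_le_cos_of_nonneg_of_le_pi hθn (by linarith) h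
      have h5 : d ≤ Real.cos θ ^ p := Real.rpow_le_rpow hd0.le h4 hp0.le
      have h6 : 1 + c⁻¹ ≤ (1 + c⁻¹) / d * Real.cos θ ^ p := by
        rw [div_mul_eq_mul_div, le_div_iff₀ hdp]
        gcongr
      have h7 : c⁻¹ * Real.cos (p * θ) ≤ c⁻¹ * 1 := by
        gcongr
        exact Real.cos_le_one _
      linarith
    · -- near the imaginary axis the real part of `w ^ p` is negative
      have h4 : Real.cos (p * θ) ≤ Real.cos (p * θ₀) :=
        Real.cos_le_cos_of_nonneg_of_le_pi (by positivity) (by nlinarith) (by nlinarith)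
      have h5 : c⁻¹ * Real.cos (p * θ) ≤ c⁻¹ * (-c) := by
        gcongr
        linarith
      rw [mul_neg, inv_mul_cancel₀ hc0.ne'] at h5
      have h6 : 0 ≤ (1 + c⁻¹) / d * Real.cos θ ^ p := by positivity
      linarith
  rw [hcpow, hre, Real.mul_rpow (norm_nonneg _) hcos]
  have h8 : 0 ≤ ‖w‖ ^ p := by positivity
  nlinarith [mul_le_mul_of_nonneg_left key h8]

/-- The estimate of M. Riesz on horizontal lines, for `1 < p ≤ 2`: apply the Poisson formula to
`(F + δ) ^ p`, which is holomorphic as `F + δ` has positive real part. -/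
theorem exists_lintegral_rpow_line_le {p : ℝ} (hp1 : 1 < p) (hp2 : p ≤ 2) :
    ∃ A : ℝ, 0 ≤ A ∧ ∀ (F : ℂ → ℂ) (J y : ℝ), 0 < y → 0 ≤ J → DifferentiableOn ℂ F upperHalf →
      (∀ z ∈ upperHalf, ‖F z‖ ≤ 2) → (∀ z ∈ upperHalf, 0 ≤ (F z).re) →
      (∀ z ∈ upperHalf, ‖F z‖ ≤ J / z.im) →
      ∫⁻ x : ℝ, ENNReal.ofReal (‖F (x + y * Complex.I)‖ ^ p) ≤ ENNReal.ofReal (A * J) := by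
  obtain ⟨A, B, hA, hB, hAB⟩ := exists_norm_rpow_le hp1 hp2
  have hp0 : 0 < p := by linarith
  have hpi := Real.pi_pos
  refine ⟨A * Real.pi * 2 ^ (p - 1), by positivity, fun F J y hy hJ hF hF2 hre hFJ => ?_⟩
  set c : ℝ → ℝ := fun R => A * Real.pi * 2 ^ (p - 1) * J + B * Real.pi * J ^ p * R ^ (-(p - 1))
    with hc
  have hclim : Tendsto c atTop (𝓝 (A * Real.pi * 2 ^ (p - 1) * J)) := by
    have := (tendsto_rpow_neg_atTop (sub_pos.2 hp1)).const_mul (B * Real.pi * J ^ p)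
    simpa [hc] using this.const_add (A * Real.pi * 2 ^ (p - 1) * J)
  refine lintegral_le_of_poisson (c := c)
    (((continuous_line hF hy).norm.rpow_const fun _ => Or.inr hp0.le).measurable.aemeasurable)
    hclim ?_
  filter_upwards [eventually_gt_atTop 0] with R hR
  have hK : ∀ x : ℝ, 0 < R / (x ^ 2 + R ^ 2) := fun x => by positivity
  set ζ : ℂ := ((R + y : ℝ) : ℂ) * Complex.I with hζ
  have hζim : ζ.im = R + y := by rw [hζ, Complex.im_ofReal_mul]; simp
  have hmem : ζ ∈ upperHalf := by
    change 0 < ζ.im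
    rw [hζim]
    positivity
  have hζJ : ‖F ζ‖ ≤ J / R := by
    refine (hFJ ζ hmem).trans ?_
    rw [hζim]
    gcongr
    linarith
  have hint : Integrable fun x : ℝ =>
      R / (x ^ 2 + R ^ 2) * ‖F (x + y * Complex.I)‖ ^ p := by
    refine (integrable_poissonKernel hR).mul_bdd (c := 2 ^ p)
      ((continuous_line hF hy).norm.rpow_const fun _ => Or.inr hp0.le).aestronglyMeasurable
      (.of_forall fun x => ?_)
    rw [Real.norm_of_nonneg (by positivity)]
    gcongr
    exact hF2 _ (line_mem_upperHalf hy x)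
  -- with `δ = 0` the power would not be differentiable at the zeros of `F`
  have hδ : ∀ δ : ℝ, 0 < δ → ∫ x : ℝ, R / (x ^ 2 + R ^ 2) * ‖F (x + y * Complex.I)‖ ^ p ≤
      A * (2 + δ) ^ (p - 1) * (Real.pi * (J / R + δ)) + B * (Real.pi * (J / R + δ) ^ p) := by
    intro δ hδ
    have hδre : ∀ z ∈ upperHalf, 0 < (F z + δ).re := fun z hz => by
      have := hre z hz
      simp
      linarith
    have hδn : ∀ z ∈ upperHalf, ‖F z + δ‖ ≤ 2 + δ := fun z hz => by
      refine (norm_add_le _ _).trans (add_le_add (hF2 z hz) ?_)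
      rw [Complex.norm_real, Real.norm_of_nonneg hδ.le]
    have hFδ : DifferentiableOn ℂ (fun z => F z + δ) upperHalf := hF.add_const _
    have hFp : DifferentiableOn ℂ (fun z => (F z + δ) ^ (p : ℂ)) upperHalf :=
      hFδ.cpow_const fun z hz => Or.inl (hδre z hz)
    have hFpn : ∀ z ∈ upperHalf, ‖(F z + δ) ^ (p : ℂ)‖ ≤ (2 + δ) ^ p := fun z hz => by
      rw [Complex.norm_cpow_real]
      exact Real.rpow_le_rpow (norm_nonneg _) (hδn z hz) hp0.le
    obtain ⟨hi1, he1⟩ := re_integral_poisson_line hR hy hFδ hδn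
    obtain ⟨hi2, he2⟩ := re_integral_poisson_line hR hy hFp hFpn
    have hζδ : ‖F ζ + δ‖ ≤ J / R + δ := by
      refine (norm_add_le _ _).trans (add_le_add hζJ ?_)
      rw [Complex.norm_real, Real.norm_of_nonneg hδ.le]
    have hmono : ∫ x : ℝ, R / (x ^ 2 + R ^ 2) * ‖F (x + y * Complex.I)‖ ^ p ≤
        ∫ x : ℝ, (A * (2 + δ) ^ (p - 1) *
          (R / (x ^ 2 + R ^ 2) * (F (x + y * Complex.I) + δ).re) -
          B * (R / (x ^ 2 + R ^ 2) * ((F (x + y * Complex.I) + δ) ^ (p : ℂ)).re)) := by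
      refine integral_mono hint ((hi1.const_mul _).sub (hi2.const_mul _)) fun x => ?_
      have hx := line_mem_upperHalf hy x
      set w := F (x + y * Complex.I) with hw
      have hw1 : 0 < (w + δ).re := hδre _ hx
      have hw2 : ‖w‖ ≤ ‖w + δ‖ := by
        have hw0 : 0 ≤ w.re := hre _ hx
        refine (sq_le_sq₀ (norm_nonneg _) (norm_nonneg _)).1 ?_
        rw [← Complex.normSq_eq_norm_sq, ← Complex.normSq_eq_norm_sq, Complex.normSq_apply,
          Complex.normSq_apply]
        simp only [Complex.add_re, Complex.add_im, Complex.ofReal_re, Complex.ofReal_im, add_zero]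
        nlinarith
      have hw3 : (w + δ).re ^ p ≤ (2 + δ) ^ (p - 1) * (w + δ).re := by
        have e : (w + δ).re ^ p = (w + δ).re ^ (p - 1) * (w + δ).re := by
          rw [← Real.rpow_add_one hw1.ne', sub_add_cancel]
        rw [e]
        refine mul_le_mul_of_nonneg_right (Real.rpow_le_rpow hw1.le
          ((Complex.re_le_norm _).trans (hδn _ hx)) (by linarith)) hw1.le
      have hw4 := hAB _ hw1
      have hw5 : ‖w‖ ^ p ≤ ‖w + δ‖ ^ p := Real.rpow_le_rpow (norm_nonneg _) hw2 hp0.le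
      have hw6 := mul_le_mul_of_nonneg_left hw3 hA
      have hw7 : ‖w‖ ^ p ≤ A * ((2 + δ) ^ (p - 1) * (w + δ).re) - B * ((w + δ) ^ (p : ℂ)).re := by
        linarith
      have hw8 := mul_le_mul_of_nonneg_left hw7 (hK x).le
      simp only
      calc _ ≤ _ := hw8
        _ = _ := by ring
    rw [integral_sub (hi1.const_mul _) (hi2.const_mul _), integral_const_mul, integral_const_mul,
      he1, he2] at hmono
    refine hmono.trans ?_
    rw [sub_eq_add_neg]
    refine add_le_add ?_ ?_
    · gcongr
      exact (Complex.re_le_norm _).trans hζδ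
    · rw [← mul_neg, ← mul_neg]
      gcongr
      refine (neg_le_abs _).trans ((Complex.abs_re_le_norm _).trans ?_)
      rw [Complex.norm_cpow_real]
      exact Real.rpow_le_rpow (norm_nonneg _) hζδ hp0.le
  have hlim0 : ∫ x : ℝ, R / (x ^ 2 + R ^ 2) * ‖F (x + y * Complex.I)‖ ^ p ≤
      A * 2 ^ (p - 1) * (Real.pi * (J / R)) + B * (Real.pi * (J / R) ^ p) := by
    have hcont : Continuous fun δ : ℝ =>
        A * (2 + δ) ^ (p - 1) * (Real.pi * (J / R + δ)) + B * (Real.pi * (J / R + δ) ^ p) := by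
      have e1 : Continuous fun δ : ℝ => (2 + δ) ^ (p - 1) :=
        Continuous.rpow_const (by fun_prop) fun _ => Or.inr (by linarith)
      have e2 : Continuous fun δ : ℝ => (J / R + δ) ^ p :=
        Continuous.rpow_const (by fun_prop) fun _ => Or.inr (by linarith)
      fun_prop
    have h0 := (hcont.tendsto 0).mono_left (nhdsWithin_le_nhds (s := Ioi 0))
    simp only [add_zero] at h0
    refine ge_of_tendsto h0 ?_
    filter_upwards [self_mem_nhdsWithin] with δ h
    exact hδ δ h
  rw [← ofReal_integral_eq_lintegral_ofReal hint (.of_forall fun x =>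
    mul_nonneg (hK x).le (by positivity))]
  refine ENNReal.ofReal_le_ofReal (hlim0.trans_eq ?_)
  simp only [hc]
  rw [Real.div_rpow hJ hR.le, Real.rpow_neg hR.le, Real.rpow_sub_one hR.ne']
  have : R ^ p ≠ 0 := (Real.rpow_pos_of_pos hR p).ne'
  field_simp

/-! ### The limit function -/

theorem re_one_sub_nonneg {w : ℂ} (hw : ‖w‖ ≤ 1) : 0 ≤ (1 - w).re := by
  have := (Complex.re_le_norm w).trans hw
  simp
  linarith

theorem norm_one_sub_le_two {w : ℂ} (hw : ‖w‖ ≤ 1) : ‖1 - w‖ ≤ 2 := by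
  refine (norm_sub_le _ _).trans ?_
  rw [norm_one]
  linarith

theorem eLpNorm_le_of_lintegral_rpow_le {f : ℝ → ℂ} {p c : ℝ} (hp : 0 < p) (hc : 0 ≤ c)
    (h : ∫⁻ x, ENNReal.ofReal (‖f x‖ ^ p) ≤ ENNReal.ofReal c) :
    eLpNorm f (ENNReal.ofReal p) volume ≤ ENNReal.ofReal (c ^ (1 / p)) := by
  rw [eLpNorm_eq_lintegral_rpow_enorm_toReal (by simpa using hp) ENNReal.ofReal_ne_top,
    ENNReal.toReal_ofReal hp.le, ← ENNReal.ofReal_rpow_of_nonneg hc (by positivity)]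
  refine ENNReal.rpow_le_rpow ?_ (by positivity)
  refine (lintegral_congr fun x => ?_).trans_le h
  rw [← ENNReal.ofReal_rpow_of_nonneg (norm_nonneg _) hp.le, ofReal_norm]

/-- M. Riesz' estimate on horizontal lines; for `p > 2` it follows from `p = 2`, as
`|F| ≤ 2`. -/
theorem exists_lintegral_rpow_line_le_of_one_lt {p : ℝ} (hp : 1 < p) :
    ∃ A : ℝ, 0 ≤ A ∧ ∀ (F : ℂ → ℂ) (J y : ℝ), 0 < y → 0 ≤ J →
      DifferentiableOn ℂ F upperHalf → (∀ z ∈ upperHalf, ‖F z‖ ≤ 2) →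
      (∀ z ∈ upperHalf, 0 ≤ (F z).re) → (∀ z ∈ upperHalf, ‖F z‖ ≤ J / z.im) →
      ∫⁻ x : ℝ, ENNReal.ofReal (‖F (x + y * Complex.I)‖ ^ p) ≤ ENNReal.ofReal (A * J) := by
  rcases le_or_gt p 2 with hp2 | hp2
  · exact exists_lintegral_rpow_line_le hp hp2
  · obtain ⟨A, hA, hAF⟩ := exists_lintegral_rpow_line_le one_lt_two le_rfl
    refine ⟨2 ^ (p - 2) * A, by positivity, fun F J y hy hJ hF hF2 hre hFJ => ?_⟩
    have h0 : (0 : ℝ) ≤ 2 ^ (p - 2) := by positivity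
    calc ∫⁻ x : ℝ, ENNReal.ofReal (‖F (x + y * Complex.I)‖ ^ p)
        ≤ ∫⁻ x : ℝ, ENNReal.ofReal (2 ^ (p - 2)) *
            ENNReal.ofReal (‖F (x + y * Complex.I)‖ ^ (2 : ℝ)) := by
          refine lintegral_mono fun x => ?_
          rw [← ENNReal.ofReal_mul h0]
          refine ENNReal.ofReal_le_ofReal ?_
          set r := ‖F (x + y * Complex.I)‖
          have hr : r ≤ 2 := hF2 _ (line_mem_upperHalf hy x)
          have hr0 : 0 ≤ r := norm_nonneg _
          have e : r ^ p = r ^ (p - 2) * r ^ (2 : ℝ) := by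
            rw [← Real.rpow_add_of_nonneg hr0 (by linarith) (by norm_num), sub_add_cancel]
          rw [e]
          exact mul_le_mul_of_nonneg_right (Real.rpow_le_rpow hr0 hr (by linarith)) (by positivity)
      _ ≤ ENNReal.ofReal (2 ^ (p - 2)) * ENNReal.ofReal (A * J) := by
          rw [lintegral_const_mul' _ _ ENNReal.ofReal_ne_top]
          gcongr
          exact hAF F J y hy hJ hF hF2 hre hFJ
      _ = ENNReal.ofReal (2 ^ (p - 2) * A * J) := by
          rw [← ENNReal.ofReal_mul h0, mul_assoc]

/-- The `L^p` bound for the boundary function, obtained from the horizontal lines by Fatou's lemma. -/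
theorem exists_lintegral_boundary_rpow_le {p : ℝ} (hp : 1 < p) :
    ∃ A : ℝ, 0 ≤ A ∧ ∀ (G : ℂ → ℂ) (b : ℝ → ℂ) (J : ℝ), 0 ≤ J → DifferentiableOn ℂ G upperHalf →
      (∀ z ∈ upperHalf, ‖G z‖ ≤ 1) → (∀ z ∈ upperHalf, ‖1 - G z‖ ≤ J / z.im) →
      HasBoundaryFunction G b →
      ∫⁻ x : ℝ, ENNReal.ofReal (‖1 - b x‖ ^ p) ≤ ENNReal.ofReal (A * J) := by
  obtain ⟨A, hA, hAF⟩ := exists_lintegral_rpow_line_le_of_one_lt hp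
  refine ⟨A, hA, fun G b J hJ hG hG1 hGJ hb => ?_⟩
  have hn : ∀ n : ℕ, (0 : ℝ) < 1 / ((n : ℝ) + 1) := fun n => by positivity
  have hF : DifferentiableOn ℂ (fun z => 1 - G z) upperHalf := hG.const_sub 1
  set Φ : ℂ → ENNReal := fun z => ENNReal.ofReal (‖1 - z‖ ^ p) with hΦ
  have hpow : Continuous Φ := ENNReal.continuous_ofReal.comp
    (((continuous_const.sub continuous_id).norm).rpow_const fun _ => Or.inr (by linarith))
  have hline : ∀ n : ℕ, ∫⁻ x : ℝ, Φ (G (x + ((1 / ((n : ℝ) + 1) : ℝ) : ℂ) * Complex.I)) ≤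
      ENNReal.ofReal (A * J) := fun n =>
    hAF (fun z => 1 - G z) J _ (hn n) hJ hF (fun z hz => norm_one_sub_le_two (hG1 z hz))
      (fun z hz => re_one_sub_nonneg (hG1 z hz)) hGJ
  change ∫⁻ x : ℝ, Φ (b x) ≤ _
  clear_value Φ
  refine lintegral_le_of_tendsto (fun n => ?_) ?_ (.of_forall hline) tendsto_const_nhds
  · exact (hpow.comp (continuous_line hG (hn n))).measurable.aemeasurable
  · filter_upwards [hb.tendsto_vertical] with x hx
    exact (hpow.tendsto (b x)).comp hx

section Limit

variable {g : ℝ → ℂ → ℂ} {a : ℝ → ℝ → ℂ → ℂ} {J : ℝ → ℝ}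

/-- A family `g t` of functions on the half-plane, whose increments are controlled by functions
`1 - a s t` that are small away from the real line, converges there. -/
theorem exists_tendstoLocallyUniformlyOn (hJ : Tendsto J atTop (𝓝 0))
    (ha : ∀ s t, 0 ≤ t → t ≤ s → ∀ z ∈ upperHalf, ‖1 - a s t z‖ ≤ J t / z.im)
    (hga : ∀ s t, 0 ≤ t → t ≤ s → ∀ z ∈ upperHalf,
      ‖g s z - g t z‖ ^ 2 ≤ 2 * (1 - a s t z).re) :
    ∃ G, TendstoLocallyUniformlyOn g G atTop upperHalf := by
  have hinc : ∀ s t, 0 ≤ t → t ≤ s → ∀ z ∈ upperHalf, ‖g s z - g t z‖ ^ 2 ≤ 2 * (J t / z.im) :=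
    fun s t ht hts z hz => (hga s t ht hts z hz).trans (mul_le_mul_of_nonneg_left
      ((Complex.re_le_norm _).trans (ha s t ht hts z hz)) two_pos.le)
  have hsmall : ∀ y : ℝ, ∀ ε > 0, ∀ᶠ t in atTop, 2 * (J t / y) < ε := fun y ε hε => by
    have h1 : Tendsto (fun t => 2 * (J t / y)) atTop (𝓝 0) := by
      simpa using (hJ.div_const y).const_mul 2
    exact h1.eventually_lt_const hε
  have hlim : ∀ z ∈ upperHalf, ∃ w, Tendsto (fun t => g t z) atTop (𝓝 w) := fun z hz => by
    refine cauchySeq_tendsto_of_complete (Metric.cauchySeq_iff'.2 fun ε hε => ?_)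
    obtain ⟨T, hT, hT0⟩ := ((hsmall z.im _ (pow_pos hε 2)).and (eventually_ge_atTop 0)).exists
    refine ⟨T, fun s hs => ?_⟩
    rw [dist_eq_norm]
    exact lt_of_pow_lt_pow_left₀ 2 hε.le ((hinc s T hT0 hs z hz).trans_lt hT)
  choose! G hG using hlim
  refine ⟨G, Metric.tendstoLocallyUniformlyOn_iff.2 fun ε hε z hz => ?_⟩
  have hz' : 0 < z.im := hz
  refine ⟨{w | z.im / 2 < w.im}, mem_nhdsWithin_of_mem_nhds
    ((isOpen_lt continuous_const Complex.continuous_im).mem_nhds (half_lt_self hz')), ?_⟩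
  filter_upwards [hsmall (z.im / 2) _ (pow_pos hε 2), eventually_ge_atTop 0] with t ht ht0 w hw
  have hw' : z.im / 2 < w.im := hw
  have hwu : w ∈ upperHalf := (half_pos hz').trans hw'
  have hJt : 0 ≤ J t := by
    have h1 := (norm_nonneg _).trans (ha t t ht0 le_rfl z hz)
    rwa [le_div_iff₀ hz', zero_mul] at h1
  rw [dist_eq_norm]
  refine lt_of_pow_lt_pow_left₀ 2 hε.le (lt_of_le_of_lt ?_ ht)
  refine le_of_tendsto (((hG w hwu).sub_const (g t w)).norm.pow 2) ?_
  filter_upwards [eventually_ge_atTop t] with s hs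
  refine (hinc s t ht0 hs w hwu).trans ?_
  gcongr

/-- The distance from `g t` to the limit in `H²`. -/
theorem hardyNorm_two_sub_le {G : ℂ → ℂ} {t : ℝ} (hJ : 0 ≤ J t)
    (hg : ∀ s, t ≤ s → DifferentiableOn ℂ (g s) upperHalf)
    (had : ∀ s, t ≤ s → DifferentiableOn ℂ (a s t) upperHalf)
    (ha1 : ∀ s, t ≤ s → ∀ z ∈ upperHalf, ‖a s t z‖ ≤ 1)
    (ha : ∀ s, t ≤ s → ∀ z ∈ upperHalf, ‖1 - a s t z‖ ≤ J t / z.im)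
    (hga : ∀ s, t ≤ s → ∀ z ∈ upperHalf, ‖g s z - g t z‖ ^ 2 ≤ 2 * (1 - a s t z).re)
    (hG : ∀ z ∈ upperHalf, Tendsto (fun s => g s z) atTop (𝓝 (G z))) :
    hardyNorm 2 (fun z => g t z - G z) ≤
      ENNReal.ofReal ((2 * (Real.pi * J t)) ^ ((1 : ℝ) / 2)) := by
  have hpi := Real.pi_pos
  refine iSup₂_le fun y hy => ?_
  have e2 : (2 : ENNReal) = ENNReal.ofReal 2 := by simp
  rw [e2]
  refine eLpNorm_le_of_lintegral_rpow_le two_pos (by positivity) ?_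
  simp only [Real.rpow_two]
  -- replace `n` by `max n t`, to have a sequence that stays above `t`
  have hmax : Tendsto (fun n : ℕ => max (n : ℝ) t) atTop atTop :=
    tendsto_atTop_mono (fun n => le_max_left _ _) tendsto_natCast_atTop_atTop
  refine lintegral_le_of_tendsto
    (g := fun n x => ENNReal.ofReal (‖g t (x + y * Complex.I) -
      g (max (n : ℝ) t) (x + y * Complex.I)‖ ^ 2))
    (c := fun _ => _) (fun n => ?_) (.of_forall fun x => ?_) (.of_forall fun n => ?_)
    tendsto_const_nhds
  · exact (((continuous_line (hg t le_rfl) hy).sub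
      (continuous_line (hg _ (le_max_right _ _)) hy)).norm.pow 2).measurable.aemeasurable.ennreal_ofReal
  · exact (ENNReal.continuous_ofReal.tendsto _).comp
      ((((hG _ (line_mem_upperHalf hy x)).comp hmax).const_sub _).norm.pow 2)
  · set s := max (n : ℝ) t
    have hs : t ≤ s := le_max_right _ _
    have h1 := lintegral_re_line_le (C := 2) hy hJ ((had s hs).const_sub 1)
      (fun z hz => norm_one_sub_le_two (ha1 s hs z hz))
      (fun z hz => re_one_sub_nonneg (ha1 s hs z hz)) (ha s hs)
    calc ∫⁻ x : ℝ, ENNReal.ofReal (‖g t (x + y * Complex.I) - g s (x + y * Complex.I)‖ ^ 2)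
        ≤ ∫⁻ x : ℝ, ENNReal.ofReal 2 *
            ENNReal.ofReal (1 - a s t (x + y * Complex.I)).re := by
          refine lintegral_mono fun x => ?_
          rw [← ENNReal.ofReal_mul two_pos.le, norm_sub_rev]
          exact ENNReal.ofReal_le_ofReal (hga s hs _ (line_mem_upperHalf hy x))
      _ ≤ ENNReal.ofReal 2 * ENNReal.ofReal (Real.pi * J t) := by
          rw [lintegral_const_mul' _ _ ENNReal.ofReal_ne_top]
          gcongr
      _ = ENNReal.ofReal (2 * (Real.pi * J t)) := (ENNReal.ofReal_mul two_pos.le).symm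

end Limit

theorem hardyNorm_top_le_one {G : ℂ → ℂ} (hG1 : ∀ z ∈ upperHalf, ‖G z‖ ≤ 1) :
    hardyNorm ⊤ G ≤ 1 := by
  refine iSup₂_le fun y hy => ?_
  rw [eLpNorm_exponent_top]
  refine eLpNormEssSup_le_of_ae_enorm_bound (.of_forall fun x => ?_)
  rw [← ofReal_norm]
  exact ENNReal.ofReal_le_one.2 (hG1 _ (line_mem_upperHalf hy x))

/-! ### Conclusion -/

section Propagator

variable {N j : ℕ} (hj : j ≤ N) {lam : Fin N → ℝ} {V : ℝ → Matrix (Fin N) (Fin N) ℂ}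
  {X : ℝ → ℂ → Matrix (Fin N) (Fin N) ℂ}

theorem tendsto_integral_energyDensity (hlam : StrictMono lam)
    (hV : ∀ m n : Fin N, LocallyIntegrableOn (fun t => V t m n) (Ici (0 : ℝ)))
    (hI : potentialEnergy j lam V < ⊤) :
    Tendsto (fun t => ∫ r in Ioi t, energyDensity hj lam V r) atTop (𝓝 0) := by
  have hint : IntegrableOn (energyDensity hj lam V) (Ioi 0) :=
    (integrableOn_energyDensity hj hlam hV hI).mono_set Ioi_subset_Ici_self
  have h1 := intervalIntegral_tendsto_integral_Ioi 0 hint tendsto_id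
  have h2 := h1.const_sub (∫ r in Ioi 0, energyDensity hj lam V r)
  rw [sub_self] at h2
  refine h2.congr' ?_
  filter_upwards [eventually_ge_atTop 0] with t ht
  have h3 := intervalIntegral.integral_interval_add_Ioi' (a := 0) (b := t)
    ((intervalIntegrable_iff_integrableOn_Ioc_of_le ht).2 (hint.mono_set Ioc_subset_Ioi_self))
    (hint.mono_set (Ioi_subset_Ioi ht))
  simp only [id]
  linarith

theorem norm_one_sub_propagatorMinor_le (hX : IsEvolution lam V X)
    (hV : ∀ m n : Fin N, LocallyIntegrableOn (fun t => V t m n) (Ici (0 : ℝ)))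
    (hH : ∀ᵐ t ∂(volume.restrict (Ici (0 : ℝ))), (V t).IsHermitian) (hlam : StrictMono lam)
    (hD : ∀ᵐ t ∂(volume.restrict (Ici (0 : ℝ))), ∀ m : Fin N, V t m m = 0)
    (hI : potentialEnergy j lam V < ⊤) {k : ℂ} (hk : 0 < k.im) {s t : ℝ}
    (ht : 0 ≤ t) (hts : t ≤ s) :
    ‖1 - propagatorMinor hj lam X s k (Fin.castLE hj) t‖ ≤
      (∫ r in Ioi t, energyDensity hj lam V r) / k.im := by
  have hint : IntegrableOn (energyDensity hj lam V) (Ioi t) :=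
    (integrableOn_energyDensity hj hlam hV hI).mono_set
      fun r hr => ht.trans (mem_Ioi.1 hr).le
  have h1 := norm_sq_one_sub_propagatorMinor_le hj hX hV hH hlam hD hI hk ht hts
  have ha1 := norm_propagatorMinor_le_one hj hX hV hH hlam hk ht hts
  set w := propagatorMinor hj lam X s k (Fin.castLE hj) t
  have hle : ∫ r in t..s, energyDensity hj lam V r ≤ ∫ r in Ioi t, energyDensity hj lam V r := by
    rw [intervalIntegral.integral_of_le hts]
    exact setIntegral_mono_set hint (.of_forall fun r => energyDensity_nonneg hj hlam r)
      Ioc_subset_Ioi_self.eventuallyLE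
  have h0 : 0 ≤ ∫ r in t..s, energyDensity hj lam V r :=
    intervalIntegral.integral_nonneg hts fun r _ => energyDensity_nonneg hj hlam r
  set P := ∫ r in t..s, energyDensity hj lam V r
  set Q := ∫ r in Ioi t, energyDensity hj lam V r
  have h2 : 1 - ‖w‖ ≤ ‖1 - w‖ := by
    have := norm_sub_norm_le 1 w
    rwa [norm_one] at this
  have h3 : 1 - ‖w‖ ^ 2 ≤ 2 * ‖1 - w‖ := by nlinarith [norm_nonneg w, norm_nonneg (1 - w)]
  have h4 : k.im * ‖1 - w‖ ^ 2 ≤ Q * ‖1 - w‖ := by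
    nlinarith [mul_le_mul_of_nonneg_left h3 h0,
      mul_le_mul_of_nonneg_right hle (norm_nonneg (1 - w))]
  rw [le_div_iff₀ hk]
  rcases (norm_nonneg (1 - w)).eq_or_lt with h | h
  · rw [← h, zero_mul]
    exact h0.trans hle
  · nlinarith

end Propagator

theorem mainTheorem1 :
    ∃ C : ℝ → ℝ,
      ∀ (N j : ℕ) (hj1 : 1 ≤ j) (hjN : j ≤ N)
        (lam : Fin N → ℝ) (V : ℝ → Matrix (Fin N) (Fin N) ℂ)
        (X : ℝ → ℂ → Matrix (Fin N) (Fin N) ℂ),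
        StrictMono lam →
        lam ⟨0, lt_of_lt_of_le hj1 hjN⟩ = 0 →
        (∀ m n : Fin N, LocallyIntegrableOn (fun t => V t m n) (Ici (0 : ℝ))) →
        (∀ᵐ t ∂(volume.restrict (Ici (0 : ℝ))), (V t).IsHermitian) →
        (∀ᵐ t ∂(volume.restrict (Ici (0 : ℝ))), ∀ m : Fin N, V t m m = 0) →
        IsEvolution lam V X →
        potentialEnergy j lam V < ⊤ →
        ∃ (G : ℂ → ℂ) (b : ℝ → ℂ),
          -- the limit lies in the unit ball of `H^∞(ℂ⁺)`, and `b` is its boundary function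
          MemHardy ⊤ G ∧ hardyNorm ⊤ G ≤ 1 ∧ HasBoundaryFunction G b ∧
          -- convergence in `ℂ⁺`, uniformly on compact subsets
          TendstoLocallyUniformlyOn (normalizedMinor hjN lam X) G atTop upperHalf ∧
          -- convergence in `H²(ℂ⁺)`
          (∀ t : ℝ, 0 ≤ t → MemHardy 2 (fun k => normalizedMinor hjN lam X t k - G k)) ∧
          Tendsto (fun t : ℝ => hardyNorm 2 (fun k => normalizedMinor hjN lam X t k - G k))
            atTop (𝓝 0) ∧
          -- the logarithmic integral
          (∀ᵐ x : ℝ, b x ≠ 0) ∧ Integrable (fun x : ℝ => Real.log ‖b x‖) ∧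
          (∫ x : ℝ, Real.log ‖b x‖) ≤ 0 ∧
          -(Real.pi * (potentialEnergy j lam V).toReal) ≤ (∫ x : ℝ, Real.log ‖b x‖) ∧
          -- the `L^p` bounds
          ∀ p : ℝ, 1 < p →
            MemLp (fun x : ℝ => 1 - b x) (ENNReal.ofReal p) volume ∧
            (∫ x : ℝ, ‖1 - b x‖ ^ p) ≤ C p * (potentialEnergy j lam V).toReal := by
  choose! A hA0 hA using fun (p : ℝ) (hp : 1 < p) => exists_lintegral_boundary_rpow_le hp
  refine ⟨A, ?_⟩
  intro N j hj1 hj lam V X hlam hlam0 hV hH hD hX hI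
  have hlam' : ∀ a, 0 ≤ lam a := fun a => by
    rw [← hlam0]
    exact hlam.monotone (Fin.le_def.2 (Nat.zero_le _))
  set E := (potentialEnergy j lam V).toReal with hE
  set g := normalizedMinor hj lam X with hg
  set a : ℝ → ℝ → ℂ → ℂ := fun s t k => propagatorMinor hj lam X s k (Fin.castLE hj) t with ha
  set J : ℝ → ℝ := fun t => ∫ r in Ioi t, energyDensity hj lam V r with hJ
  have hE0 : 0 ≤ E := ENNReal.toReal_nonneg
  have hJ0 : ∀ t, 0 ≤ J t := fun t => integral_nonneg fun r => energyDensity_nonneg hj hlam r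
  have hJE : J 0 = E := by
    rw [hE, ← integral_energyDensity hj hlam hV, integral_Ici_eq_integral_Ioi]
  have hJlim : Tendsto J atTop (𝓝 0) := tendsto_integral_energyDensity hj hlam hV hI
  have had : ∀ s t, 0 ≤ t → t ≤ s → DifferentiableOn ℂ (a s t) upperHalf :=
    fun s t ht hts z hz => (differentiableAt_propagatorMinor hj hX hV hH hlam' hz
      (ht.trans hts) ht).differentiableWithinAt
  have ha1 : ∀ s t, 0 ≤ t → t ≤ s → ∀ z ∈ upperHalf, ‖a s t z‖ ≤ 1 :=
    fun s t ht hts z hz => norm_propagatorMinor_le_one hj hX hV hH hlam hz ht hts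
  have haJ : ∀ s t, 0 ≤ t → t ≤ s → ∀ z ∈ upperHalf, ‖1 - a s t z‖ ≤ J t / z.im :=
    fun s t ht hts z hz => norm_one_sub_propagatorMinor_le hj hX hV hH hlam hD hI hz ht hts
  have hga : ∀ s t, 0 ≤ t → t ≤ s → ∀ z ∈ upperHalf,
      ‖g s z - g t z‖ ^ 2 ≤ 2 * (1 - a s t z).re :=
    fun s t ht hts z hz => norm_sq_normalizedMinor_sub_le hj hX hV hH hlam hz ht hts
  have hag : ∀ s, a s 0 = g s := fun s => funext fun z => propagatorMinor_zero hj hX s z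
  have hgd : ∀ s, 0 ≤ s → DifferentiableOn ℂ (g s) upperHalf :=
    fun s hs => hag s ▸ had s 0 le_rfl hs
  obtain ⟨G, hG⟩ := exists_tendstoLocallyUniformlyOn hJlim haJ hga
  have hGpt : ∀ z ∈ upperHalf, Tendsto (fun s => g s z) atTop (𝓝 (G z)) :=
    fun z hz => hG.tendsto_at hz
  have hGd : DifferentiableOn ℂ G upperHalf :=
    hG.differentiableOn ((eventually_ge_atTop 0).mono hgd) isOpen_upperHalf
  have hG1 : ∀ z ∈ upperHalf, ‖G z‖ ≤ 1 := fun z hz =>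
    le_of_tendsto (hGpt z hz).norm ((eventually_ge_atTop 0).mono fun s hs => by
      rw [← hag]
      exact ha1 s 0 le_rfl hs z hz)
  have hGE : ∀ z ∈ upperHalf, ‖1 - G z‖ ≤ E / z.im := fun z hz =>
    le_of_tendsto ((hGpt z hz).const_sub 1).norm ((eventually_ge_atTop 0).mono fun s hs => by
      rw [← hag, ← hJE]
      exact haJ s 0 le_rfl hs z hz)
  have hH2 : ∀ t, 0 ≤ t → hardyNorm 2 (fun k => g t k - G k) ≤
      ENNReal.ofReal ((2 * (Real.pi * J t)) ^ ((1 : ℝ) / 2)) := fun t ht =>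
    hardyNorm_two_sub_le (a := a) (hJ0 t) (fun s hs => hgd s (ht.trans hs))
      (fun s hs => had s t ht hs) (fun s hs => ha1 s t ht hs) (fun s hs => haJ s t ht hs)
      (fun s hs => hga s t ht hs) hGpt
  obtain ⟨b, hb⟩ := exists_hasBoundaryFunction hGd hG1
  have hbm := hb.aemeasurable hGd
  obtain ⟨hb0, hlogi, hlog0, hlogE⟩ := log_boundary_integrable hE0 hGd hG1 hGE hb
  have hGtop := hardyNorm_top_le_one hG1
  refine ⟨G, b, ⟨hGd, hGtop.trans_lt ENNReal.one_lt_top⟩, hGtop, hb, hG,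
    fun t ht => ⟨(hgd t ht).sub hGd, (hH2 t ht).trans_lt ENNReal.ofReal_lt_top⟩, ?_,
    hb0, hlogi, hlog0, hlogE, fun p hp => ?_⟩
  · have h1 : Tendsto (fun t => ENNReal.ofReal ((2 * (Real.pi * J t)) ^ ((1 : ℝ) / 2))) atTop
        (𝓝 0) := by
      have h2 := (((hJlim.const_mul Real.pi).const_mul 2).rpow_const
        (p := (1 : ℝ) / 2) (Or.inr (by norm_num)))
      have h3 := (ENNReal.continuous_ofReal.tendsto _).comp h2
      simpa [Function.comp_def] using h3
    exact tendsto_of_tendsto_of_tendsto_of_le_of_le' tendsto_const_nhds h1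
      (.of_forall fun _ => zero_le) ((eventually_ge_atTop 0).mono hH2)
  · have hp0 : 0 < p := one_pos.trans hp
    have h1 := hA p hp G b E hE0 hGd hG1 hGE hb
    have hAE : 0 ≤ A p * E := mul_nonneg (hA0 p hp) hE0
    have hm : AEStronglyMeasurable (fun x => 1 - b x) :=
      (hbm.const_sub 1).aestronglyMeasurable
    refine ⟨⟨hm, (eLpNorm_le_of_lintegral_rpow_le hp0 hAE h1).trans_lt ENNReal.ofReal_lt_top⟩, ?_⟩
    rw [integral_eq_lintegral_of_nonneg_ae (.of_forall fun x => by positivity)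
      (hm.norm.aemeasurable.pow_const p).aestronglyMeasurable]
    exact ENNReal.toReal_le_of_le_ofReal hAE h1
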